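/- Let $U,V,W$ be real Banach spaces, $T>0$, and let $\omega$ be a control on $[0,T]$: a non-negative function $\omega_{s,t}$ of $0\le s\le t\le T$ with $\omega_{r,s}+\omega_{s,t}\le\omega_{r,t}$ that is continuous at the diagonal. Let $U\otimes V$ denote the completed projective tensor product. For a two-parameter family $A$ put $\|A\|_p=\sup_{s<t}|A_{s,t}|/\omega_{s,t}^{1/p}$ (the least $C\ge 0$ with $|A_{s,t}|\le C\omega_{s,t}^{1/p}$); write $y_{s,t}=y_t-y_s$ for a path $y$. Let $2\le p<3$ and let $\mathbf x=1+\mathbf x^1+\mathbf x^2:[0,T]\to 1\oplus U\oplus(U\otimes U)$ be a rough path of finite $p$-variation controlled by $\omega$, i.e. the increments $\mathbf x_{s,t}=\mathbf x_s^{-1}\otimes\mathbf x_t$ satisfy $\|\mathbf x^1\|_p<\infty$ and $\|\mathbf x^2\|_{p/2}<\infty$. For a Banach space $E$ let $P_{p,p,p/2}(\mathbf x,E)$ be the space of controlled rough paths, that is, of pairs $(y,y^\dagger)$ with $y:[0,T]\to E$, $y^\dagger:[0,T]\to L(U,E)$, such that $\|y^\dagger\|_p<\infty$ and $y^\sharp_{s,t}:=y_{s,t}-y^\dagger_s\mathbf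 x^1_{s,t}$ satisfies $\|y^\sharp\|_{p/2}<\infty$, with the norm $|y_0|+|y^\dagger_0|+\|y^\dagger\|_p+\|y^\sharp\|_{p/2}$. For $n\in\mathbb N$ and $0<\alpha\le 1$, a map between Banach spaces is of class $\mathcal C^{n+\alpha}$ on an open set if it is $n$ times continuously Fréchet differentiable there, its derivatives of order $0,\dots,n$ are bounded and the one of order $n$ is $\alpha$-Hölder continuous; $\mathcal C^{n+\alpha}(E,F)$ is the space of maps of this class on all of $E$, normed by the maximum of the sup norms of the derivatives of order $0,\dots,n$ and of the $\alpha$-Hölder seminorm of the one of order $n$. A map is locally of class $\mathcal C^{n+\alpha}$ if every point has an open neighbourhood on which it is of class $\mathcal C^{n+\alpha}$. For $z\in P_{p,p,p/2}(\mathbf x,W)$ let $z^\flat_{s,t}\in U\otimes W$ be the family with $z^\flat_{r,s}+z^\flat_{s,t}+\mathbf x^1_{r,s}\otimes z_{s,t}=z^\flat_{r,t}$ for $r\le s\le t$ and $|z^\flat_{s,t}-(\mathrm{Id}\otimes z^\dagger_s)\mathbf x^2_{s,t}|\le K\omega_{s,t}^{\theta}$ for some $K$ and some $\theta>1$. For a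 path $Y$ in $L(W,V)$ with derivative $Y^\dagger$ in $L(U,L(W,V))$, identified with $L(U\otimes W,V)$, the integral $\int_0^\cdot Y\,dz$ is the path that starts from $0$ and satisfies $|\int_s^t Y\,dz-Y_sz_{s,t}-Y^\dagger_sz^\flat_{s,t}|\le K\omega_{s,t}^{\theta}$ for some $K$ and some $\theta>1$. For $y\in P_{p,p,p/2}(\mathbf x,V)$, the integrand $f(y)$ has the derivative $f(y)^\dagger=Df(y)\,y^\dagger$. **Theorem.** Let $2\le p<3$, let $\mathbf x$ be a rough path as above, let $k\ge 1$ be an integer, $\gamma\in(0,1]$ and $\kappa\in(0,1)$ with $2+\kappa\gamma>p$. For every $a\in V$, $b\in L(W,V)$, $f\in\mathcal C^{k+1+\gamma}(V,L(W,V))$ and $z\in P_{p,p,p/2}(\mathbf x,W)$ there is a unique $(y,y^\dagger)\in P_{p,p,p/2}(\mathbf x,V)$ with $$y_t=a+\int_0^t f(y_s)\,dz_s+b\,z_{0,t},\qquad y^\dagger_t=f(y_t)z^\dagger_t+b\,z^\dagger_t,\qquad t\in[0,T],$$ and the Itô map $(a,b,f,z)\mapsto(y,y^\dagger)$, $$V\times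 L(W,V)\times\mathcal C^{k+1+\gamma}(V,L(W,V))\times P_{p,p,p/2}(\mathbf x,W)\to P_{p,p,p/2}(\mathbf x,V),$$ is locally of class $\mathcal C^{k+(1-\kappa)\gamma}$. -/

import Mathlib

open scoped TensorProduct Topology

noncomputable section

namespace RoughIto

/-! ### Norms given by a smallest constant -/

/-- The smallest non-negative constant `C` such that `P C` holds. -/
def leastConst (P : ℝ → Prop) : ℝ := sInf {C | 0 ≤ C ∧ P C}

lemma leastConst_nonneg (P : ℝ → Prop) : 0 ≤ leastConst P :=
  Real.sInf_nonneg fun _ h => h.1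

lemma leastConst_le {P : ℝ → Prop} {C : ℝ} (h0 : 0 ≤ C) (h : P C) : leastConst P ≤ C :=
  csInf_le ⟨0, fun _ h => h.1⟩ ⟨h0, h⟩

lemma le_leastConst {P : ℝ → Prop} (hne : ∃ C, 0 ≤ C ∧ P C) {a : ℝ}
    (h : ∀ C, 0 ≤ C → P C → a ≤ C) : a ≤ leastConst P :=
  le_csInf hne fun C hC => h C hC.1 hC.2

lemma le_leastConst_mul {P : ℝ → Prop} (hne : ∃ C, 0 ≤ C ∧ P C) {a w : ℝ} (hw : 0 ≤ w)
    (h : ∀ C, 0 ≤ C → P C → a ≤ C * w) : a ≤ leastConst P * w := by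
  rcases hw.eq_or_lt with rfl | hw
  · obtain ⟨C, h0, hC⟩ := hne
    simpa using h C h0 hC
  · rw [← div_le_iff₀ hw]
    exact le_leastConst hne fun C h0 hC => (div_le_iff₀ hw).2 (h C h0 hC)

lemma leastConst_smul_le {E : Type*} [AddCommGroup E] [Module ℝ E] {P : E → ℝ → Prop}
    (hex : ∀ x, ∃ C, 0 ≤ C ∧ P x C)
    (hsmul : ∀ (c : ℝ) x C, P x C → P (c • x) (|c| * C)) (c : ℝ) (x : E) :
    leastConst (P (c • x)) ≤ |c| * leastConst (P x) := by
  rw [mul_comm]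
  refine le_leastConst_mul (hex x) (abs_nonneg c) fun C h0 hC => ?_
  rw [mul_comm]
  exact leastConst_le (by positivity) (hsmul c x C hC)

lemma leastConst_smul {E : Type*} [AddCommGroup E] [Module ℝ E] {P : E → ℝ → Prop}
    (hex : ∀ x, ∃ C, 0 ≤ C ∧ P x C)
    (hsmul : ∀ (c : ℝ) x C, P x C → P (c • x) (|c| * C)) (c : ℝ) (x : E) :
    leastConst (P (c • x)) = |c| * leastConst (P x) := by
  refine le_antisymm (leastConst_smul_le hex hsmul c x) ?_
  rcases eq_or_ne c 0 with rfl | hc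
  · simpa using leastConst_nonneg _
  · have h := leastConst_smul_le hex hsmul c⁻¹ (c • x)
    rw [inv_smul_smul₀ hc, abs_inv] at h
    rwa [le_inv_mul_iff₀ (abs_pos.2 hc)] at h

lemma leastConst_add_le {E : Type*} [AddCommGroup E] {P : E → ℝ → Prop}
    (hex : ∀ x, ∃ C, 0 ≤ C ∧ P x C)
    (hadd : ∀ x y C D, P x C → P y D → P (x + y) (C + D)) (x y : E) :
    leastConst (P (x + y)) ≤ leastConst (P x) + leastConst (P y) := by
  rw [← sub_le_iff_le_add]
  refine le_leastConst (hex x) fun C hC0 hC => ?_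
  rw [sub_le_comm]
  refine le_leastConst (hex y) fun D hD0 hD => ?_
  rw [sub_le_iff_le_add, add_comm D]
  exact leastConst_le (by positivity) (hadd x y C D hC hD)

/-! ### The projective tensor product of two Banach spaces -/

section Tensor

variable (U V : Type*) [NormedAddCommGroup U] [NormedSpace ℝ U]
  [NormedAddCommGroup V] [NormedSpace ℝ V]

/-- The algebraic tensor product, which is given the projective seminorm below. -/
def AlgTensor : Type _ := U ⊗[ℝ] V

instance : AddCommGroup (AlgTensor U V) := inferInstanceAs (AddCommGroup (U ⊗[ℝ] V))
instance : Module ℝ (AlgTensor U V) := inferInstanceAs (Module ℝ (U ⊗[ℝ] V))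

variable {U V}

/-- `t` has a decomposition `∑ uᵢ ⊗ vᵢ` with `∑ ‖uᵢ‖ ‖vᵢ‖ = C`. -/
def HasDecomp (t : AlgTensor U V) (C : ℝ) : Prop :=
  ∃ l : List (U × V), (l.map fun m => (m.1 ⊗ₜ[ℝ] m.2 : U ⊗[ℝ] V)).sum = t ∧
    (l.map fun m => ‖m.1‖ * ‖m.2‖).sum = C

lemma HasDecomp.add {s t : AlgTensor U V} {C D : ℝ} (hs : HasDecomp s C) (ht : HasDecomp t D) :
    HasDecomp (s + t) (C + D) := by
  obtain ⟨l, h1, h2⟩ := hs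
  obtain ⟨m, h3, h4⟩ := ht
  refine ⟨l ++ m, ?_, ?_⟩
  · rw [List.map_append, List.sum_append, h1, h3]; rfl
  · rw [List.map_append, List.sum_append, h2, h4]

lemma HasDecomp.smul (c : ℝ) {t : AlgTensor U V} {C : ℝ} (ht : HasDecomp t C) :
    HasDecomp (c • t) (|c| * C) := by
  obtain ⟨l, h1, h2⟩ := ht
  refine ⟨l.map fun m => (c • m.1, m.2), ?_, ?_⟩
  · subst h1
    change _ = c • (l.map fun m => (m.1 ⊗ₜ[ℝ] m.2 : U ⊗[ℝ] V)).sum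
    rw [List.smul_sum]
    simp [List.map_map, Function.comp_def, TensorProduct.smul_tmul']
  · subst h2
    rw [← List.sum_map_mul_left]
    simp [List.map_map, Function.comp_def, norm_smul, mul_assoc]

lemma HasDecomp.exists (t : AlgTensor U V) : ∃ C, 0 ≤ C ∧ HasDecomp t C := by
  suffices h : ∃ C, HasDecomp t C by
    obtain ⟨C, l, h1, h2⟩ := h
    refine ⟨C, ?_, l, h1, h2⟩
    rw [← h2]
    refine List.sum_nonneg fun a ha => ?_
    obtain ⟨m, -, rfl⟩ := List.mem_map.1 ha
    positivity
  refine TensorProduct.induction_on (motive := fun t : U ⊗[ℝ] V => ∃ C, HasDecomp (U := U) (V := V) t C)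
    t ?_ ?_ ?_
  · exact ⟨0, [], by simp⟩
  · exact fun u v => ⟨‖u‖ * ‖v‖, [(u, v)], by simp⟩
  · rintro s t ⟨C, hC⟩ ⟨D, hD⟩
    exact ⟨C + D, HasDecomp.add (U := U) (V := V) hC hD⟩

/-- The projective seminorm: the infimum of `∑ ‖uᵢ‖ ‖vᵢ‖` over all decompositions. -/
instance : Norm (AlgTensor U V) := ⟨fun t => leastConst (HasDecomp t)⟩

lemma algTensor_core : SeminormedSpace.Core ℝ (AlgTensor U V) where
  norm_nonneg _ := leastConst_nonneg _
  norm_smul c t := leastConst_smul HasDecomp.exists (fun c _ _ h => h.smul c) c t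
  norm_triangle s t := leastConst_add_le HasDecomp.exists (fun _ _ _ _ h h' => h.add h') s t

instance : SeminormedAddCommGroup (AlgTensor U V) := SeminormedAddCommGroup.ofCore algTensor_core
instance : NormedSpace ℝ (AlgTensor U V) := ⟨fun c t => (algTensor_core.norm_smul c t).le⟩

variable (U V) in
/-- The completed projective tensor product `U ⊗ V` of two Banach spaces. -/
abbrev Tensor : Type _ := UniformSpace.Completion (AlgTensor U V)

variable (U V) in
/-- The canonical continuous bilinear map `(u, v) ↦ u ⊗ v`. -/
def tmul : U →L[ℝ] V →L[ℝ] Tensor U V :=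
  LinearMap.mkContinuous₂
    (LinearMap.compr₂ (TensorProduct.mk ℝ U V)
      ((UniformSpace.Completion.toComplL : AlgTensor U V →L[ℝ] Tensor U V) :
        AlgTensor U V →ₗ[ℝ] Tensor U V)) 1 fun u v => by
    have h : HasDecomp (U := U) (V := V) (u ⊗ₜ[ℝ] v : U ⊗[ℝ] V) (‖u‖ * ‖v‖) :=
      ⟨[(u, v)], by simp⟩
    rw [one_mul]
    refine le_trans (le_of_eq ?_) (leastConst_le (by positivity) h)
    exact UniformSpace.Completion.norm_coe _

variable {E : Type*} [NormedAddCommGroup E] [NormedSpace ℝ E]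

/-- The linear map on the algebraic tensor product induced by a bounded bilinear map. -/
def linLift (B : U →L[ℝ] V →L[ℝ] E) : U ⊗[ℝ] V →ₗ[ℝ] E :=
  TensorProduct.lift (LinearMap.mk₂ ℝ (fun u v => B u v) (by simp) (by simp) (by simp) (by simp))

lemma linLift_tmul (B : U →L[ℝ] V →L[ℝ] E) (u : U) (v : V) : linLift B (u ⊗ₜ[ℝ] v) = B u v := by
  simp [linLift]

lemma norm_linLift_sum_le (B : U →L[ℝ] V →L[ℝ] E) (l : List (U × V)) :
    ‖linLift B (l.map fun m => (m.1 ⊗ₜ[ℝ] m.2 : U ⊗[ℝ] V)).sum‖ ≤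
      (l.map fun m => ‖m.1‖ * ‖m.2‖).sum * ‖B‖ := by
  induction l with
  | nil => simp
  | cons m l ih =>
    simp only [List.map_cons, List.sum_cons, map_add, linLift_tmul, add_mul]
    refine (norm_add_le _ _).trans (add_le_add ?_ ih)
    calc ‖B m.1 m.2‖ ≤ ‖B‖ * ‖m.1‖ * ‖m.2‖ := B.le_opNorm₂ _ _
      _ = ‖m.1‖ * ‖m.2‖ * ‖B‖ := by ring

/-- `linLift B` is bounded for the projective seminorm. -/
def algLift (B : U →L[ℝ] V →L[ℝ] E) : AlgTensor U V →L[ℝ] E :=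
  LinearMap.mkContinuous (E := AlgTensor U V) (linLift B) ‖B‖ fun t => by
    rw [mul_comm]
    refine le_leastConst_mul (HasDecomp.exists t) (norm_nonneg B) ?_
    rintro C - ⟨l, rfl, rfl⟩
    exact norm_linLift_sum_le B l

/-- The identification of bounded bilinear maps `U × V → E` with bounded linear maps
`U ⊗ V → E`. -/
def tlift [CompleteSpace E] (B : U →L[ℝ] V →L[ℝ] E) : Tensor U V →L[ℝ] E :=
  (algLift B).fromCompletion

lemma tlift_tmul [CompleteSpace E] (B : U →L[ℝ] V →L[ℝ] E) (u : U) (v : V) :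
    tlift B (tmul U V u v) = B u v := by
  refine (ContinuousLinearMap.fromCompletion_apply_coe (algLift B)
    (show AlgTensor U V from (u ⊗ₜ[ℝ] v : U ⊗[ℝ] V))).trans ?_
  exact linLift_tmul B u v

/-- The extension of `A : U → V` to the map `U ⊗ U → U ⊗ V`, `a ⊗ b ↦ a ⊗ A b`. -/
def idTensor (A : U →L[ℝ] V) : Tensor U U →L[ℝ] Tensor U V :=
  tlift ((tmul U V).bilinearComp (ContinuousLinearMap.id ℝ U) A)

lemma idTensor_tmul (A : U →L[ℝ] V) (a b : U) :
    idTensor A (tmul U U a b) = tmul U V a (A b) := by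
  rw [idTensor, tlift_tmul]; rfl

end Tensor

/-! ### Controls and rough paths -/

/-- The time interval `[0, T]`. -/
abbrev Time (T : ℝ) : Type := Set.Icc (0 : ℝ) T

/-- The initial time `0`. -/
def t0 {T : ℝ} [hT : Fact (0 < T)] : Time T := ⟨0, le_rfl, hT.out.le⟩

lemma t0_le {T : ℝ} [Fact (0 < T)] (t : Time T) : t0 ≤ t := t.2.1

/-- A control: a non-negative super-additive function of the intervals `[s, t] ⊆ [0, T]` which is
continuous at the diagonal. Only the values `ω s t` with `s ≤ t` matter. -/
structure Control (T : ℝ) where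
  toFun : Time T → Time T → ℝ
  nonneg : ∀ s t, s ≤ t → 0 ≤ toFun s t
  superadd : ∀ r s t, r ≤ s → s ≤ t → toFun r s + toFun s t ≤ toFun r t
  cont_diag : ∀ t, ContinuousWithinAt (fun a : Time T × Time T => toFun a.1 a.2)
    {a | a.1 ≤ a.2} (t, t)

instance {T : ℝ} : CoeFun (Control T) fun _ => Time T → Time T → ℝ := ⟨Control.toFun⟩

lemma Control.rpow_nonneg {T : ℝ} (ω : Control T) (e : ℝ) {s t : Time T} (h : s ≤ t) :
    0 ≤ ω s t ^ e := Real.rpow_nonneg (ω.nonneg s t h) e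

/-- A family indexed by the intervals `[s, t]` is bounded by `C ω(s, t) ^ (1 / p)`. -/
def VarBound {T : ℝ} (ω : Control T) (p : ℝ) {E : Type*} [NormedAddCommGroup E]
    (A : Time T → Time T → E) (C : ℝ) : Prop :=
  ∀ s t, s ≤ t → ‖A s t‖ ≤ C * ω s t ^ (1 / p)

/-- The `p`-variation seminorm `sup ‖A s t‖ / ω(s, t) ^ (1 / p)`. -/
def varNorm {T : ℝ} (ω : Control T) (p : ℝ) {E : Type*} [NormedAddCommGroup E]
    (A : Time T → Time T → E) : ℝ := leastConst (VarBound ω p A)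

/-- A rough path `1 + x¹ + x²` with values in `1 ⊕ U ⊕ (U ⊗ U)`, of finite `p`-variation
controlled by `ω`. Its increment over `[s, t]` is the product `(1 + x¹ₛ + x²ₛ)⁻¹ ⊗ (1 + x¹ₜ + x²ₜ)`
in the truncated tensor algebra, whose components are `x¹ₜ - x¹ₛ` and
`x²ₜ - x²ₛ - x¹ₛ ⊗ (x¹ₜ - x¹ₛ)`. -/
structure RoughPath {T : ℝ} (ω : Control T) (p : ℝ)
    (U : Type*) [NormedAddCommGroup U] [NormedSpace ℝ U] where
  lev1 : Time T → U
  lev2 : Time T → Tensor U U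
  bound1 : ∃ C, VarBound ω p (fun s t => lev1 t - lev1 s) C
  bound2 : ∃ C, VarBound ω (p / 2)
    (fun s t => lev2 t - lev2 s - tmul U U (lev1 s) (lev1 t - lev1 s)) C

section CRP

variable {T : ℝ} {ω : Control T} {p : ℝ}
variable {U : Type*} [NormedAddCommGroup U] [NormedSpace ℝ U]

/-- The increment `x¹_{s,t}`. -/
def RoughPath.inc1 (x : RoughPath ω p U) (s t : Time T) : U := x.lev1 t - x.lev1 s

/-- The increment `x²_{s,t}`. -/
def RoughPath.inc2 (x : RoughPath ω p U) (s t : Time T) : Tensor U U :=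
  x.lev2 t - x.lev2 s - tmul U U (x.lev1 s) (x.lev1 t - x.lev1 s)

/-- The multiplicative property of the increments. -/
lemma RoughPath.inc2_mul (x : RoughPath ω p U) (r s t : Time T) :
    x.inc2 r t = x.inc2 r s + x.inc2 s t + tmul U U (x.inc1 r s) (x.inc1 s t) := by
  simp only [RoughPath.inc2, RoughPath.inc1, map_sub, sub_apply]
  abel

/-! ### Controlled rough paths -/

variable (x : RoughPath ω p U) (q r : ℝ) {V : Type*} [NormedAddCommGroup V] [NormedSpace ℝ V]

/-- The remainder `y♯_{s,t} = y_{s,t} - y†_s x¹_{s,t}` of a pair of paths `(y, y†)`. -/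
def remainder (y : (Time T → V) × (Time T → (U →L[ℝ] V))) (s t : Time T) : V :=
  y.1 t - y.1 s - y.2 s (x.inc1 s t)

lemma remainder_add (y z : (Time T → V) × (Time T → (U →L[ℝ] V))) (s t : Time T) :
    remainder x (y + z) s t = remainder x y s t + remainder x z s t := by
  simp [remainder]; abel

lemma remainder_smul (c : ℝ) (y : (Time T → V) × (Time T → (U →L[ℝ] V))) (s t : Time T) :
    remainder x (c • y) s t = c • remainder x y s t := by
  simp [remainder, smul_sub]

lemma VarBound.add {E : Type*} [NormedAddCommGroup E] {A B D : Time T → Time T → E} {e C C' : ℝ}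
    (hA : VarBound ω e A C) (hB : VarBound ω e B C') (h : ∀ s t, D s t = A s t + B s t) :
    VarBound ω e D (C + C') := fun s t hst => by
  rw [h, add_mul]
  exact (norm_add_le _ _).trans (add_le_add (hA s t hst) (hB s t hst))

lemma VarBound.smul {E : Type*} [NormedAddCommGroup E] [NormedSpace ℝ E]
    {A D : Time T → Time T → E} {e C : ℝ} (c : ℝ)
    (hA : VarBound ω e A C) (h : ∀ s t, D s t = c • A s t) :
    VarBound ω e D (|c| * C) := fun s t hst => by
  rw [h, norm_smul, mul_assoc, Real.norm_eq_abs]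
  exact mul_le_mul_of_nonneg_left (hA s t hst) (abs_nonneg c)

lemma VarBound.exists_nonneg {E : Type*} [NormedAddCommGroup E] {A : Time T → Time T → E} {e : ℝ}
    (h : ∃ C, VarBound ω e A C) : ∃ C, 0 ≤ C ∧ VarBound ω e A C := by
  obtain ⟨C, hC⟩ := h
  exact ⟨|C|, abs_nonneg C, fun s t hst => (hC s t hst).trans
    (mul_le_mul_of_nonneg_right (le_abs_self C) (ω.rpow_nonneg _ hst))⟩

lemma VarBound.of_varNorm {E : Type*} [NormedAddCommGroup E] {A : Time T → Time T → E} {e : ℝ}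
    (h : ∃ C, VarBound ω e A C) : VarBound ω e A (varNorm ω e A) := fun s t hst =>
  le_leastConst_mul (VarBound.exists_nonneg h) (ω.rpow_nonneg _ hst) fun _ _ hC => hC s t hst

variable (V) in
/-- The linear space of pairs `(y, y†)` with `y†` of finite `q`-variation and `y♯` of finite
`r`-variation with respect to `ω`. -/
def crpSubmodule : Submodule ℝ ((Time T → V) × (Time T → (U →L[ℝ] V))) where
  carrier := {y | (∃ C, VarBound ω q (fun s t => y.2 t - y.2 s) C) ∧
    ∃ C, VarBound ω r (remainder x y) C}
  zero_mem' := ⟨⟨0, fun s t _ => by simp⟩, ⟨0, fun s t _ => by simp [remainder]⟩⟩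
  add_mem' := by
    rintro y z ⟨⟨C, hC⟩, D, hD⟩ ⟨⟨C', hC'⟩, D', hD'⟩
    exact ⟨⟨_, hC.add hC' fun s t => by simp; abel⟩, _, hD.add hD' (remainder_add x y z)⟩
  smul_mem' := by
    rintro c y ⟨⟨C, hC⟩, D, hD⟩
    exact ⟨⟨_, hC.smul c fun s t => by simp [smul_sub]⟩, _, hD.smul c (remainder_smul x c y)⟩

variable (V) in
/-- The space `P_{p,q,r}(x, V)` of controlled rough paths, identified with pairs `(y, y†)`. -/
def CRP : Type _ := ↥(crpSubmodule x q r V)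

instance : AddCommGroup (CRP x q r V) := inferInstanceAs (AddCommGroup (crpSubmodule x q r V))
instance : Module ℝ (CRP x q r V) := inferInstanceAs (Module ℝ (crpSubmodule x q r V))

variable {x q r}

/-- The path `y` of a controlled rough path. -/
def CRP.path (y : CRP x q r V) : Time T → V := y.1.1

/-- The path `y†` of a controlled rough path. -/
def CRP.dag (y : CRP x q r V) : Time T → (U →L[ℝ] V) := y.1.2

/-- The remainder `y♯` of a controlled rough path. -/
def CRP.sharp (y : CRP x q r V) (s t : Time T) : V :=
  y.path t - y.path s - y.dag s (x.inc1 s t)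

variable [Fact (0 < T)]

/-- `|y₀| + |y†₀| + ‖y†‖_q + ‖y♯‖_r`. -/
instance : Norm (CRP x q r V) :=
  ⟨fun y => ‖y.path t0‖ + ‖y.dag t0‖ + varNorm ω q (fun s t => y.dag t - y.dag s) +
    varNorm ω r y.sharp⟩

lemma CRP.norm_def (y : CRP x q r V) :
    ‖y‖ = ‖y.path t0‖ + ‖y.dag t0‖ + varNorm ω q (fun s t => y.dag t - y.dag s) +
      varNorm ω r y.sharp := rfl

lemma crp_core : NormedSpace.Core ℝ (CRP x q r V) where
  norm_nonneg y := by
    rw [CRP.norm_def]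
    have h1 := leastConst_nonneg (VarBound ω q (fun s t => y.dag t - y.dag s))
    have h2 := leastConst_nonneg (VarBound ω r y.sharp)
    unfold varNorm
    positivity
  norm_smul c y := by
    have h1 := leastConst_smul (E := CRP x q r V)
      (P := fun y => VarBound ω q (fun s t => y.dag t - y.dag s))
      (fun y => VarBound.exists_nonneg y.2.1)
      (fun c y C h => h.smul c fun s t => (smul_sub c (y.dag t) (y.dag s)).symm) c y
    have h2 := leastConst_smul (E := CRP x q r V)
      (P := fun y => VarBound ω r y.sharp)
      (fun y => VarBound.exists_nonneg y.2.2)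
      (fun c y C h => h.smul c (remainder_smul x c y.1)) c y
    have h3 : (c • y).path t0 = c • y.path t0 := rfl
    have h4 : (c • y).dag t0 = c • y.dag t0 := rfl
    rw [CRP.norm_def, CRP.norm_def, h3, h4, norm_smul, norm_smul, Real.norm_eq_abs]
    unfold varNorm
    rw [h1, h2]
    ring
  norm_triangle y z := by
    have h1 := leastConst_add_le (E := CRP x q r V)
      (P := fun y => VarBound ω q (fun s t => y.dag t - y.dag s))
      (fun y => VarBound.exists_nonneg y.2.1)
      (fun y z C D h h' => h.add h' fun s t => add_sub_add_comm _ _ _ _) y z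
    have h2 := leastConst_add_le (E := CRP x q r V)
      (P := fun y => VarBound ω r y.sharp)
      (fun y => VarBound.exists_nonneg y.2.2)
      (fun y z C D h h' => h.add h' (remainder_add x y.1 z.1)) y z
    have h3 : ‖(y + z).path t0‖ ≤ ‖y.path t0‖ + ‖z.path t0‖ := norm_add_le _ _
    have h4 : ‖(y + z).dag t0‖ ≤ ‖y.dag t0‖ + ‖z.dag t0‖ := norm_add_le _ _
    rw [CRP.norm_def, CRP.norm_def, CRP.norm_def]
    unfold varNorm
    linarith
  norm_eq_zero_iff y := by
    have n1 := norm_nonneg (y.path t0)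
    have n2 := norm_nonneg (y.dag t0)
    have n3 := leastConst_nonneg (VarBound ω q (fun s t => y.dag t - y.dag s))
    have n4 := leastConst_nonneg (VarBound ω r y.sharp)
    constructor
    · intro h
      rw [CRP.norm_def] at h
      have b1 := VarBound.of_varNorm y.2.1
      have b2 := VarBound.of_varNorm y.2.2
      have e1 : y.path t0 = 0 := norm_eq_zero.1 (by unfold varNorm at h; linarith)
      have e2 : y.dag t0 = 0 := norm_eq_zero.1 (by unfold varNorm at h; linarith)
      have e3 : varNorm ω q (fun s t => y.1.2 t - y.1.2 s) = 0 := by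
        change ‖y.path t0‖ + ‖y.dag t0‖ + varNorm ω q (fun s t => y.1.2 t - y.1.2 s) + _ = 0 at h
        unfold varNorm at h ⊢
        change 0 ≤ leastConst (VarBound ω q (fun s t => y.1.2 t - y.1.2 s)) at n3
        linarith
      have e4 : varNorm ω r (remainder x y.1) = 0 := by
        change ‖y.path t0‖ + ‖y.dag t0‖ + _ + varNorm ω r (remainder x y.1) = 0 at h
        unfold varNorm at h ⊢
        change 0 ≤ leastConst (VarBound ω r (remainder x y.1)) at n4
        linarith
      have d : ∀ t, y.1.2 t = 0 := fun t => by
        have := b1 t0 t (t0_le t)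
        rw [e3, zero_mul, norm_le_zero_iff] at this
        exact (sub_eq_zero.1 this).trans e2
      refine Subtype.ext (Prod.ext ?_ (funext d))
      funext t
      have := b2 t0 t (t0_le t)
      rw [e4, zero_mul, norm_le_zero_iff, remainder, d t0, zero_apply, sub_zero] at this
      exact (sub_eq_zero.1 this).trans e1
    · rintro rfl
      refine le_antisymm ?_ ?_
      · have m1 : varNorm ω q (fun s t => (0 : CRP x q r V).dag t - (0 : CRP x q r V).dag s) ≤ 0 :=
          leastConst_le le_rfl fun s t _ => by
            change ‖(0 : U →L[ℝ] V) - 0‖ ≤ _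
            simp
        have m2 : varNorm ω r (0 : CRP x q r V).sharp ≤ 0 :=
          leastConst_le le_rfl fun s t _ => by
            change ‖(0 : V) - 0 - (0 : U →L[ℝ] V) _‖ ≤ _
            simp
        have m3 : ‖(0 : CRP x q r V).path t0‖ = 0 := norm_zero (E := V)
        have m4 : ‖(0 : CRP x q r V).dag t0‖ = 0 := norm_zero (E := U →L[ℝ] V)
        rw [CRP.norm_def]
        linarith
      · rw [CRP.norm_def]; unfold varNorm; positivity

instance : NormedAddCommGroup (CRP x q r V) := NormedAddCommGroup.ofCore crp_core
instance : NormedSpace ℝ (CRP x q r V) := ⟨fun c y => (crp_core.norm_smul c y).le⟩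

end CRP

/-! ### Functions of class `C^{n+α}` -/

section Holder

variable {E F : Type*} [NormedAddCommGroup E] [NormedSpace ℝ E]
  [NormedAddCommGroup F] [NormedSpace ℝ F]

/-- On `S`, the derivatives of `f` of order at most `n` are bounded by `C` and the one of order `n`
is `α`-Hölder with constant `C`. -/
def HolderBound (n : ℕ) (α : ℝ) (S : Set E) (f : E → F) (C : ℝ) : Prop :=
  (∀ j ≤ n, ∀ v ∈ S, ‖iteratedFDeriv ℝ j f v‖ ≤ C) ∧
    ∀ v ∈ S, ∀ v' ∈ S,
      ‖iteratedFDeriv ℝ n f v - iteratedFDeriv ℝ n f v'‖ ≤ C * ‖v - v'‖ ^ α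

/-- `f` is of class `C^{n+α}` on the open set `S`: it is `n` times continuously Fréchet
differentiable, with bounded derivatives of order `0, …, n` and an `α`-Hölder derivative of
order `n`. -/
def OfClassOn (n : ℕ) (α : ℝ) (S : Set E) (f : E → F) : Prop :=
  ContDiffOn ℝ n f S ∧ ∃ C, HolderBound n α S f C

/-- `f` is locally of class `C^{n+α}`. -/
def LocallyOfClass (n : ℕ) (α : ℝ) (f : E → F) : Prop :=
  ∀ v, ∃ S : Set E, IsOpen S ∧ v ∈ S ∧ OfClassOn n α S f

lemma OfClassOn.contDiff {n : ℕ} {α : ℝ} {f : E → F} (h : OfClassOn n α Set.univ f) :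
    ContDiff ℝ n f := contDiffOn_univ.1 h.1

lemma HolderBound.add {n : ℕ} {α : ℝ} {f g : E → F} {C D : ℝ}
    (hf : ContDiff ℝ n f) (hg : ContDiff ℝ n g)
    (h : HolderBound n α Set.univ f C) (h' : HolderBound n α Set.univ g D) :
    HolderBound n α Set.univ (f + g) (C + D) := by
  have e : ∀ j ≤ n, iteratedFDeriv ℝ j (f + g) = iteratedFDeriv ℝ j f + iteratedFDeriv ℝ j g :=
    fun j hj => iteratedFDeriv_add (hf.of_le (by exact_mod_cast hj)) (hg.of_le (by exact_mod_cast hj))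
  refine ⟨fun j hj v hv => ?_, fun v hv v' hv' => ?_⟩
  · rw [e j hj]
    exact (norm_add_le _ _).trans (add_le_add (h.1 j hj v hv) (h'.1 j hj v hv))
  · rw [e n le_rfl, Pi.add_apply, Pi.add_apply, add_sub_add_comm, add_mul]
    exact (norm_add_le _ _).trans (add_le_add (h.2 v hv v' hv') (h'.2 v hv v' hv'))

lemma HolderBound.smul {n : ℕ} {α : ℝ} {f : E → F} {C : ℝ} (c : ℝ)
    (hf : ContDiff ℝ n f) (h : HolderBound n α Set.univ f C) :
    HolderBound n α Set.univ (c • f) (|c| * C) := by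
  have e : ∀ j ≤ n, ∀ v, iteratedFDeriv ℝ j (c • f) v = c • iteratedFDeriv ℝ j f v :=
    fun j hj v => iteratedFDeriv_const_smul_apply (hf.of_le (by exact_mod_cast hj)).contDiffAt
  refine ⟨fun j hj v hv => ?_, fun v hv v' hv' => ?_⟩
  · rw [e j hj, norm_smul, Real.norm_eq_abs]
    exact mul_le_mul_of_nonneg_left (h.1 j hj v hv) (abs_nonneg c)
  · rw [e n le_rfl, e n le_rfl, ← smul_sub, norm_smul, Real.norm_eq_abs, mul_assoc]
    exact mul_le_mul_of_nonneg_left (h.2 v hv v' hv') (abs_nonneg c)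

lemma HolderBound.zero (n : ℕ) (α : ℝ) :
    HolderBound n α Set.univ (0 : E → F) 0 := by
  have e : ∀ j, ∀ v, iteratedFDeriv ℝ j (0 : E → F) v = 0 := fun j v => by
    have := iteratedFDeriv_fun_zero (𝕜 := ℝ) (E := E) (F := F) (n := j)
    exact congrFun this v
  exact ⟨fun j _ v _ => by simp [e], fun v _ v' _ => by simp [e]⟩

variable (E F) in
/-- The linear space of functions of class `C^{n+α}` on the whole space. -/
def holderSubmodule (n : ℕ) (α : ℝ) : Submodule ℝ (E → F) where
  carrier := {f | OfClassOn n α Set.univ f}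
  zero_mem' := ⟨contDiffOn_const, 0, HolderBound.zero n α⟩
  add_mem' := fun {f g} hf hg => by
    obtain ⟨C, hC⟩ := hf.2
    obtain ⟨D, hD⟩ := hg.2
    exact ⟨hf.1.add hg.1, _, hC.add hf.contDiff hg.contDiff hD⟩
  smul_mem' := fun c f hf => by
    obtain ⟨C, hC⟩ := hf.2
    exact ⟨contDiffOn_const.smul hf.1, _, hC.smul c hf.contDiff⟩

variable (E F) in
/-- The space `C^{n+α}(E, F)`. -/
def HolderSpace (n : ℕ) (α : ℝ) : Type _ := ↥(holderSubmodule E F n α)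

variable {n : ℕ} {α : ℝ}

instance : AddCommGroup (HolderSpace E F n α) :=
  inferInstanceAs (AddCommGroup (holderSubmodule E F n α))
instance : Module ℝ (HolderSpace E F n α) := inferInstanceAs (Module ℝ (holderSubmodule E F n α))

instance : CoeFun (HolderSpace E F n α) fun _ => E → F := ⟨fun f => f.1⟩

/-- The maximum of the sup norms of the derivatives of order `0, …, n` and of the `α`-Hölder
seminorm of the derivative of order `n`. -/
instance : Norm (HolderSpace E F n α) := ⟨fun f => leastConst (HolderBound n α Set.univ f.1)⟩

lemma HolderSpace.exists_bound (f : HolderSpace E F n α) :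
    ∃ C, 0 ≤ C ∧ HolderBound n α Set.univ f.1 C := by
  obtain ⟨C, hC⟩ := f.2.2
  exact ⟨C, (norm_nonneg _).trans (hC.1 0 (Nat.zero_le n) 0 (Set.mem_univ _)), hC⟩

lemma holder_core : NormedSpace.Core ℝ (HolderSpace E F n α) where
  norm_nonneg _ := leastConst_nonneg _
  norm_smul c f := leastConst_smul (E := HolderSpace E F n α)
    (P := fun f => HolderBound n α Set.univ f.1) HolderSpace.exists_bound
    (fun c f _ h => h.smul c f.2.contDiff) c f
  norm_triangle f g := leastConst_add_le (E := HolderSpace E F n α)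
    (P := fun f => HolderBound n α Set.univ f.1) HolderSpace.exists_bound
    (fun f g _ _ h h' => h.add f.2.contDiff g.2.contDiff h') f g
  norm_eq_zero_iff f := by
    constructor
    · intro h
      refine Subtype.ext (funext fun v => ?_)
      have : ‖iteratedFDeriv ℝ 0 f.1 v‖ ≤ ‖f‖ :=
        le_leastConst f.exists_bound fun C _ hC => hC.1 0 (Nat.zero_le n) v (Set.mem_univ v)
      rw [h, norm_iteratedFDeriv_zero, norm_le_zero_iff] at this
      exact this
    · rintro rfl
      exact le_antisymm (leastConst_le le_rfl (HolderBound.zero n α)) (leastConst_nonneg _)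

instance : NormedAddCommGroup (HolderSpace E F n α) := NormedAddCommGroup.ofCore holder_core
instance : NormedSpace ℝ (HolderSpace E F n α) := ⟨fun c f => (holder_core.norm_smul c f).le⟩

end Holder

/-! ### Integration and differential equations -/

section Integral

variable {T : ℝ} [Fact (0 < T)] {ω : Control T} {p : ℝ}
variable {U V W : Type*} [NormedAddCommGroup U] [NormedSpace ℝ U]
  [NormedAddCommGroup V] [NormedSpace ℝ V] [CompleteSpace V]
  [NormedAddCommGroup W] [NormedSpace ℝ W]
variable {x : RoughPath ω p U} {q r : ℝ}

/-- `φ` is the family `z♭_{s,t} ∈ U ⊗ W`, which plays the role of the iterated integral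
`∫ₛᵗ x¹_{s,u} ⊗ dz_u`. It is determined by a relation of multiplicativity and by its closeness to
`z†_s x²_{s,t}`. -/
def IsFlat (z : CRP x q r W) (φ : Time T → Time T → Tensor U W) : Prop :=
  (∀ a b c, a ≤ b → b ≤ c →
    φ a b + φ b c + tmul U W (x.inc1 a b) (z.path c - z.path b) = φ a c) ∧
  ∃ θ > (1 : ℝ), ∃ K, ∀ s t, s ≤ t →
    ‖φ s t - idTensor (z.dag s) (x.inc2 s t)‖ ≤ K * ω s t ^ θ

/-- `J` is the integral `t ↦ ∫₀ᵗ Y dz` of an integrand given by a path `Y` and its derivative `Y†`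
with respect to `x`: the path that starts from `0` and whose increments are
`Y_s z_{s,t} + Y†_s z♭_{s,t} + O(ω(s,t)^θ)` for some `θ > 1`. Here `Y†_s : U → L(W, V)` acts on
`U ⊗ W` through `u ⊗ w ↦ Y†_s u w`. -/
def IsIntegral (Y : Time T → (W →L[ℝ] V)) (Y' : Time T → (U →L[ℝ] W →L[ℝ] V))
    (z : CRP x q r W) (J : Time T → V) : Prop :=
  J t0 = 0 ∧ ∃ φ, IsFlat z φ ∧ ∃ θ > (1 : ℝ), ∃ K, ∀ s t, s ≤ t →
    ‖J t - J s - Y s (z.path t - z.path s) - tlift (Y' s) (φ s t)‖ ≤ K * ω s t ^ θ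

/-- The controlled rough path `(y, y†)` solves `y_t = a + ∫₀ᵗ f(y_s) dz_s + b z_{0,t}` with
`y†_t = f(y_t) z†_t + b z†_t`. The integrand `f(y)` is a controlled rough path with
`f(y)† = Df(y) y†`. -/
def Solves (a : V) (b : W →L[ℝ] V) (f : V → (W →L[ℝ] V)) (z : CRP x q r W) (y : CRP x q r V) :
    Prop :=
  (∃ J, IsIntegral (fun t => f (y.path t)) (fun t => (fderiv ℝ f (y.path t)).comp (y.dag t)) z J ∧
    ∀ t, y.path t = a + J t + b (z.path t - z.path t0)) ∧
  ∀ t, y.dag t = (f (y.path t)).comp (z.dag t) + b.comp (z.dag t)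

end Integral

end RoughIto

end

noncomputable section

set_option linter.unusedSectionVars false

namespace RoughIto

/-! ### Calculus of maps of class `C^{n+β}` near a point -/

section Calculus

open Asymptotics Filter

variable {E F G : Type*} [NormedAddCommGroup E] [NormedSpace ℝ E]
  [NormedAddCommGroup F] [NormedSpace ℝ F] [NormedAddCommGroup G] [NormedSpace ℝ G]

/-! Put σ = κγ. The proof rests on splitting the Hölder exponent as γ = κγ + (1 - κ)γ: the first
share pays for regularity in time, and the second is left for the dependence on the path.

Integrands f(y) are placed in the larger space of controlled rough paths whose derivative has finite
p/σ-variation and whose remainder has finite p/(1+σ)-variation. The germ of the integral against z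
then has a defect of order ω^((2+σ)/p). Since p < 2 + σ, this exponent exceeds 1, and the sewing
lemma `exists_sewing` turns integration into a bounded bilinear map `intL`.

Composition is treated as an operator-valued map `omegaL`, sending y to the bounded linear operator
f ↦ f(y). Interpolating between two bounds for second differences of Df
(`C1Holder.second_difference`) shows that it is locally (1-κ)γ-Hölder. Its derivative at y in the
direction h is f ↦ (Df)(y) h, which is a bounded linear image of the same kind of operator one order
lower (`hasFDerivAt_omegaL`). Induction gives class C^(n+(1-κ)γ) (`ckHolderAt_omegaL`). Because f
enters linearly, the right-hand side of the equation is a smooth function of the data and of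
`omegaL`, so it inherits this class (`ckHolderAt_picardMap`).

Solutions are the fixed points of that right-hand side (`solves_iff`). Its derivative in y is the
Volterra operator h ↦ ∫ (Df(y) h) dz. Measured on short intervals, with an exponential weight in
time and different weights for the path, the derivative and the variations, this operator halves all
bounds (`exists_halving`). Hence some power of it has norm below 1, and 1 minus the operator is
invertible (`isUnit_one_sub_integral`). Applied along segments, the same estimate yields uniqueness
(`picardMap_unique`) and, on a set of paths with invariant local bounds (`exists_invariant`), the
convergence of Picard iteration (`exists_picardMap_eq`).

An implicit function argument for globally unique fixed points, `CkHolderAt.fixedPoint`, then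
transfers the regularity of the right-hand side to the solution map. -/

/-- `f` is `n` times continuously differentiable near `x` and its derivative of order `n` is
`β`-Hölder near `x`. -/
def CkHolderAt (n : ℕ) (β : ℝ) (f : E → F) (x : E) : Prop :=
  ContDiffAt ℝ n f x ∧
    (fun z : E × E => iteratedFDeriv ℝ n f z.1 - iteratedFDeriv ℝ n f z.2) =O[𝓝 (x, x)]
      fun z => ‖z.1 - z.2‖ ^ β

lemma isBigO_sub_rpow {H : Type*} [NormedAddCommGroup H] {β : ℝ} (hβ : β ≤ 1) (x : H) :
    (fun z : H × H => z.1 - z.2) =O[𝓝 (x, x)] fun z => ‖z.1 - z.2‖ ^ β := by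
  have h : Tendsto (fun z : H × H => ‖z.1 - z.2‖) (𝓝 (x, x)) (𝓝 0) := by
    have : Continuous fun z : H × H => ‖z.1 - z.2‖ := by fun_prop
    simpa using this.tendsto (x, x)
  refine IsBigO.of_bound 1 ?_
  filter_upwards [h.eventually (gt_mem_nhds one_pos)] with z hz
  rw [one_mul, Real.norm_eq_abs, abs_of_nonneg (Real.rpow_nonneg (norm_nonneg _) _)]
  rcases (norm_nonneg (z.1 - z.2)).eq_or_lt with h0 | h0
  · rw [← h0]; exact Real.rpow_nonneg le_rfl _
  · simpa using Real.rpow_le_rpow_of_exponent_ge h0 hz.le hβ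

lemma isBigO_sub_of_contDiffAt {f : E → F} {x : E} (hf : ContDiffAt ℝ 1 f x) :
    (fun z : E × E => f z.1 - f z.2) =O[𝓝 (x, x)] fun z => z.1 - z.2 :=
  (hf.hasStrictFDerivAt one_ne_zero).isBigO_sub

/-- With one more derivative, the derivative of order n is Lipschitz near the point, and distances
below 1 are at most their power β. -/
lemma CkHolderAt.of_contDiffAt {n : ℕ} {β : ℝ} (hβ : β ≤ 1) {f : E → F} {x : E}
    (hf : ContDiffAt ℝ (n + 1 : ℕ) f x) : CkHolderAt n β f x := by
  refine ⟨hf.of_le (by exact_mod_cast n.le_succ), ?_⟩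
  refine (isBigO_sub_of_contDiffAt (hf.iteratedFDeriv_right (m := 1) ?_)).trans
    (isBigO_sub_rpow hβ x)
  push_cast
  rw [add_comm]

lemma CkHolderAt.of_le {n i : ℕ} {β : ℝ} (hβ : β ≤ 1) {f : E → F} {x : E}
    (hf : CkHolderAt n β f x) (hi : i ≤ n) : CkHolderAt i β f x := by
  rcases hi.eq_or_lt with rfl | h
  · exact hf
  · exact .of_contDiffAt hβ (hf.1.of_le (by exact_mod_cast h))

lemma isBigO_iteratedFDeriv_zero_iff {β : ℝ} {f : E → F} {x : E} :
    ((fun z : E × E => iteratedFDeriv ℝ 0 f z.1 - iteratedFDeriv ℝ 0 f z.2) =O[𝓝 (x, x)]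
      fun z => ‖z.1 - z.2‖ ^ β) ↔
    (fun z : E × E => f z.1 - f z.2) =O[𝓝 (x, x)] fun z => ‖z.1 - z.2‖ ^ β := by
  rw [← isBigO_norm_left, ← isBigO_norm_left (f' := fun z : E × E => f z.1 - f z.2)]
  simp only [iteratedFDeriv_zero_eq_comp, Function.comp_apply, ← map_sub,
    LinearIsometryEquiv.norm_map]

lemma CkHolderAt.zero_isBigO {n : ℕ} {β : ℝ} (hβ : β ≤ 1) {f : E → F} {x : E}
    (hf : CkHolderAt n β f x) :
    (fun z : E × E => f z.1 - f z.2) =O[𝓝 (x, x)] fun z => ‖z.1 - z.2‖ ^ β :=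
  isBigO_iteratedFDeriv_zero_iff.1 (hf.of_le hβ (Nat.zero_le n)).2

lemma ContDiffAt.isBoundedUnder_iteratedFDeriv {n : ℕ} {f : E → F} {x : E}
    (hf : ContDiffAt ℝ n f x) {i : ℕ} (hi : i ≤ n) {ι : Type*} {l : Filter ι} {u : ι → E}
    (hu : Tendsto u l (𝓝 x)) :
    l.IsBoundedUnder (· ≤ ·) fun a => ‖ftaylorSeries ℝ f (u a) i‖ :=
  ((hf.continuousAt_iteratedFDeriv (by exact_mod_cast hi)).tendsto.comp hu).norm.isBoundedUnder_le

/-- By the Faà di Bruno formula the derivative of order n is a polynomial in the derivatives of g at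
f and of f, each locally bounded and β-Hölder. The last hypothesis matters only for n = 0: two maps
that are merely β-Hölder compose to exponent β², so one of them has to be Lipschitz. For n ≥ 1 the
inner map is automatically C¹. -/
lemma CkHolderAt.comp {n : ℕ} {β : ℝ} (h0 : 0 ≤ β) (hβ : β ≤ 1) {g : F → G} {f : E → F} {x : E}
    (hg : CkHolderAt n β g (f x)) (hf : CkHolderAt n β f x)
    (hd : ContDiffAt ℝ 1 g (f x) ∨ ContDiffAt ℝ 1 f x) : CkHolderAt n β (g ∘ f) x := by
  have t1 : Tendsto (fun z : E × E => z.1) (𝓝 (x, x)) (𝓝 x) := continuous_fst.tendsto (x, x)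
  have t2 : Tendsto (fun z : E × E => z.2) (𝓝 (x, x)) (𝓝 x) := continuous_snd.tendsto (x, x)
  have t12 : Tendsto (fun z : E × E => (f z.1, f z.2)) (𝓝 (x, x)) (𝓝 (f x, f x)) :=
    (hf.1.continuousAt.tendsto.comp t1).prodMk_nhds (hf.1.continuousAt.tendsto.comp t2)
  refine ⟨hg.1.comp x hf.1, ?_⟩
  have e : ∀ᶠ y in 𝓝 x, iteratedFDeriv ℝ n (g ∘ f) y =
      (ftaylorSeries ℝ g (f y)).taylorComp (ftaylorSeries ℝ f y) n := by
    filter_upwards [hf.1.eventually (by simp),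
      hf.1.continuousAt.eventually (hg.1.eventually (by simp))] with y h1 h2
    exact iteratedFDeriv_comp h2 h1 le_rfl
  refine IsBigO.congr' (f₁ := fun z : E × E =>
      (ftaylorSeries ℝ g (f z.1)).taylorComp (ftaylorSeries ℝ f z.1) n -
      (ftaylorSeries ℝ g (f z.2)).taylorComp (ftaylorSeries ℝ f z.2) n) ?_ ?_ EventuallyEq.rfl
  · refine FormalMultilinearSeries.taylorComp_sub_taylorComp_isBigO (fun i hi => ?_)
      (fun i hi => ?_) (fun i hi => ?_) (fun i hi => ?_) (fun i hi => ?_)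
    · exact ContDiffAt.isBoundedUnder_iteratedFDeriv hg.1 hi (hf.1.continuousAt.tendsto.comp t1)
    · by_cases hfd : ContDiffAt ℝ 1 f x
      · refine ((hg.of_le hβ hi).2.comp_tendsto t12).trans ?_
        exact IsBigO.rpow h0 (.of_forall fun _ => norm_nonneg _)
          (isBigO_sub_of_contDiffAt hfd).norm_norm
      · have hn : n = 0 := by
          by_contra hn
          exact hfd (hf.1.of_le (by exact_mod_cast Nat.one_le_iff_ne_zero.2 hn))
        obtain rfl : i = 0 := by omega
        have := ((isBigO_sub_of_contDiffAt (hd.resolve_right hfd)).comp_tendsto t12).trans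
          (hf.zero_isBigO hβ)
        rw [← isBigO_norm_left] at this ⊢
        simpa only [ftaylorSeries, iteratedFDeriv_zero_eq_comp, Function.comp_apply, ← map_sub,
          LinearIsometryEquiv.norm_map] using this
    · exact ContDiffAt.isBoundedUnder_iteratedFDeriv hf.1 hi t1
    · exact ContDiffAt.isBoundedUnder_iteratedFDeriv hf.1 hi t2
    · exact (hf.of_le hβ hi).2
  · filter_upwards [t1.eventually e, t2.eventually e] with z h1 h2
    rw [h1, h2]

lemma CkHolderAt.prodMk {n : ℕ} {β : ℝ} {f : E → F} {g : E → G} {x : E}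
    (hf : CkHolderAt n β f x) (hg : CkHolderAt n β g x) :
    CkHolderAt n β (fun y => (f y, g y)) x := by
  have t1 : Tendsto (fun z : E × E => z.1) (𝓝 (x, x)) (𝓝 x) := continuous_fst.tendsto (x, x)
  have t2 : Tendsto (fun z : E × E => z.2) (𝓝 (x, x)) (𝓝 x) := continuous_snd.tendsto (x, x)
  refine ⟨hf.1.prodMk hg.1, ?_⟩
  have e : ∀ᶠ y in 𝓝 x, iteratedFDeriv ℝ n (fun y => (f y, g y)) y =
      (iteratedFDeriv ℝ n f y).prod (iteratedFDeriv ℝ n g y) := by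
    filter_upwards [hf.1.eventually (by simp), hg.1.eventually (by simp)] with y h1 h2
    exact iteratedFDeriv_prodMk h1 h2 le_rfl
  refine IsBigO.congr' (f₁ := fun z : E × E =>
      (iteratedFDeriv ℝ n f z.1 - iteratedFDeriv ℝ n f z.2).prod
        (iteratedFDeriv ℝ n g z.1 - iteratedFDeriv ℝ n g z.2)) ?_ ?_ EventuallyEq.rfl
  · refine .of_norm_left ?_
    simp only [ContinuousMultilinearMap.opNorm_prod, ← Prod.norm_mk]
    exact (hf.2.prod_left hg.2).norm_left
  · filter_upwards [t1.eventually e, t2.eventually e] with z h1 h2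
    rw [h1, h2]
    rfl

lemma norm_iteratedFDeriv_succ_sub (f : E → F) (n : ℕ) (x y : E) :
    ‖iteratedFDeriv ℝ (n + 1) f x - iteratedFDeriv ℝ (n + 1) f y‖ =
      ‖iteratedFDeriv ℝ n (fderiv ℝ f) x - iteratedFDeriv ℝ n (fderiv ℝ f) y‖ := by
  simp only [iteratedFDeriv_succ_eq_comp_right, Function.comp_apply, ← dist_eq_norm,
    LinearIsometryEquiv.dist_map]

lemma CkHolderAt.fderiv {n : ℕ} {β : ℝ} {f : E → F} {x : E} (hf : CkHolderAt (n + 1) β f x) :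
    CkHolderAt n β (fderiv ℝ f) x := by
  refine ⟨hf.1.fderiv_right (by simp), ?_⟩
  have := hf.2
  rw [← isBigO_norm_left] at this ⊢
  simpa only [norm_iteratedFDeriv_succ_sub] using this

lemma CkHolderAt.of_hasFDerivAt {n : ℕ} {β : ℝ} {f : E → F} {f' : E → E →L[ℝ] F} {x : E}
    (h : ∀ y, HasFDerivAt f (f' y) y) (hf : CkHolderAt n β f' x) :
    CkHolderAt (n + 1) β f x := by
  refine ⟨?_, ?_⟩
  · push_cast
    exact contDiffAt_succ_iff_hasFDerivAt.2 ⟨f', ⟨Set.univ, univ_mem, fun y _ => h y⟩, hf.1⟩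
  · have := hf.2
    rw [show f' = _root_.fderiv ℝ f from funext fun y => (h y).fderiv.symm] at this
    rw [← isBigO_norm_left] at this ⊢
    simpa only [norm_iteratedFDeriv_succ_sub] using this

/-- Each derivative up to order n is continuous at x, hence bounded near x by its norm there plus 1,
and a neighbourhood of (x, x) contains a square. The sum of all these bounds and of the absolute
value of the Hölder constant serves as a single constant. -/
lemma LocallyOfClass.of_ckHolderAt {n : ℕ} {β : ℝ} {f : E → F} (h : ∀ x, CkHolderAt n β f x) :
    LocallyOfClass n β f := by
  intro x
  obtain ⟨C, hC⟩ := (h x).2.bound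
  have hb : ∀ j ∈ Finset.range (n + 1), ∀ᶠ y in 𝓝 x,
      ‖iteratedFDeriv ℝ j f y‖ ≤ ‖iteratedFDeriv ℝ j f x‖ + 1 := fun j hj =>
    (((h x).1.continuousAt_iteratedFDeriv (by
      exact_mod_cast Nat.lt_succ_iff.1 (Finset.mem_range.1 hj))).norm.tendsto.eventually
      (gt_mem_nhds (lt_add_one _))).mono fun _ hy => le_of_lt hy
  have hb' := (Filter.eventually_all_finset _).2 hb
  rw [nhds_prod_eq] at hC
  obtain ⟨t, ht, hC⟩ := Filter.mem_prod_same_iff.1 hC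
  obtain ⟨S, hS, hSo, hxS⟩ := mem_nhds_iff.1 (Filter.inter_mem ht hb')
  refine ⟨S, hSo, hxS, fun y _ => (h y).1.contDiffWithinAt,
    |C| + ∑ j ∈ Finset.range (n + 1), (‖iteratedFDeriv ℝ j f x‖ + 1), fun j hj v hv => ?_,
    fun v hv v' hv' => ?_⟩
  · have hj' := Finset.mem_range.2 (Nat.lt_succ_of_le hj)
    refine ((hS hv).2 j hj').trans ((Finset.single_le_sum (f := fun j =>
      ‖iteratedFDeriv ℝ j f x‖ + 1) (fun i _ => by positivity) hj').trans ?_)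
    exact le_add_of_nonneg_left (abs_nonneg C)
  · refine (hC (Set.mk_mem_prod (hS hv).1 (hS hv').1)).trans ?_
    have h0 := Real.rpow_nonneg (norm_nonneg (v - v')) β
    rw [Real.norm_of_nonneg h0]
    refine mul_le_mul_of_nonneg_right ((le_abs_self C).trans ?_) h0
    exact le_add_of_nonneg_right (Finset.sum_nonneg fun i _ => by positivity)

end Calculus

/-! ### Regularity of fixed points depending on a parameter -/

section Implicit

open Filter Asymptotics

variable {X P : Type*} [NormedAddCommGroup X] [NormedSpace ℝ X]
  [NormedAddCommGroup P] [NormedSpace ℝ P] [CompleteSpace P]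

/-- The derivative of the fixed point as a function of the derivative of the map. -/
def implicitDeriv (D : X × P →L[ℝ] P) : X →L[ℝ] P :=
  (Ring.inverse (1 - D.comp (.inr ℝ X P))).comp (D.comp (.inl ℝ X P))

/-- For θ' near θ, the map y ↦ y - Ψ(θ', y) is close to an invertible linear map on a ball around I
θ, so it has a zero in every small ball there. Global uniqueness identifies this zero with I θ'.
Only P has to be complete, since the surjectivity argument takes place in P for a fixed parameter.
-/
lemma continuousAt_fixedPoint {Ψ : X × P → P} {I : X → P}
    (hI : ∀ θ y, Ψ (θ, y) = y ↔ y = I θ) {θ : X} (hΨ : ContDiffAt ℝ 1 Ψ (θ, I θ))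
    (hu : IsUnit (1 - (fderiv ℝ Ψ (θ, I θ)).comp (.inr ℝ X P))) : ContinuousAt I θ := by
  obtain ⟨u, hu⟩ := hu
  set D := fderiv ℝ Ψ (θ, I θ) with hD
  set T := ContinuousLinearEquiv.unitsEquiv ℝ P u with hT
  have hT' : ∀ h, T h = h - D (0, h) := fun h => by
    change (u : P →L[ℝ] P) h = _
    rw [hu]; simp
  -- Adding 1 keeps the constant positive even if P is trivial.
  set N : NNReal := ‖(T.symm : P →L[ℝ] P)‖₊ + 1 with hN
  have hN0 : 0 < N := by positivity
  let R : (T : P →L[ℝ] P).NonlinearRightInverse :=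
    { toFun := T.symm
      nnnorm := N
      bound' := fun y => by
        refine ((T.symm : P →L[ℝ] P).le_opNorm y).trans ?_
        gcongr
        simp [hN]
      right_inv' := fun y => T.apply_symm_apply y }
  have hs := hΨ.hasStrictFDerivAt one_ne_zero
  set c : NNReal := N⁻¹ / 2 with hc
  have hc0 : 0 < c := by positivity
  obtain ⟨s, hs, happ⟩ := hs.approximates_deriv_on_nhds (c := c) (Or.inr hc0)
  rw [nhds_prod_eq, mem_prod_iff] at hs
  obtain ⟨s1, hs1, s2, hs2, hss⟩ := hs
  obtain ⟨ε0, hε0, hball⟩ := Metric.nhds_basis_closedBall.mem_iff.1 hs2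
  rw [Metric.continuousAt_iff']
  intro ε hε
  set e := min ε0 (ε / 2) with he
  have he0 : 0 < e := by positivity
  have hcont : Tendsto (fun θ' => I θ - Ψ (θ', I θ)) (𝓝 θ) (𝓝 0) := by
    have h1 : ContinuousAt (fun θ' => Ψ (θ', I θ)) θ :=
      ContinuousAt.comp (f := fun θ' => (θ', I θ)) hΨ.continuousAt (by fun_prop)
    have h2 : Tendsto (fun θ' => I θ - Ψ (θ', I θ)) (𝓝 θ) (𝓝 (I θ - Ψ (θ, I θ))) :=
      tendsto_const_nhds.sub h1
    rwa [(hI θ (I θ)).2 rfl, sub_self] at h2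
  have hr : 0 < (((N : ℝ))⁻¹ - c) * e := by
    have : (0 : ℝ) < (N : ℝ) := by exact_mod_cast hN0
    have hcc : (c : ℝ) = (N : ℝ)⁻¹ / 2 := by simp [hc]
    rw [hcc]
    have : (0 : ℝ) < (N : ℝ)⁻¹ := by positivity
    have h2 : (N : ℝ)⁻¹ - (N : ℝ)⁻¹ / 2 = (N : ℝ)⁻¹ / 2 := by ring
    rw [h2]; positivity
  filter_upwards [hs1, hcont (Metric.closedBall_mem_nhds 0 hr)] with θ' h1 h2
  have happ' : ApproximatesLinearOn (fun y => y - Ψ (θ', y)) (T : P →L[ℝ] P)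
      (Metric.closedBall (I θ) ε0) c := by
    intro y hy y' hy'
    have := happ _ (hss ⟨h1, hball hy⟩ : (θ', y) ∈ s) _ (hss ⟨h1, hball hy'⟩ : (θ', y') ∈ s)
    have e1 : y - Ψ (θ', y) - (y' - Ψ (θ', y')) - (T : P →L[ℝ] P) (y - y') =
        -(Ψ (θ', y) - Ψ (θ', y') - D ((θ', y) - (θ', y'))) := by
      rw [ContinuousLinearEquiv.coe_coe, hT', Prod.mk_sub_mk, sub_self]; abel
    rw [e1, norm_neg]
    refine this.trans (le_of_eq ?_)
    rw [Prod.mk_sub_mk, sub_self, Prod.norm_mk, norm_zero, max_eq_right (norm_nonneg _)]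
  -- The image of the ball of radius e contains the ball of radius (N⁻¹ - c) e around the value at I
  -- θ, and the choice of θ' puts 0 in it.
  obtain ⟨y, hy, hy0⟩ := happ'.surjOn_closedBall_of_nonlinearRightInverse R he0.le
    (Metric.closedBall_subset_closedBall (min_le_left _ _) : Metric.closedBall (I θ) e ⊆ _)
    (show (0 : P) ∈ _ by
      rw [Metric.mem_closedBall, dist_comm]
      exact h2)
  rw [← (hI θ' y).1 (sub_eq_zero.1 hy0).symm]
  refine (Metric.mem_closedBall.1 hy).trans_lt ((min_le_right _ _).trans_lt ?_)
  linarith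

/-- Expanding Ψ to first order at (θ, I θ) and solving for the increment of I gives the candidate
derivative plus an error that is small relative to the increments of θ and of I together. Continuity
of I makes the expansion applicable along the graph. -/
lemma hasFDerivAt_fixedPoint {Ψ : X × P → P} {I : X → P}
    (hI : ∀ θ y, Ψ (θ, y) = y ↔ y = I θ) {θ : X} (hΨ : ContDiffAt ℝ 1 Ψ (θ, I θ))
    (hu : IsUnit (1 - (fderiv ℝ Ψ (θ, I θ)).comp (.inr ℝ X P))) :
    HasFDerivAt I (implicitDeriv (fderiv ℝ Ψ (θ, I θ))) θ := by
  have hc := continuousAt_fixedPoint hI hΨ hu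
  have hd := (hΨ.differentiableAt one_ne_zero).hasFDerivAt
  unfold implicitDeriv
  obtain ⟨u, hu⟩ := hu
  set D := fderiv ℝ Ψ (θ, I θ) with hD
  rw [← hu, Ring.inverse_unit]
  set S : P →L[ℝ] P := ↑u⁻¹ with hS
  have hSu : ∀ h, S (h - D (0, h)) = h := fun h => by
    have : h - D (0, h) = (u : P →L[ℝ] P) h := by rw [hu]; simp
    rw [this]
    change (((u⁻¹ : (P →L[ℝ] P)ˣ) : P →L[ℝ] P) * (u : P →L[ℝ] P)) h = h
    rw [Units.inv_mul]; rfl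
  have hfix : ∀ θ, Ψ (θ, I θ) = I θ := fun θ => (hI θ (I θ)).2 rfl
  have htend : Tendsto (fun θ' => (θ', I θ')) (𝓝 θ) (𝓝 (θ, I θ)) :=
    tendsto_id.prodMk_nhds hc
  have hr := hd.isLittleO.comp_tendsto htend
  set r : X → P := fun θ' => Ψ (θ', I θ') - Ψ (θ, I θ) - D ((θ', I θ') - (θ, I θ)) with hrdef
  have key : ∀ θ', I θ' - I θ = S (D (θ' - θ, 0)) + S (r θ') := fun θ' => by
    have h1 : D (θ' - θ, I θ' - I θ) = D (θ' - θ, 0) + D (0, I θ' - I θ) := by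
      rw [← map_add]; simp
    have h2 : D (θ' - θ, 0) + r θ' = I θ' - I θ - D (0, I θ' - I θ) := by
      simp only [hrdef, hfix, Prod.mk_sub_mk, h1]
      abel
    rw [← map_add, h2, hSu]
  have hrO : r =o[𝓝 θ] fun θ' => (θ' - θ, I θ' - I θ) := hr
  have hSr : (fun θ' => S (r θ')) =o[𝓝 θ] fun θ' => (θ' - θ, I θ' - I θ) :=
    (S.isBigO_comp r _).trans_isLittleO hrO
  -- The error is at most half of both increments, so the half involving I is absorbed on the left;
  -- this gives the constant 2K + 1.
  have h_isBigO : (fun θ' => I θ' - I θ) =O[𝓝 θ] fun θ' => θ' - θ := by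
    set K := ‖S.comp (D.comp (.inl ℝ X P))‖ with hK
    refine IsBigO.of_bound (2 * K + 1) ?_
    filter_upwards [hSr.def (c := 1 / 2) (by norm_num)] with θ' h
    have h1 : ‖S (D (θ' - θ, 0))‖ ≤ K * ‖θ' - θ‖ :=
      (S.comp (D.comp (.inl ℝ X P))).le_opNorm (θ' - θ)
    have h2 : ‖I θ' - I θ‖ ≤ ‖S (D (θ' - θ, 0))‖ + ‖S (r θ')‖ := by
      rw [key θ']; exact norm_add_le _ _
    have h3 : ‖(θ' - θ, I θ' - I θ)‖ ≤ ‖θ' - θ‖ + ‖I θ' - I θ‖ :=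
      max_le_add_of_nonneg (norm_nonneg _) (norm_nonneg _)
    linarith
  refine .of_isLittleO ?_
  have h1 : (fun θ' => (θ' - θ, I θ' - I θ)) =O[𝓝 θ] fun θ' => θ' - θ :=
    (isBigO_refl _ _).prod_left h_isBigO
  refine (hSr.trans_isBigO h1).congr_left fun θ' => ?_
  rw [key θ']
  simp

lemma contDiffAt_implicitDeriv {n : ℕ} {D : X × P →L[ℝ] P}
    (hu : IsUnit (1 - D.comp (.inr ℝ X P))) :
    ContDiffAt ℝ n (implicitDeriv : (X × P →L[ℝ] P) → X →L[ℝ] P) D := by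
  obtain ⟨u, hu⟩ := hu
  have h1 : ContDiffAt ℝ n (fun D : X × P →L[ℝ] P => 1 - D.comp (.inr ℝ X P)) D :=
    (contDiff_const.sub (((ContinuousLinearMap.compL ℝ P (X × P) P).flip
      (.inr ℝ X P)).contDiff)).contDiffAt
  have h2 : ContDiffAt ℝ n (Ring.inverse : (P →L[ℝ] P) → _) (1 - D.comp (.inr ℝ X P)) := by
    rw [← hu]; exact contDiffAt_ringInverse ℝ u
  exact (h2.comp D h1).clm_comp ((ContinuousLinearMap.compL ℝ X (X × P) P).flip
      (.inl ℝ X P)).contDiff.contDiffAt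

/-- The fixed point of a map of class `C^{m+1+β}` that depends on a parameter is of class
`C^{m+1+β}` in the parameter. The space of parameters need not be complete. -/
theorem CkHolderAt.fixedPoint {m : ℕ} {β : ℝ} (h0 : 0 ≤ β) (hβ : β ≤ 1) {Ψ : X × P → P}
    {I : X → P} (hI : ∀ θ y, Ψ (θ, y) = y ↔ y = I θ) (hΨ : ∀ a, CkHolderAt (m + 1) β Ψ a)
    (hu : ∀ θ, IsUnit (1 - (_root_.fderiv ℝ Ψ (θ, I θ)).comp (.inr ℝ X P))) (θ : X) :
    CkHolderAt (m + 1) β I θ := by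
  have hΨ1 : ∀ a, ContDiffAt ℝ 1 Ψ a := fun a => (hΨ a).1.of_le (by exact_mod_cast m.succ_pos)
  have hd := fun θ => hasFDerivAt_fixedPoint hI (hΨ1 (θ, I θ)) (hu θ)
  have hcomp : ∀ j : ℕ, j ≤ m → (∀ θ, ContDiffAt ℝ j I θ) →
      ∀ θ, ContDiffAt ℝ j (fun θ => implicitDeriv (_root_.fderiv ℝ Ψ (θ, I θ))) θ := by
    intro j hj h θ
    refine ContDiffAt.comp θ (g := implicitDeriv) (contDiffAt_implicitDeriv (hu θ)) ?_
    refine ContDiffAt.comp θ (g := _root_.fderiv ℝ Ψ) (f := fun θ => (θ, I θ)) ?_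
      (contDiffAt_id.prodMk (h θ))
    exact (hΨ (θ, I θ)).fderiv.1.of_le (by exact_mod_cast hj)
  -- Bootstrap: the derivative of I is a smooth function of DΨ along the graph of I, so each order
  -- of regularity of I yields the next, up to m + 1.
  have hreg : ∀ j : ℕ, j ≤ m + 1 → ∀ θ, ContDiffAt ℝ j I θ := by
    intro j
    induction j with
    | zero =>
      intro _
      have : ContDiff ℝ 0 I := contDiff_zero.2
        (continuous_iff_continuousAt.2 fun θ => (hd θ).continuousAt)
      exact fun θ => this.contDiffAt
    | succ j ih =>
      intro hj θ
      push_cast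
      exact contDiffAt_succ_iff_hasFDerivAt.2 ⟨_, ⟨Set.univ, univ_mem, fun y _ => hd y⟩,
        hcomp j (by omega) (ih (by omega)) θ⟩
  refine .of_hasFDerivAt hd ?_
  have hI1 : ContDiffAt ℝ 1 (fun θ => (θ, I θ)) θ := by
    have := hreg 1 (by omega) θ
    exact contDiffAt_id.prodMk (by exact_mod_cast this)
  refine CkHolderAt.comp (g := implicitDeriv) h0 hβ
    (.of_contDiffAt hβ (contDiffAt_implicitDeriv (hu θ))) ?_
    (Or.inl (by exact_mod_cast contDiffAt_implicitDeriv (n := 1) (hu θ)))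
  -- For m = 0 the outer map DΨ may be no better than Hölder, so the C¹ regularity of the graph map
  -- is what allows the composition.
  refine CkHolderAt.comp (g := _root_.fderiv ℝ Ψ) (f := fun θ => (θ, I θ)) h0 hβ
    (hΨ _).fderiv ?_ (Or.inr hI1)
  exact .of_contDiffAt hβ (contDiffAt_id.prodMk (hreg (m + 1) le_rfl θ))

end Implicit

/-! ### Elementary properties of controls -/

section Controls

variable {T : ℝ} (ω : Control T)

lemma Control.self_eq_zero (t : Time T) : ω t t = 0 := by
  have h1 := ω.superadd t t t le_rfl le_rfl
  have h2 := ω.nonneg t t le_rfl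
  linarith

lemma Control.mono {r s t u : Time T} (hrs : r ≤ s) (hst : s ≤ t) (htu : t ≤ u) :
    ω s t ≤ ω r u := by
  have h1 := ω.superadd r s u hrs (hst.trans htu)
  have h2 := ω.superadd s t u hst htu
  have h3 := ω.nonneg r s hrs
  have h4 := ω.nonneg t u htu
  linarith

/-- Continuity at the diagonal is pointwise; a Lebesgue number of the resulting cover of the compact
interval makes it uniform. -/
lemma Control.exists_small {ε : ℝ} (hε : 0 < ε) :
    ∃ δ > 0, ∀ s t : Time T, s ≤ t → (t : ℝ) - s < δ → ω s t < ε := by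
  have h : ∀ t : Time T, ∃ δ > 0, ∀ a b : Time T, a ∈ Metric.ball t δ → b ∈ Metric.ball t δ →
      a ≤ b → ω a b < ε := by
    intro t
    have h1 : ∀ᶠ a in 𝓝[{a | a.1 ≤ a.2}] (t, t), ω a.1 a.2 < ε :=
      (ω.cont_diag t).tendsto.eventually (gt_mem_nhds (by simpa [ω.self_eq_zero] using hε))
    rw [eventually_nhdsWithin_iff, Metric.eventually_nhds_iff] at h1
    obtain ⟨δ, hδ, h2⟩ := h1
    refine ⟨δ, hδ, fun a b ha hb hab => h2 (y := (a, b)) ?_ hab⟩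
    rw [Prod.dist_eq]
    exact max_lt ha hb
  choose d hd h using h
  obtain ⟨δ, hδ, hL⟩ := lebesgue_number_lemma_of_metric (isCompact_univ (X := Time T))
    (fun t => Metric.isOpen_ball (x := t) (ε := d t))
    (fun t _ => Set.mem_iUnion.2 ⟨t, Metric.mem_ball_self (hd t)⟩)
  refine ⟨δ, hδ, fun s t hst hlt => ?_⟩
  obtain ⟨i, hi⟩ := hL s (Set.mem_univ s)
  refine h i s t (hi (Metric.mem_ball_self hδ)) (hi ?_) hst
  rw [Metric.mem_ball, Subtype.dist_eq, Real.dist_eq, abs_of_nonneg (sub_nonneg.2 (show (s : ℝ) ≤ t from hst))]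
  exact hlt

lemma Control.sum_le (u : ℕ → Time T) (hu : Monotone u) (n : ℕ) :
    ∑ i ∈ Finset.range n, ω (u i) (u (i + 1)) ≤ ω (u 0) (u n) := by
  induction n with
  | zero => simp [ω.self_eq_zero]
  | succ n ih =>
    rw [Finset.sum_range_succ]
    have := ω.superadd (u 0) (u n) (u (n + 1)) (hu (Nat.zero_le n)) (hu n.le_succ)
    linarith

end Controls

/-! ### The sewing lemma -/

section Sewing

variable {T : ℝ} {ω : Control T} {E : Type*} [NormedAddCommGroup E]

/-- The constant of the sewing lemma. -/
def sewConst (θ : ℝ) : ℝ := 2 / (1 - 2 ^ (1 - θ))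

lemma two_rpow_lt_one {θ : ℝ} (hθ : 1 < θ) : (2 : ℝ) ^ (1 - θ) < 1 :=
  Real.rpow_lt_one_of_one_lt_of_neg (by norm_num) (by linarith)

lemma sewConst_pos {θ : ℝ} (hθ : 1 < θ) : 0 < sewConst θ :=
  div_pos two_pos (sub_pos.2 (two_rpow_lt_one hθ))

/-- This identity closes the induction over partitions: two halves contribute the factor 2^(1-θ),
and gluing them costs two defects. -/
lemma sewConst_eq {θ : ℝ} (hθ : 1 < θ) : sewConst θ * 2 ^ (1 - θ) + 2 = sewConst θ := by
  have := sub_pos.2 (two_rpow_lt_one hθ)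
  unfold sewConst
  field_simp
  ring

/-- The defect of additivity of `Ξ` on the subintervals of `[a, b]` is at most `K ω ^ θ`. -/
def SewBound (ω : Control T) (θ : ℝ) (a b : Time T) (Ξ : Time T → Time T → E) (K : ℝ) : Prop :=
  ∀ r s t, a ≤ r → r ≤ s → s ≤ t → t ≤ b → ‖Ξ r s + Ξ s t - Ξ r t‖ ≤ K * ω r t ^ θ

lemma SewBound.self_eq_zero {θ : ℝ} (hθ : 1 < θ) {a b : Time T} {Ξ : Time T → Time T → E} {K : ℝ}
    (h : SewBound ω θ a b Ξ K) {t : Time T} (hat : a ≤ t) (htb : t ≤ b) : Ξ t t = 0 := by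
  have := h t t t hat le_rfl le_rfl htb
  rw [add_sub_cancel_right, ω.self_eq_zero, Real.zero_rpow (by linarith), mul_zero] at this
  exact norm_le_zero_iff.1 this

/-- Cut the partition after the last point m with ω(u₀, uₘ) ≤ W/2, where W is the total control. By
superadditivity the part to the right of m + 1 also has control at most W/2. The induction
hypothesis bounds both parts by a multiple of (W/2)^θ, and joining the left part, the middle cell
and the right part costs two defects of at most K W^θ each. -/
lemma SewBound.norm_sum_sub_le {θ : ℝ} (hθ : 1 < θ) {a b : Time T} {Ξ : Time T → Time T → E}
    {K : ℝ} (hK : 0 ≤ K) (h : SewBound ω θ a b Ξ K) (n : ℕ) :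
    ∀ u : ℕ → Time T, Monotone u → a ≤ u 0 → u n ≤ b →
      ‖∑ i ∈ Finset.range n, Ξ (u i) (u (i + 1)) - Ξ (u 0) (u n)‖ ≤
        sewConst θ * K * ω (u 0) (u n) ^ θ := by
  have hC := sewConst_pos hθ
  induction n using Nat.strong_induction_on with
  | _ n ih =>
    intro u hu ha hb
    have hw := ω.nonneg (u 0) (u n) (hu (Nat.zero_le n))
    rcases n.eq_zero_or_pos with rfl | hn
    · simp only [Finset.range_zero, Finset.sum_empty, zero_sub, norm_neg]
      rw [h.self_eq_zero hθ ha hb, norm_zero]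
      positivity
    set W := ω (u 0) (u n) with hW
    let Q : ℕ → Prop := fun m => m < n ∧ ω (u 0) (u m) ≤ W / 2
    have hQ0 : Q 0 := ⟨hn, by rw [ω.self_eq_zero]; positivity⟩
    classical
    set m := Nat.findGreatest Q n with hm
    have hQm : Q m := Nat.findGreatest_spec (Nat.zero_le n) hQ0
    have hright : ω (u (m + 1)) (u n) ≤ W / 2 := by
      by_cases hmn : m + 1 = n
      · rw [hmn, ω.self_eq_zero]; positivity
      · have hlt : m + 1 < n := lt_of_le_of_ne hQm.1 hmn
        have : ¬ Q (m + 1) := Nat.findGreatest_is_greatest (Nat.lt_succ_self m) hlt.le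
        have h1 : W / 2 < ω (u 0) (u (m + 1)) := by
          by_contra hcon
          exact this ⟨hlt, not_lt.1 hcon⟩
        have h2 := ω.superadd (u 0) (u (m + 1)) (u n) (hu (Nat.zero_le _)) (hu hlt.le)
        linarith
    have hmn : m + 1 ≤ n := hQm.1
    have ihl := ih m hQm.1 u hu ha ((hu hQm.1.le).trans hb)
    have ihr := ih (n - (m + 1)) (by omega) (fun i => u (m + 1 + i))
      (fun i j hij => hu (by omega)) (ha.trans (hu (Nat.zero_le _)))
      (by rw [Nat.add_sub_cancel' hmn]; exact hb)
    simp only [Nat.add_sub_cancel' hmn, add_zero] at ihr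
    have hsplit : ∑ i ∈ Finset.range n, Ξ (u i) (u (i + 1)) =
        ∑ i ∈ Finset.range m, Ξ (u i) (u (i + 1)) + Ξ (u m) (u (m + 1)) +
        ∑ i ∈ Finset.range (n - (m + 1)), Ξ (u (m + 1 + i)) (u (m + 1 + i + 1)) := by
      rw [← Finset.sum_range_succ, ← Finset.sum_range_add (fun i => Ξ (u i) (u (i + 1))) (m + 1),
        Nat.add_sub_cancel' hmn]
    have hpow : (W / 2) ^ θ = 2 ^ (1 - θ) / 2 * W ^ θ := by
      rw [Real.div_rpow hw two_pos.le, Real.rpow_sub two_pos, Real.rpow_one]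
      field_simp
    have b1 := h (u 0) (u m) (u (m + 1)) ha (hu (Nat.zero_le _)) (hu m.le_succ)
      ((hu hmn).trans hb)
    have b2 := h (u 0) (u (m + 1)) (u n) ha (hu (Nat.zero_le _)) (hu hmn) hb
    have w1 : ω (u 0) (u (m + 1)) ^ θ ≤ W ^ θ :=
      Real.rpow_le_rpow (ω.nonneg _ _ (hu (Nat.zero_le _)))
        (ω.mono le_rfl (hu (Nat.zero_le _)) (hu hmn)) (by linarith)
    have w2 : ω (u 0) (u m) ^ θ ≤ (W / 2) ^ θ :=
      Real.rpow_le_rpow (ω.nonneg _ _ (hu (Nat.zero_le _))) hQm.2 (by linarith)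
    have w3 : ω (u (m + 1)) (u n) ^ θ ≤ (W / 2) ^ θ :=
      Real.rpow_le_rpow (ω.nonneg _ _ (hu hmn)) hright (by linarith)
    rw [hpow] at w2 w3
    have e : ∑ i ∈ Finset.range n, Ξ (u i) (u (i + 1)) - Ξ (u 0) (u n) =
        (∑ i ∈ Finset.range m, Ξ (u i) (u (i + 1)) - Ξ (u 0) (u m)) +
        (∑ i ∈ Finset.range (n - (m + 1)), Ξ (u (m + 1 + i)) (u (m + 1 + i + 1)) -
          Ξ (u (m + 1)) (u n)) +
        ((Ξ (u 0) (u m) + Ξ (u m) (u (m + 1)) - Ξ (u 0) (u (m + 1))) +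
          (Ξ (u 0) (u (m + 1)) + Ξ (u (m + 1)) (u n) - Ξ (u 0) (u n))) := by
      rw [hsplit]; abel
    rw [e]
    refine (norm_add_le _ _).trans ((add_le_add (norm_add_le _ _) (norm_add_le _ _)).trans ?_)
    have i1 := ihl.trans (mul_le_mul_of_nonneg_left w2 (by positivity))
    have i2 := ihr.trans (mul_le_mul_of_nonneg_left w3 (by positivity))
    have i3 := b1.trans (mul_le_mul_of_nonneg_left w1 hK)
    calc _ ≤ sewConst θ * K * (2 ^ (1 - θ) / 2 * W ^ θ) + sewConst θ * K *
          (2 ^ (1 - θ) / 2 * W ^ θ) + (K * W ^ θ + K * W ^ θ) :=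
          add_le_add (add_le_add i1 i2) (add_le_add i3 b2)
      _ = (sewConst θ * 2 ^ (1 - θ) + 2) * K * W ^ θ := by ring
      _ = _ := by rw [sewConst_eq hθ]

/-- The point `i T / 2 ^ n` of the dyadic mesh, projected to `[a, b]`. -/
def mesh (T : ℝ) (n : ℕ) (a b : Time T) (i : ℕ) : Time T :=
  max a (min b (Set.projIcc 0 T (a.2.1.trans a.2.2) (i * T / 2 ^ n)))

lemma mesh_mono (n : ℕ) (a b : Time T) : Monotone (mesh T n a b) := by
  intro i j hij
  have hT : 0 ≤ T := a.2.1.trans a.2.2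
  refine max_le_max le_rfl (min_le_min le_rfl (Set.monotone_projIcc _ ?_))
  gcongr

lemma mesh_zero (n : ℕ) (a b : Time T) : mesh T n a b 0 = a := by
  refine max_eq_left ((min_le_right _ _).trans ?_)
  simp only [Nat.cast_zero, zero_mul, zero_div, Set.projIcc_left]
  exact a.2.1

lemma mesh_last (n : ℕ) {a b : Time T} (hab : a ≤ b) : mesh T n a b (2 ^ n) = b := by
  unfold mesh
  have : ((2 ^ n : ℕ) : ℝ) * T / 2 ^ n = T := by push_cast; field_simp
  rw [this, Set.projIcc_right, min_eq_left (show b ≤ _ from b.2.2), max_eq_right hab]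

lemma le_mesh (n : ℕ) (a b : Time T) (i : ℕ) : a ≤ mesh T n a b i := le_max_left _ _

lemma mesh_le (n : ℕ) {a b : Time T} (hab : a ≤ b) (i : ℕ) : mesh T n a b i ≤ b :=
  max_le hab (min_le_left _ _)

lemma mesh_refine (n k : ℕ) (a b : Time T) (i : ℕ) :
    mesh T (n + k) a b (i * 2 ^ k) = mesh T n a b i := by
  unfold mesh
  congr 3
  push_cast
  rw [pow_add]
  field_simp

lemma mesh_succ_sub_le (n : ℕ) (a b : Time T) (i : ℕ) :
    (mesh T n a b (i + 1) : ℝ) - mesh T n a b i ≤ T / 2 ^ n := by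
  have hT : 0 ≤ T := a.2.1.trans a.2.2
  have key : ∀ x : ℝ, 0 ≤ x → ∀ y, y = x + T / 2 ^ n →
      (max (a : ℝ) (min b (max 0 (min T y)))) - max (a : ℝ) (min b (max 0 (min T x))) ≤
        T / 2 ^ n := by
    intro x hx y hy
    have h0 : 0 ≤ T / 2 ^ n := by positivity
    simp only [max_def, min_def]
    split_ifs <;> linarith
  exact key (i * T / 2 ^ n) (by positivity) _ (by push_cast; ring)

lemma exists_mesh_small {ε : ℝ} (hε : 0 < ε) :
    ∃ N, ∀ n ≥ N, ∀ a b : Time T, ∀ i, ω (mesh T n a b i) (mesh T n a b (i + 1)) ≤ ε := by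
  obtain ⟨δ, hδ, h⟩ := ω.exists_small hε
  have ht : Filter.Tendsto (fun n : ℕ => T / 2 ^ n) Filter.atTop (𝓝 0) := by
    have := (tendsto_pow_atTop_nhds_zero_of_lt_one (r := (1 / 2 : ℝ)) (by norm_num)
      (by norm_num)).const_mul T
    simpa [div_eq_mul_inv] using this
  obtain ⟨N, hN⟩ := Filter.eventually_atTop.1 (ht.eventually (gt_mem_nhds hδ))
  exact ⟨N, fun n hn a b i => (h _ _ (mesh_mono n a b i.le_succ)
    ((mesh_succ_sub_le n a b i).trans_lt (hN n hn))).le⟩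

/-- Sums of `ω ^ θ` over fine meshes are small. -/
lemma exists_sum_mesh_small {θ : ℝ} (hθ : 1 < θ) {a b : Time T} (hab : a ≤ b) {ε : ℝ}
    (hε : 0 < ε) : ∃ N, ∀ n ≥ N,
      ∑ i ∈ Finset.range (2 ^ n), ω (mesh T n a b i) (mesh T n a b (i + 1)) ^ θ ≤ ε := by
  have hw := ω.nonneg a b hab
  -- If every cell has control at most e, the sum is at most e^(θ-1) times the sum of the controls,
  -- hence at most e^(θ-1) ω(a, b), which is below ε.
  set e : ℝ := (ε / (ω a b + 1)) ^ (1 / (θ - 1)) with he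
  have he0 : 0 < e := Real.rpow_pos_of_pos (by positivity) _
  obtain ⟨N, hN⟩ := exists_mesh_small (ω := ω) he0
  refine ⟨N, fun n hn => ?_⟩
  have hee : e ^ (θ - 1) = ε / (ω a b + 1) := by
    rw [he, ← Real.rpow_mul (by positivity), one_div, inv_mul_cancel₀ (by linarith), Real.rpow_one]
  calc _ ≤ ∑ i ∈ Finset.range (2 ^ n), e ^ (θ - 1) * ω (mesh T n a b i) (mesh T n a b (i + 1)) := by
        refine Finset.sum_le_sum fun i _ => ?_
        have h0 := ω.nonneg _ _ (mesh_mono n a b i.le_succ)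
        have : θ = (θ - 1) + 1 := by ring
        conv_lhs => rw [this]
        rw [Real.rpow_add_of_nonneg h0 (by linarith) zero_le_one, Real.rpow_one]
        exact mul_le_mul_of_nonneg_right
          (Real.rpow_le_rpow h0 (hN n hn a b i) (by linarith)) h0
    _ ≤ e ^ (θ - 1) * ω a b := by
        rw [← Finset.mul_sum]
        refine mul_le_mul_of_nonneg_left ?_ (by positivity)
        have := ω.sum_le _ (mesh_mono n a b) (2 ^ n)
        rwa [mesh_zero n a b, mesh_last n hab] at this
    _ ≤ ε := by
        rw [hee, div_mul_eq_mul_div, div_le_iff₀ (by positivity)]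
        nlinarith

/-- The sum of `Ξ` over the mesh of `[a, b]`. -/
def meshSum (Ξ : Time T → Time T → E) (n : ℕ) (a b : Time T) : E :=
  ∑ i ∈ Finset.range (2 ^ n), Ξ (mesh T n a b i) (mesh T n a b (i + 1))

lemma SewBound.norm_meshSum_sub_le {θ : ℝ} (hθ : 1 < θ) {a b : Time T} (hab : a ≤ b)
    {Ξ : Time T → Time T → E} {K : ℝ} (hK : 0 ≤ K) (h : SewBound ω θ a b Ξ K) (n : ℕ) :
    ‖meshSum Ξ n a b - Ξ a b‖ ≤ sewConst θ * K * ω a b ^ θ := by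
  have := h.norm_sum_sub_le hθ hK (2 ^ n) (mesh T n a b) (mesh_mono n a b) (le_mesh n a b 0)
    (mesh_le n hab _)
  rwa [mesh_zero n a b, mesh_last n hab] at this

lemma sum_range_mul {M : Type*} [AddCommMonoid M] (f : ℕ → M) (a b : ℕ) :
    ∑ i ∈ Finset.range (a * b), f i =
      ∑ i ∈ Finset.range a, ∑ j ∈ Finset.range b, f (i * b + j) := by
  induction a with
  | zero => simp
  | succ a ih => rw [Nat.succ_mul, Finset.sum_range_add, ih, Finset.sum_range_succ]

/-- The finer mesh subdivides each cell of the coarser one into 2^k pieces, so the partition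
estimate applies cell by cell. -/
lemma SewBound.norm_meshSum_add_sub_le {θ : ℝ} (hθ : 1 < θ) {a b : Time T} (hab : a ≤ b)
    {Ξ : Time T → Time T → E} {K : ℝ} (hK : 0 ≤ K) (h : SewBound ω θ a b Ξ K) (n k : ℕ) :
    ‖meshSum Ξ (n + k) a b - meshSum Ξ n a b‖ ≤ sewConst θ * K *
      ∑ i ∈ Finset.range (2 ^ n), ω (mesh T n a b i) (mesh T n a b (i + 1)) ^ θ := by
  unfold meshSum
  rw [pow_add, sum_range_mul, ← Finset.sum_sub_distrib, Finset.mul_sum]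
  refine (norm_sum_le _ _).trans (Finset.sum_le_sum fun i _ => ?_)
  have := h.norm_sum_sub_le hθ hK (2 ^ k) (fun j => mesh T (n + k) a b (i * 2 ^ k + j))
    (fun _ _ hj => mesh_mono _ a b (by omega)) (le_mesh _ a b _) (mesh_le _ hab _)
  have e : i * 2 ^ k + 2 ^ k = (i + 1) * 2 ^ k := by ring
  simp only [add_zero, mesh_refine, e] at this
  simpa only [add_assoc] using this

/-- The meshes of all intervals come from the same dyadic points of [0, T]; this makes mesh sums
over adjacent intervals comparable term by term. -/
lemma mesh_split (n : ℕ) {r s t : Time T} (hrs : r ≤ s) (hst : s ≤ t) (i : ℕ) :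
    mesh T n r s i = min s (mesh T n r t i) ∧ mesh T n s t i = max s (mesh T n r t i) := by
  unfold mesh
  generalize Set.projIcc 0 T _ _ = c
  constructor
  · rw [min_max_distrib_left, min_eq_right hrs, ← min_assoc, min_eq_left hst]
  · rw [← max_assoc, max_eq_left hrs]

/-- A cell not cut by s contributes nothing, because Ξ vanishes on degenerate intervals. A cell cut
by s contributes one defect. -/
lemma SewBound.norm_meshSum_defect_le {θ : ℝ} (hθ : 1 < θ) {r s t : Time T} (hrs : r ≤ s)
    (hst : s ≤ t) {Ξ : Time T → Time T → E} {K : ℝ} (h : SewBound ω θ r t Ξ K) (n : ℕ) :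
    ‖meshSum Ξ n r s + meshSum Ξ n s t - meshSum Ξ n r t‖ ≤
      K * ∑ i ∈ Finset.range (2 ^ n), ω (mesh T n r t i) (mesh T n r t (i + 1)) ^ θ := by
  unfold meshSum
  rw [← Finset.sum_add_distrib, ← Finset.sum_sub_distrib, Finset.mul_sum]
  refine (norm_sum_le _ _).trans (Finset.sum_le_sum fun i _ => ?_)
  simp only [(mesh_split n hrs hst _).1, (mesh_split n hrs hst _).2]
  have hm := mesh_mono n r t i.le_succ
  have h1 := le_mesh n r t i
  have h2 := mesh_le n (hrs.trans hst) (i + 1)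
  set c := mesh T n r t i
  set d := mesh T n r t (i + 1)
  have hself : ∀ {u}, r ≤ u → u ≤ t → Ξ u u = 0 := fun hu hu' => h.self_eq_zero hθ hu hu'
  rcases le_total s c with hc | hc
  · rw [min_eq_left hc, min_eq_left (hc.trans hm), max_eq_right hc, max_eq_right (hc.trans hm),
      hself hrs hst, zero_add, sub_self, norm_zero]
    simpa [hself h1 (hm.trans h2), hself hrs hst] using (norm_nonneg _).trans (h c c d h1 le_rfl hm h2)
  · rcases le_total s d with hd | hd
    · rw [min_eq_right hc, min_eq_left hd, max_eq_left hc, max_eq_right hd]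
      exact h c s d h1 hc hd h2
    · rw [min_eq_right hc, min_eq_right hd, max_eq_left hc, max_eq_left hd,
        hself hrs hst, add_zero, sub_self, norm_zero]
      exact (norm_nonneg _).trans (h c c d h1 le_rfl hm h2)

lemma SewBound.nonneg_or {θ : ℝ} {a b : Time T} {Ξ : Time T → Time T → E} {K : ℝ}
    (h : SewBound ω θ a b Ξ K) : SewBound ω θ a b Ξ |K| := fun r s t h1 h2 h3 h4 =>
  (h r s t h1 h2 h3 h4).trans (mul_le_mul_of_nonneg_right (le_abs_self K)
    (ω.rpow_nonneg _ (h2.trans h3)))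

/-- The sewing lemma. The estimate is local: its constant on `[a, b]` depends only on the
defect of additivity on the subintervals of `[a, b]`. -/
theorem exists_sewing [Fact (0 < T)] [CompleteSpace E] {θ : ℝ} (hθ : 1 < θ)
    {Ξ : Time T → Time T → E} (hΞ : ∃ K, ∀ a b, SewBound ω θ a b Ξ K) :
    ∃ J : Time T → E, J t0 = 0 ∧ ∀ a b K, a ≤ b → 0 ≤ K → SewBound ω θ a b Ξ K →
      ‖J b - J a - Ξ a b‖ ≤ sewConst θ * K * ω a b ^ θ := by
  obtain ⟨K, hK⟩ := hΞ
  have hK' := fun a b => (hK a b).nonneg_or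
  have hC := sewConst_pos hθ
  have hcau : ∀ a b : Time T, a ≤ b → CauchySeq fun n => meshSum Ξ n a b := by
    intro a b hab
    refine Metric.cauchySeq_iff'.2 fun ε hε => ?_
    obtain ⟨N, hN⟩ := exists_sum_mesh_small (ω := ω) hθ hab
      (ε := ε / (2 * (sewConst θ * |K| + 1))) (by positivity)
    refine ⟨N, fun n hn => ?_⟩
    obtain ⟨k, rfl⟩ := Nat.exists_eq_add_of_le hn
    rw [dist_eq_norm]
    refine ((hK' a b).norm_meshSum_add_sub_le hθ hab (abs_nonneg K) N k).trans_lt ?_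
    refine (mul_le_mul_of_nonneg_left (hN N le_rfl) (by positivity)).trans_lt ?_
    rw [mul_div_assoc', div_lt_iff₀ (by positivity)]
    nlinarith [mul_nonneg hC.le (abs_nonneg K)]
  choose! L hL using fun a b hab => cauchySeq_tendsto_of_complete (hcau a b hab)
  -- The defect of additivity of the mesh sums is bounded by a sum of ω^θ over the cells, which
  -- tends to 0.
  have hadd : ∀ r s t, r ≤ s → s ≤ t → L r s + L s t = L r t := by
    intro r s t hrs hst
    have h1 := ((hL r s hrs).add (hL s t hst)).sub (hL r t (hrs.trans hst))
    rw [← sub_eq_zero]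
    refine tendsto_nhds_unique h1 (Metric.tendsto_atTop.2 fun ε hε => ?_)
    obtain ⟨N, hN⟩ := exists_sum_mesh_small (ω := ω) hθ (hrs.trans hst)
      (ε := ε / (2 * (|K| + 1))) (by positivity)
    refine ⟨N, fun n hn => ?_⟩
    rw [dist_zero_right]
    refine ((hK' r t).norm_meshSum_defect_le hθ hrs hst n).trans_lt ?_
    refine (mul_le_mul_of_nonneg_left (hN n hn) (abs_nonneg K)).trans_lt ?_
    rw [mul_div_assoc', div_lt_iff₀ (by positivity)]
    nlinarith [abs_nonneg K]
  refine ⟨fun t => L t0 t, ?_, fun a b K hab hK h => ?_⟩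
  · simpa using hadd t0 t0 t0 le_rfl le_rfl
  · have e : L t0 b - L t0 a = L a b := by rw [← hadd t0 a b (t0_le a) hab]; abel
    simp only [e]
    exact le_of_tendsto ((hL a b hab).sub_const (Ξ a b)).norm
      (.of_forall fun n => h.norm_meshSum_sub_le hθ hab hK n)

/-- An additive family which is `O(ω ^ θ)` with `θ > 1` vanishes. -/
theorem eq_zero_of_additive {θ : ℝ} (hθ : 1 < θ) {D : Time T → Time T → E} {K : ℝ}
    (hadd : ∀ r s t, r ≤ s → s ≤ t → D r s + D s t = D r t)
    (hD : ∀ s t, s ≤ t → ‖D s t‖ ≤ K * ω s t ^ θ) {s t : Time T} (hst : s ≤ t) : D s t = 0 := by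
  have hself : ∀ u, D u u = 0 := fun u => by simpa using hadd u u u le_rfl le_rfl
  -- An additive family equals its sum over any mesh, and these sums are bounded by sums of ω^θ that
  -- tend to 0.
  have hsum : ∀ u : ℕ → Time T, Monotone u → ∀ n,
      ∑ i ∈ Finset.range n, D (u i) (u (i + 1)) = D (u 0) (u n) := by
    intro u hu n
    induction n with
    | zero => simp [hself]
    | succ n ih => rw [Finset.sum_range_succ, ih, hadd _ _ _ (hu (Nat.zero_le n)) (hu n.le_succ)]
  refine norm_le_zero_iff.1 (le_of_forall_pos_le_add fun ε hε => ?_)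
  rw [zero_add]
  obtain ⟨N, hN⟩ := exists_sum_mesh_small (ω := ω) hθ hst (ε := ε / (|K| + 1)) (by positivity)
  have := hsum _ (mesh_mono N s t) (2 ^ N)
  rw [mesh_zero N s t, mesh_last N hst] at this
  rw [← this]
  refine (norm_sum_le _ _).trans ((Finset.sum_le_sum fun i _ => (hD _ _
    (mesh_mono N s t i.le_succ)).trans (mul_le_mul_of_nonneg_right (le_abs_self K)
    (ω.rpow_nonneg _ (mesh_mono N s t i.le_succ)))).trans ?_)
  rw [← Finset.mul_sum]
  refine (mul_le_mul_of_nonneg_left (hN N le_rfl) (abs_nonneg K)).trans ?_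
  rw [mul_div_assoc', div_le_iff₀ (by positivity)]
  nlinarith [abs_nonneg K]

end Sewing

/-! ### Bounds for pairs of paths on an interval -/

/-- The final time `T`. -/
def tT {T : ℝ} [hT : Fact (0 < T)] : Time T := ⟨T, hT.out.le, le_rfl⟩

lemma le_tT {T : ℝ} [Fact (0 < T)] (t : Time T) : t ≤ tT := t.2.2

section Bounds

variable {T : ℝ} {ω : Control T} {p : ℝ}
variable {U : Type*} [NormedAddCommGroup U] [NormedSpace ℝ U]
variable (x : RoughPath ω p U) (q r : ℝ) {E : Type*} [NormedAddCommGroup E] [NormedSpace ℝ E]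

/-- On `[a, b]`, the path is bounded by `m0`, its derivative by `m1`, and the variations of the
derivative and of the remainder by `m2`. -/
structure IvBd (y : (Time T → E) × (Time T → (U →L[ℝ] E))) (a b : Time T) (m0 m1 m2 : ℝ) :
    Prop where
  path : ∀ t, a ≤ t → t ≤ b → ‖y.1 t‖ ≤ m0
  dag : ∀ t, a ≤ t → t ≤ b → ‖y.2 t‖ ≤ m1
  var : ∀ s t, a ≤ s → s ≤ t → t ≤ b → ‖y.2 t - y.2 s‖ ≤ m2 * ω s t ^ (1 / q)
  rem : ∀ s t, a ≤ s → s ≤ t → t ≤ b → ‖remainder x y s t‖ ≤ m2 * ω s t ^ (1 / r)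

variable {x q r}
variable {y : (Time T → E) × (Time T → (U →L[ℝ] E))} {a b : Time T} {m0 m1 m2 n0 n1 n2 : ℝ}

lemma IvBd.mono (h : IvBd x q r y a b m0 m1 m2) (h0 : m0 ≤ n0) (h1 : m1 ≤ n1) (h2 : m2 ≤ n2) :
    IvBd x q r y a b n0 n1 n2 where
  path t ha hb := (h.path t ha hb).trans h0
  dag t ha hb := (h.dag t ha hb).trans h1
  var s t ha hst hb := (h.var s t ha hst hb).trans
    (mul_le_mul_of_nonneg_right h2 (ω.rpow_nonneg _ hst))
  rem s t ha hst hb := (h.rem s t ha hst hb).trans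
    (mul_le_mul_of_nonneg_right h2 (ω.rpow_nonneg _ hst))

lemma IvBd.restrict (h : IvBd x q r y a b m0 m1 m2) {a' b' : Time T} (ha : a ≤ a') (hb : b' ≤ b) :
    IvBd x q r y a' b' m0 m1 m2 where
  path t h1 h2 := h.path t (ha.trans h1) (h2.trans hb)
  dag t h1 h2 := h.dag t (ha.trans h1) (h2.trans hb)
  var s t h1 h2 h3 := h.var s t (ha.trans h1) h2 (h3.trans hb)
  rem s t h1 h2 h3 := h.rem s t (ha.trans h1) h2 (h3.trans hb)

lemma IvBd.add {y' : (Time T → E) × (Time T → (U →L[ℝ] E))} (h : IvBd x q r y a b m0 m1 m2)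
    (h' : IvBd x q r y' a b n0 n1 n2) :
    IvBd x q r (y + y') a b (m0 + n0) (m1 + n1) (m2 + n2) where
  path t ha hb := (norm_add_le _ _).trans (add_le_add (h.path t ha hb) (h'.path t ha hb))
  dag t ha hb := (norm_add_le _ _).trans (add_le_add (h.dag t ha hb) (h'.dag t ha hb))
  var s t ha hst hb := by
    rw [Prod.snd_add, Pi.add_apply, Pi.add_apply, add_sub_add_comm, add_mul]
    exact (norm_add_le _ _).trans (add_le_add (h.var s t ha hst hb) (h'.var s t ha hst hb))
  rem s t ha hst hb := by
    rw [remainder_add, add_mul]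
    exact (norm_add_le _ _).trans (add_le_add (h.rem s t ha hst hb) (h'.rem s t ha hst hb))

lemma IvBd.smul (c : ℝ) (h : IvBd x q r y a b m0 m1 m2) :
    IvBd x q r (c • y) a b (|c| * m0) (|c| * m1) (|c| * m2) where
  path t ha hb := by
    rw [Prod.smul_fst, Pi.smul_apply, norm_smul, Real.norm_eq_abs]
    exact mul_le_mul_of_nonneg_left (h.path t ha hb) (abs_nonneg c)
  dag t ha hb := by
    rw [Prod.smul_snd, Pi.smul_apply, norm_smul, Real.norm_eq_abs]
    exact mul_le_mul_of_nonneg_left (h.dag t ha hb) (abs_nonneg c)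
  var s t ha hst hb := by
    rw [Prod.smul_snd, Pi.smul_apply, Pi.smul_apply, ← smul_sub, norm_smul, Real.norm_eq_abs,
      mul_assoc]
    exact mul_le_mul_of_nonneg_left (h.var s t ha hst hb) (abs_nonneg c)
  rem s t ha hst hb := by
    rw [remainder_smul, norm_smul, Real.norm_eq_abs, mul_assoc]
    exact mul_le_mul_of_nonneg_left (h.rem s t ha hst hb) (abs_nonneg c)

lemma IvBd.nonneg (h : IvBd x q r y a b m0 m1 m2) (hab : a ≤ b) : 0 ≤ m0 ∧ 0 ≤ m1 :=
  ⟨(norm_nonneg _).trans (h.path a le_rfl hab), (norm_nonneg _).trans (h.dag a le_rfl hab)⟩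

end Bounds

/-! ### Controlled rough paths as elements of a Banach space -/

section Space

variable {T : ℝ} {ω : Control T} {p : ℝ}
variable {U : Type*} [NormedAddCommGroup U] [NormedSpace ℝ U]
variable {x : RoughPath ω p U} {q r : ℝ} {E : Type*} [NormedAddCommGroup E] [NormedSpace ℝ E]

/-- The size of the increments of a rough path. -/
def RoughPath.size (x : RoughPath ω p U) : ℝ := varNorm ω p x.inc1 + varNorm ω (p / 2) x.inc2

lemma RoughPath.size_nonneg (x : RoughPath ω p U) : 0 ≤ x.size :=
  add_nonneg (leastConst_nonneg _) (leastConst_nonneg _)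

lemma RoughPath.norm_inc1_le (x : RoughPath ω p U) {s t : Time T} (hst : s ≤ t) :
    ‖x.inc1 s t‖ ≤ x.size * ω s t ^ (1 / p) :=
  (VarBound.of_varNorm x.bound1 s t hst).trans (mul_le_mul_of_nonneg_right
    (le_add_of_nonneg_right (leastConst_nonneg _)) (ω.rpow_nonneg _ hst))

lemma RoughPath.norm_inc2_le (x : RoughPath ω p U) {s t : Time T} (hst : s ≤ t) :
    ‖x.inc2 s t‖ ≤ x.size * ω s t ^ (1 / (p / 2)) :=
  (VarBound.of_varNorm x.bound2 s t hst).trans (mul_le_mul_of_nonneg_right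
    (le_add_of_nonneg_left (leastConst_nonneg _)) (ω.rpow_nonneg _ hst))

/-- A pair of paths of finite variation as a controlled rough path. -/
def CRP.ofMem (y : (Time T → E) × (Time T → (U →L[ℝ] E))) (hy : y ∈ crpSubmodule x q r E) :
    CRP x q r E := ⟨y, hy⟩

lemma CRP.ext {y z : CRP x q r E} (h1 : ∀ t, y.path t = z.path t) (h2 : ∀ t, y.dag t = z.dag t) :
    y = z :=
  Subtype.ext (Prod.ext (funext h1) (funext h2))

lemma CRP.val_add (y z : CRP x q r E) : (y + z).1 = y.1 + z.1 := rfl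
lemma CRP.val_sub (y z : CRP x q r E) : (y - z).1 = y.1 - z.1 := rfl
lemma CRP.val_smul (c : ℝ) (y : CRP x q r E) : (c • y).1 = c • y.1 := rfl
lemma CRP.path_add (y z : CRP x q r E) (t : Time T) : (y + z).path t = y.path t + z.path t := rfl
lemma CRP.dag_add (y z : CRP x q r E) (t : Time T) : (y + z).dag t = y.dag t + z.dag t := rfl
lemma CRP.dag_sub (y z : CRP x q r E) (t : Time T) : (y - z).dag t = y.dag t - z.dag t := rfl
lemma CRP.path_smul (c : ℝ) (y : CRP x q r E) (t : Time T) :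
    (c • y).path t = c • y.path t := rfl
lemma CRP.dag_smul (c : ℝ) (y : CRP x q r E) (t : Time T) : (c • y).dag t = c • y.dag t := rfl

lemma CRP.sharp_add (y z : CRP x q r E) (s t : Time T) :
    (y + z).sharp s t = y.sharp s t + z.sharp s t := remainder_add x y.1 z.1 s t

lemma CRP.sharp_sub (y z : CRP x q r E) (s t : Time T) :
    (y - z).sharp s t = y.sharp s t - z.sharp s t := by
  rw [eq_sub_iff_add_eq, ← CRP.sharp_add, sub_add_cancel]

lemma CRP.path_eq (y : CRP x q r E) (s t : Time T) :
    y.path t - y.path s = y.dag s (x.inc1 s t) + y.sharp s t := by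
  unfold CRP.sharp; abel

variable [Fact (0 < T)]

lemma CRP.norm_dag_sub_le (y : CRP x q r E) {s t : Time T} (hst : s ≤ t) :
    ‖y.dag t - y.dag s‖ ≤ ‖y‖ * ω s t ^ (1 / q) := by
  refine (VarBound.of_varNorm y.2.1 s t hst).trans
    (mul_le_mul_of_nonneg_right ?_ (ω.rpow_nonneg _ hst))
  rw [CRP.norm_def]
  have h := leastConst_nonneg (VarBound ω r y.sharp)
  have h1 := norm_nonneg (y.path t0)
  have h2 := norm_nonneg (y.dag t0)
  change varNorm ω q (fun s t => y.dag t - y.dag s) ≤ _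
  unfold varNorm
  linarith

lemma CRP.norm_sharp_le (y : CRP x q r E) {s t : Time T} (hst : s ≤ t) :
    ‖y.sharp s t‖ ≤ ‖y‖ * ω s t ^ (1 / r) := by
  refine (VarBound.of_varNorm y.2.2 s t hst).trans
    (mul_le_mul_of_nonneg_right ?_ (ω.rpow_nonneg _ hst))
  rw [CRP.norm_def]
  have h := leastConst_nonneg (VarBound ω q (fun s t => y.dag t - y.dag s))
  have h1 := norm_nonneg (y.path t0)
  have h2 := norm_nonneg (y.dag t0)
  change varNorm ω r y.sharp ≤ _
  unfold varNorm at h ⊢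
  linarith

lemma CRP.norm_path_zero_le (y : CRP x q r E) : ‖y.path t0‖ ≤ ‖y‖ := by
  rw [CRP.norm_def]
  have h := leastConst_nonneg (VarBound ω q (fun s t => y.dag t - y.dag s))
  have h' := leastConst_nonneg (VarBound ω r y.sharp)
  have h2 := norm_nonneg (y.dag t0)
  unfold varNorm
  linarith

lemma CRP.norm_dag_zero_le (y : CRP x q r E) : ‖y.dag t0‖ ≤ ‖y‖ := by
  rw [CRP.norm_def]
  have h := leastConst_nonneg (VarBound ω q (fun s t => y.dag t - y.dag s))
  have h' := leastConst_nonneg (VarBound ω r y.sharp)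
  have h2 := norm_nonneg (y.path t0)
  unfold varNorm
  linarith

lemma CRP.norm_le {y : CRP x q r E} {K0 K1 K2 K3 : ℝ} (h0 : ‖y.path t0‖ ≤ K0)
    (h1 : ‖y.dag t0‖ ≤ K1) (hK2 : 0 ≤ K2)
    (h2 : ∀ s t, s ≤ t → ‖y.dag t - y.dag s‖ ≤ K2 * ω s t ^ (1 / q))
    (hK3 : 0 ≤ K3) (h3 : ∀ s t, s ≤ t → ‖y.sharp s t‖ ≤ K3 * ω s t ^ (1 / r)) :
    ‖y‖ ≤ K0 + K1 + K2 + K3 := by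
  rw [CRP.norm_def]
  exact add_le_add (add_le_add (add_le_add h0 h1) (leastConst_le hK2 h2)) (leastConst_le hK3 h3)

lemma IvBd.mem {y : (Time T → E) × (Time T → (U →L[ℝ] E))} {m0 m1 m2 : ℝ}
    (h : IvBd x q r y t0 tT m0 m1 m2) : y ∈ crpSubmodule x q r E :=
  ⟨⟨m2, fun s t hst => h.var s t (t0_le s) hst (le_tT t)⟩,
    ⟨m2, fun s t hst => h.rem s t (t0_le s) hst (le_tT t)⟩⟩

lemma IvBd.norm_le {y : CRP x q r E} {m0 m1 m2 : ℝ} (h : IvBd x q r y.1 t0 tT m0 m1 m2)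
    (hm2 : 0 ≤ m2) : ‖y‖ ≤ m0 + m1 + 2 * m2 := by
  have := CRP.norm_le (h.path t0 le_rfl (le_tT _)) (h.dag t0 le_rfl (le_tT _)) hm2
    (fun s t hst => h.var s t (t0_le s) hst (le_tT t)) hm2
    (fun s t hst => h.rem s t (t0_le s) hst (le_tT t))
  linarith

/-- The norm of a controlled rough path dominates its sup norm up to this factor. -/
def supConst (x : RoughPath ω p U) (q r : ℝ) : ℝ :=
  1 + x.size * ω t0 tT ^ (1 / p) + ω t0 tT ^ (1 / q) + ω t0 tT ^ (1 / r)

lemma one_le_supConst (x : RoughPath ω p U) (q r : ℝ) : 1 ≤ supConst x q r := by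
  have h0 := x.size_nonneg
  have h := fun e => ω.rpow_nonneg e (t0_le (tT : Time T))
  unfold supConst
  have h1 := mul_nonneg h0 (h (1 / p))
  linarith [h (1 / q), h (1 / r)]

lemma Control.rpow_le_total {e : ℝ} (he : 0 ≤ e) {s t : Time T} (hst : s ≤ t) :
    ω s t ^ e ≤ ω t0 tT ^ e :=
  Real.rpow_le_rpow (ω.nonneg s t hst) (ω.mono (t0_le s) hst (le_tT t)) he

/-- The norm controls values at time 0 only. Values at later times are recovered from y_t = y_0 +
y†_0 x¹_{0,t} + y♯_{0,t} and the bound on the increments of y†. -/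
lemma CRP.ivBd (hp : 0 ≤ p) (hq : 0 ≤ q) (hr : 0 ≤ r) (y : CRP x q r E) :
    IvBd x q r y.1 t0 tT (supConst x q r * ‖y‖) (supConst x q r * ‖y‖) ‖y‖ := by
  have hX := x.size_nonneg
  have hw := fun e => ω.rpow_nonneg e (t0_le (tT : Time T))
  have hy := norm_nonneg y
  have hXw := mul_nonneg hX (hw (1 / p))
  refine ⟨fun t _ _ => ?_, fun t _ _ => ?_, fun s t _ hst _ => y.norm_dag_sub_le hst,
    fun s t _ hst _ => y.norm_sharp_le hst⟩
  · have h1 : ‖x.inc1 t0 t‖ ≤ x.size * ω t0 tT ^ (1 / p) := (x.norm_inc1_le (t0_le t)).trans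
      (mul_le_mul_of_nonneg_left (ω.rpow_le_total (by positivity) (t0_le t)) hX)
    have h2 : ‖y.sharp t0 t‖ ≤ ‖y‖ * ω t0 tT ^ (1 / r) := (y.norm_sharp_le (t0_le t)).trans
      (mul_le_mul_of_nonneg_left (ω.rpow_le_total (by positivity) (t0_le t)) hy)
    have h3 : ‖y.dag t0 (x.inc1 t0 t)‖ ≤ ‖y‖ * (x.size * ω t0 tT ^ (1 / p)) :=
      ((y.dag t0).le_opNorm _).trans (mul_le_mul y.norm_dag_zero_le h1 (norm_nonneg _) hy)
    have e : y.path t = y.path t0 + y.dag t0 (x.inc1 t0 t) + y.sharp t0 t := by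
      have := y.path_eq t0 t
      rw [sub_eq_iff_eq_add] at this
      rw [this]; abel
    change ‖y.path t‖ ≤ _
    rw [e]
    refine (norm_add₃_le).trans ?_
    have h4 := y.norm_path_zero_le
    unfold supConst
    nlinarith [mul_nonneg (hw (1 / q)) hy]
  · have h1 := (y.norm_dag_sub_le (t0_le t)).trans
      (mul_le_mul_of_nonneg_left (ω.rpow_le_total (by positivity) (t0_le t)) hy)
    have h2 : ‖y.dag t‖ ≤ ‖y.dag t0‖ + ‖y.dag t - y.dag t0‖ := by
      simpa using norm_add_le (y.dag t0) (y.dag t - y.dag t0)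
    have h4 := y.norm_dag_zero_le
    change ‖y.dag t‖ ≤ _
    unfold supConst
    nlinarith [mul_nonneg (hw (1 / r)) hy, mul_nonneg hXw hy]

variable (x q r E) in
/-- Evaluation of the path as a continuous linear map. -/
def pathL (hp : 0 ≤ p) (hq : 0 ≤ q) (hr : 0 ≤ r) (t : Time T) : CRP x q r E →L[ℝ] E :=
  LinearMap.mkContinuous
    { toFun := fun y => y.path t, map_add' := fun _ _ => rfl, map_smul' := fun _ _ => rfl }
    (supConst x q r) fun y => (y.ivBd hp hq hr).path t (t0_le t) (le_tT t)

variable (x q r E) in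
/-- Evaluation of the derivative as a continuous linear map. -/
def dagL (hp : 0 ≤ p) (hq : 0 ≤ q) (hr : 0 ≤ r) (t : Time T) : CRP x q r E →L[ℝ] U →L[ℝ] E :=
  LinearMap.mkContinuous
    { toFun := fun y => y.dag t, map_add' := fun _ _ => rfl, map_smul' := fun _ _ => rfl }
    (supConst x q r) fun y => (y.ivBd hp hq hr).dag t (t0_le t) (le_tT t)

-- Evaluations at fixed times are bounded, so a Cauchy sequence converges pointwise. The interval
-- bounds on differences pass to the limit, which shows both that the limit is a controlled rough
-- path and that convergence holds in norm.
open Filter in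
theorem CRP.completeSpace [CompleteSpace E] (hp : 0 ≤ p) (hq : 0 ≤ q) (hr : 0 ≤ r) :
    CompleteSpace (CRP x q r E) := by
  refine Metric.complete_of_cauchySeq_tendsto fun u hu => ?_
  have c1 : ∀ t, ∃ l, Tendsto (fun n => (u n).path t) atTop (𝓝 l) := fun t =>
    cauchySeq_tendsto_of_complete
      (hu.map (pathL x q r E hp hq hr t).uniformContinuous)
  have c2 : ∀ t, ∃ l, Tendsto (fun n => (u n).dag t) atTop (𝓝 l) := fun t =>
    cauchySeq_tendsto_of_complete
      (hu.map (dagL x q r E hp hq hr t).uniformContinuous)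
  choose Y hY using c1
  choose Y' hY' using c2
  have bd : ∀ ε > 0, ∃ N, ∀ n ≥ N, IvBd x q r ((u n).1 - (Y, Y')) t0 tT
      (supConst x q r * ε) (supConst x q r * ε) ε := by
    intro ε hε
    obtain ⟨N, hN⟩ := Metric.cauchySeq_iff.1 hu ε hε
    refine ⟨N, fun n hn => ?_⟩
    have hb : ∀ m ≥ N, IvBd x q r (u n - u m).1 t0 tT
        (supConst x q r * ε) (supConst x q r * ε) ε := fun m hm => by
      have h1 := hN n hn m hm
      rw [dist_eq_norm] at h1
      have h2 := one_le_supConst x q r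
      exact ((u n - u m).ivBd hp hq hr).mono (by gcongr) (by gcongr) h1.le
    have hev : ∀ᶠ m in atTop, m ≥ N := eventually_ge_atTop N
    refine ⟨fun t h1 h2 => ?_, fun t h1 h2 => ?_, fun s t h1 h2 h3 => ?_, fun s t h1 h2 h3 => ?_⟩
    · exact le_of_tendsto ((hY t).const_sub ((u n).path t)).norm
        (hev.mono fun m hm => (hb m hm).path t h1 h2)
    · exact le_of_tendsto ((hY' t).const_sub ((u n).dag t)).norm
        (hev.mono fun m hm => (hb m hm).dag t h1 h2)
    · exact le_of_tendsto ((((hY' t).const_sub ((u n).dag t)).sub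
        ((hY' s).const_sub ((u n).dag s)))).norm
        (hev.mono fun m hm => (hb m hm).var s t h1 h2 h3)
    · refine le_of_tendsto (f := fun m => ‖remainder x (u n - u m).1 s t‖) (Tendsto.norm ?_)
        (hev.mono fun m hm => (hb m hm).rem s t h1 h2 h3)
      have k1 := (hY t).const_sub ((u n).path t)
      have k2 := (hY s).const_sub ((u n).path s)
      have k3 : Tendsto (fun m => ((u n).dag s - (u m).dag s) (x.inc1 s t)) atTop
          (𝓝 (((u n).dag s - Y' s) (x.inc1 s t))) :=
        ((ContinuousLinearMap.apply ℝ E (x.inc1 s t)).continuous.tendsto _).comp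
          ((hY' s).const_sub ((u n).dag s))
      exact (k1.sub k2).sub k3
  obtain ⟨N, hN⟩ := bd 1 one_pos
  have hmem : (Y, Y') ∈ crpSubmodule x q r E := by
    have := (crpSubmodule x q r E).sub_mem (u N).2 (hN N le_rfl).mem
    rwa [sub_sub_cancel] at this
  have hC := one_le_supConst x q r
  refine ⟨CRP.ofMem _ hmem, Metric.tendsto_atTop.2 fun ε hε => ?_⟩
  -- The norm is at most m0 + m1 + 2 m2, so the factor 8 gives a total of at most ε / 2.
  obtain ⟨N, hN⟩ := bd (ε / (8 * supConst x q r)) (by positivity)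
  refine ⟨N, fun n hn => ?_⟩
  rw [dist_eq_norm]
  have := IvBd.norm_le (y := u n - CRP.ofMem _ hmem) (hN n hn) (by positivity)
  refine this.trans_lt ?_
  have e : supConst x q r * (ε / (8 * supConst x q r)) = ε / 8 := by field_simp
  have e2 : ε / (8 * supConst x q r) ≤ ε / 8 :=
    div_le_div_of_nonneg_left hε.le (by norm_num) (by linarith)
  rw [e]
  linarith

end Space

/-! ### Bounded maps on the projective tensor product -/

section TensorLemmas

variable {U V E : Type*} [NormedAddCommGroup U] [NormedSpace ℝ U]
  [NormedAddCommGroup V] [NormedSpace ℝ V] [NormedAddCommGroup E] [NormedSpace ℝ E]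

lemma norm_tmul_le (u : U) (v : V) : ‖tmul U V u v‖ ≤ ‖u‖ * ‖v‖ := by
  have h : ‖tmul U V‖ ≤ 1 := LinearMap.mkContinuous₂_norm_le _ zero_le_one _
  refine ((tmul U V).le_opNorm₂ u v).trans ?_
  rw [mul_assoc]
  exact mul_le_of_le_one_left (by positivity) h

/-- Elementary tensors span the algebraic tensor product, which is dense in its completion. -/
lemma tensor_ext {A B : Tensor U V →L[ℝ] E}
    (h : ∀ u v, A (tmul U V u v) = B (tmul U V u v)) (t : Tensor U V) : A t = B t := by
  refine UniformSpace.Completion.induction_on t (isClosed_eq A.continuous B.continuous) fun a => ?_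
  refine TensorProduct.induction_on (motive := fun a : U ⊗[ℝ] V =>
    A ((show AlgTensor U V from a : AlgTensor U V) : Tensor U V) =
      B ((show AlgTensor U V from a : AlgTensor U V) : Tensor U V)) a ?_ ?_ ?_
  · have h0 : (((0 : AlgTensor U V)) : Tensor U V) = 0 := UniformSpace.Completion.coe_zero
    exact (congrArg A h0).trans (by rw [map_zero]; exact ((congrArg B h0).trans (map_zero B)).symm)
  · exact fun u v => h u v
  · intro a b ha hb
    have e := UniformSpace.Completion.coe_add (α := AlgTensor U V) a b
    refine (congrArg A e).trans (Eq.trans ?_ (congrArg B e).symm)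
    rw [map_add, map_add]
    exact congrArg₂ _ ha hb

variable [CompleteSpace E]

lemma norm_tlift_le (B : U →L[ℝ] V →L[ℝ] E) (t : Tensor U V) : ‖tlift B t‖ ≤ ‖B‖ * ‖t‖ := by
  refine UniformSpace.Completion.induction_on t (isClosed_le (by fun_prop) (by fun_prop))
    fun a => ?_
  have e : tlift B (a : Tensor U V) = algLift B a :=
    ContinuousLinearMap.fromCompletion_apply_coe (algLift B) a
  have h : ‖algLift B‖ ≤ ‖B‖ := LinearMap.mkContinuous_norm_le _ (norm_nonneg B) _
  rw [e, UniformSpace.Completion.norm_coe]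
  exact ((algLift B).le_opNorm a).trans (mul_le_mul_of_nonneg_right h (norm_nonneg _))

lemma tlift_add (A B : U →L[ℝ] V →L[ℝ] E) (t : Tensor U V) :
    tlift (A + B) t = tlift A t + tlift B t :=
  tensor_ext (A := tlift (A + B)) (B := tlift A + tlift B) (fun u v => by
    simp [tlift_tmul]) t

lemma tlift_smul (c : ℝ) (A : U →L[ℝ] V →L[ℝ] E) (t : Tensor U V) :
    tlift (c • A) t = c • tlift A t :=
  tensor_ext (A := tlift (c • A)) (B := c • tlift A) (fun u v => by
    simp [tlift_tmul]) t

lemma tlift_sub (A B : U →L[ℝ] V →L[ℝ] E) (t : Tensor U V) :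
    tlift (A - B) t = tlift A t - tlift B t := by
  rw [eq_sub_iff_add_eq, ← tlift_add, sub_add_cancel]

lemma idTensor_add (A B : U →L[ℝ] V) (t : Tensor U U) :
    idTensor (A + B) t = idTensor A t + idTensor B t :=
  tensor_ext (A := idTensor (A + B)) (B := idTensor A + idTensor B) (fun u v => by
    simp [idTensor_tmul]) t

lemma idTensor_smul (c : ℝ) (A : U →L[ℝ] V) (t : Tensor U U) :
    idTensor (c • A) t = c • idTensor A t :=
  tensor_ext (A := idTensor (c • A)) (B := c • idTensor A) (fun u v => by
    simp [idTensor_tmul]) t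

lemma idTensor_sub (A B : U →L[ℝ] V) (t : Tensor U U) :
    idTensor (A - B) t = idTensor A t - idTensor B t := by
  rw [eq_sub_iff_add_eq, ← idTensor_add, sub_add_cancel]

lemma norm_idTensor_le (A : U →L[ℝ] V) (t : Tensor U U) : ‖idTensor A t‖ ≤ ‖A‖ * ‖t‖ := by
  refine (norm_tlift_le _ t).trans (mul_le_mul_of_nonneg_right ?_ (norm_nonneg t))
  refine ContinuousLinearMap.opNorm_le_bound₂ _ (norm_nonneg A) fun a b => ?_
  refine (norm_tmul_le _ _).trans ?_
  calc ‖a‖ * ‖A b‖ ≤ ‖a‖ * (‖A‖ * ‖b‖) := by gcongr; exact A.le_opNorm b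
    _ = ‖A‖ * ‖a‖ * ‖b‖ := by ring

end TensorLemmas

/-! ### The exponents -/

/-- The conditions on the exponents under which integration is possible. -/
structure Expo (p σ : ℝ) : Prop where
  two_le : 2 ≤ p
  pos : 0 < σ
  le_one : σ ≤ 1
  lt : p < 2 + σ

section Exponents

variable {T : ℝ} {p σ : ℝ}

/-- `ω ^ (1 / p)`. -/
def Control.w (ω : Control T) (p : ℝ) (s t : Time T) : ℝ := ω s t ^ (1 / p)

/-- `ω ^ (σ / p)`. -/
def Control.v (ω : Control T) (p σ : ℝ) (s t : Time T) : ℝ := ω s t ^ (σ / p)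

variable (ω : Control T)

lemma Control.w_nonneg {s t : Time T} (h : s ≤ t) : 0 ≤ ω.w p s t := ω.rpow_nonneg _ h

lemma Control.v_nonneg {s t : Time T} (h : s ≤ t) : 0 ≤ ω.v p σ s t := ω.rpow_nonneg _ h

lemma Expo.p_pos (h : Expo p σ) : 0 < p := by linarith [h.two_le]

lemma Control.w_mono (h : Expo p σ) {r s t u : Time T} (hrs : r ≤ s) (hst : s ≤ t) (htu : t ≤ u) :
    ω.w p s t ≤ ω.w p r u :=
  Real.rpow_le_rpow (ω.nonneg s t hst) (ω.mono hrs hst htu)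
    (div_nonneg zero_le_one h.p_pos.le)

lemma Control.v_mono (h : Expo p σ) {r s t u : Time T} (hrs : r ≤ s) (hst : s ≤ t) (htu : t ≤ u) :
    ω.v p σ s t ≤ ω.v p σ r u :=
  Real.rpow_le_rpow (ω.nonneg s t hst) (ω.mono hrs hst htu)
    (div_nonneg h.pos.le h.p_pos.le)

lemma Control.rpow_half (h : Expo p σ) {s t : Time T} (hst : s ≤ t) :
    ω s t ^ (1 / (p / 2)) = ω.w p s t * ω.w p s t := by
  have hp := h.p_pos
  have e : 1 / (p / 2) = 1 / p + 1 / p := by field_simp; norm_num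
  rw [e, Real.rpow_add_of_nonneg (ω.nonneg s t hst) (by positivity) (by positivity)]
  rfl

lemma Control.rpow_q (s t : Time T) : ω s t ^ (1 / (p / σ)) = ω.v p σ s t := by
  rw [one_div_div]; rfl

lemma Control.rpow_r (h : Expo p σ) {s t : Time T} (hst : s ≤ t) :
    ω s t ^ (1 / (p / (1 + σ))) = ω.w p s t * ω.v p σ s t := by
  have hp := h.p_pos
  have hσ := h.pos
  rw [one_div_div, add_div,
    Real.rpow_add_of_nonneg (ω.nonneg s t hst) (by positivity) (by positivity)]
  rfl

/-- The sewing exponent is (2 + σ)/p: defects below always appear as two factors ω^(1/p) and one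
factor ω^(σ/p). -/
lemma Control.rpow_theta (h : Expo p σ) {s t : Time T} (hst : s ≤ t) :
    ω s t ^ ((2 + σ) / p) = ω.w p s t * ω.w p s t * ω.v p σ s t := by
  have hp := h.p_pos
  have hσ := h.pos
  have e : (2 + σ) / p = (1 / p + 1 / p) + σ / p := by ring
  rw [e, Real.rpow_add_of_nonneg (ω.nonneg s t hst) (by positivity) (by positivity),
    Real.rpow_add_of_nonneg (ω.nonneg s t hst) (by positivity) (by positivity)]
  rfl

lemma Expo.one_lt (h : Expo p σ) : 1 < (2 + σ) / p := (one_lt_div h.p_pos).2 h.lt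

variable [Fact (0 < T)]

/-- A constant that dominates powers of `ω` on the whole time interval. -/
def Control.D (p σ : ℝ) : ℝ :=
  1 + ω.w p t0 tT + ω.v p σ t0 tT + ω t0 tT ^ ((1 - σ) / p)

lemma Control.one_le_D : 1 ≤ ω.D p σ := by
  have h1 := ω.w_nonneg (p := p) (t0_le (tT : Time T))
  have h2 := ω.v_nonneg (p := p) (σ := σ) (t0_le (tT : Time T))
  have h3 := ω.rpow_nonneg ((1 - σ) / p) (t0_le (tT : Time T))
  unfold Control.D
  linarith

lemma Control.w_le_D (h : Expo p σ) {s t : Time T} (hst : s ≤ t) : ω.w p s t ≤ ω.D p σ := by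
  have h1 := ω.w_mono h (t0_le s) hst (le_tT t)
  have h2 := ω.v_nonneg (p := p) (σ := σ) (t0_le (tT : Time T))
  have h3 := ω.rpow_nonneg ((1 - σ) / p) (t0_le (tT : Time T))
  unfold Control.D
  linarith

lemma Control.v_le_D (h : Expo p σ) {s t : Time T} (hst : s ≤ t) : ω.v p σ s t ≤ ω.D p σ := by
  have h1 := ω.v_mono h (t0_le s) hst (le_tT t)
  have h2 := ω.w_nonneg (p := p) (t0_le (tT : Time T))
  have h3 := ω.rpow_nonneg ((1 - σ) / p) (t0_le (tT : Time T))
  unfold Control.D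
  linarith

/-- As σ ≤ 1, a factor ω^(1/p) can be traded for the weaker ω^(σ/p) at the price of a constant. This
is how bounds of drivers and solutions are used in the larger space of integrands. -/
lemma Control.w_le_D_mul_v (h : Expo p σ) {s t : Time T} (hst : s ≤ t) :
    ω.w p s t ≤ ω.D p σ * ω.v p σ s t := by
  have hp := h.p_pos
  have hσ := h.pos
  have hσ' := sub_nonneg.2 h.le_one
  have e : 1 / p = (1 - σ) / p + σ / p := by ring
  have h0 := ω.nonneg s t hst
  have hv := ω.v_nonneg (p := p) (σ := σ) hst
  unfold Control.w
  rw [e, Real.rpow_add_of_nonneg h0 (by positivity) (by positivity)]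
  refine mul_le_mul_of_nonneg_right ?_ hv
  have h1 := ω.rpow_le_total (e := (1 - σ) / p) (by positivity) hst
  have h2 := ω.w_nonneg (p := p) (t0_le (tT : Time T))
  have h3 := ω.v_nonneg (p := p) (σ := σ) (t0_le (tT : Time T))
  unfold Control.D
  linarith

end Exponents

/-! ### Families that are negligible in the sewing lemma -/

section Negligible

variable {T : ℝ} {ω : Control T} {E : Type*} [NormedAddCommGroup E]

variable (ω) in
/-- `A` is `O(ω ^ θ)` for some `θ > 1`. -/
def Negligible (A : Time T → Time T → E) : Prop :=
  ∃ θ > (1 : ℝ), ∃ K, ∀ s t, s ≤ t → ‖A s t‖ ≤ K * ω s t ^ θ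

/-- The two exponents may differ; the smaller one serves for both, the excess power of ω being
bounded by its value on the whole interval. -/
lemma Negligible.add [Fact (0 < T)] {A B : Time T → Time T → E} (hA : Negligible ω A)
    (hB : Negligible ω B) : Negligible ω fun s t => A s t + B s t := by
  obtain ⟨θ, hθ, K, hK⟩ := hA
  obtain ⟨θ', hθ', K', hK'⟩ := hB
  have aux : ∀ η, min θ θ' ≤ η → ∀ L, ∀ s t : Time T, s ≤ t → L * ω s t ^ η ≤
      |L| * ω t0 tT ^ (η - min θ θ') * ω s t ^ min θ θ' := by
    intro η hη L s t hst
    have h1 : ω s t ^ η = ω s t ^ (η - min θ θ') * ω s t ^ min θ θ' := by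
      rw [← Real.rpow_add_of_nonneg (ω.nonneg s t hst) (by linarith)
        (le_min (by linarith) (by linarith)), sub_add_cancel]
    rw [h1, mul_assoc]
    have h2 := ω.rpow_nonneg (min θ θ') hst
    have h3 := ω.rpow_le_total (e := η - min θ θ') (by linarith) hst
    have h4 := ω.rpow_nonneg (η - min θ θ') hst
    calc _ ≤ |L| * (ω s t ^ (η - min θ θ') * ω s t ^ min θ θ') :=
          mul_le_mul_of_nonneg_right (le_abs_self L) (by positivity)
      _ ≤ _ := by gcongr
  refine ⟨min θ θ', lt_min hθ hθ',
    |K| * ω t0 tT ^ (θ - min θ θ') + |K'| * ω t0 tT ^ (θ' - min θ θ'), fun s t hst => (norm_add_le _ _).trans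
    ((add_le_add ((hK s t hst).trans (aux θ (min_le_left _ _) K s t hst))
      ((hK' s t hst).trans (aux θ' (min_le_right _ _) K' s t hst))).trans_eq (add_mul _ _ _).symm)⟩

lemma Negligible.smul [NormedSpace ℝ E] {A : Time T → Time T → E} (hA : Negligible ω A) (c : ℝ) :
    Negligible ω fun s t => c • A s t := by
  obtain ⟨θ, hθ, K, hK⟩ := hA
  refine ⟨θ, hθ, |c| * K, fun s t hst => ?_⟩
  rw [norm_smul, Real.norm_eq_abs, mul_assoc]
  exact mul_le_mul_of_nonneg_left (hK s t hst) (abs_nonneg c)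

lemma Negligible.congr {A B : Time T → Time T → E} (hA : Negligible ω A)
    (h : ∀ s t, s ≤ t → A s t = B s t) : Negligible ω B := by
  obtain ⟨θ, hθ, K, hK⟩ := hA
  exact ⟨θ, hθ, K, fun s t hst => h s t hst ▸ hK s t hst⟩

lemma Negligible.sub [Fact (0 < T)] [NormedSpace ℝ E] {A B : Time T → Time T → E}
    (hA : Negligible ω A) (hB : Negligible ω B) : Negligible ω fun s t => A s t - B s t :=
  (hA.add (hB.smul (-1))).congr fun s t _ => by rw [neg_one_smul, sub_eq_add_neg]

lemma Negligible.eq_zero {A : Time T → Time T → E} (hA : Negligible ω A)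
    (hadd : ∀ r s t, r ≤ s → s ≤ t → A r s + A s t = A r t) {s t : Time T} (hst : s ≤ t) :
    A s t = 0 := by
  obtain ⟨θ, hθ, K, hK⟩ := hA
  exact eq_zero_of_additive hθ hadd hK hst

end Negligible

/-! ### The iterated integral of the rough path and a controlled rough path -/

section Flat

variable {T : ℝ} [Fact (0 < T)] {ω : Control T} {p σ : ℝ}
variable {U V W : Type*} [NormedAddCommGroup U] [NormedSpace ℝ U]
  [NormedAddCommGroup V] [NormedSpace ℝ V] [NormedAddCommGroup W] [NormedSpace ℝ W]
variable {x : RoughPath ω p U}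

lemma RoughPath.norm_inc2_le_w (hσ : Expo p σ) (x : RoughPath ω p U) {s t : Time T}
    (hst : s ≤ t) : ‖x.inc2 s t‖ ≤ x.size * (ω.w p s t * ω.w p s t) := by
  rw [← ω.rpow_half hσ hst]; exact x.norm_inc2_le hst

/-- The increments of a controlled rough path. -/
lemma IvBd.norm_path_sub_le (hσ : Expo p σ) {y : (Time T → V) × (Time T → (U →L[ℝ] V))}
    {a b : Time T} {m0 m1 m2 : ℝ} (hm2 : 0 ≤ m2) (h : IvBd x p (p / 2) y a b m0 m1 m2)
    {s t : Time T} (has : a ≤ s) (hst : s ≤ t) (htb : t ≤ b) :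
    ‖y.1 t - y.1 s‖ ≤ (m1 * x.size + m2 * ω.D p σ) * ω.w p s t := by
  have h1 : y.1 t - y.1 s = y.2 s (x.inc1 s t) + remainder x y s t := by
    unfold remainder; abel
  rw [h1]
  have hw := ω.w_nonneg (p := p) hst
  have hm1 := (h.nonneg (has.trans (hst.trans htb))).2
  have h2 : ‖y.2 s (x.inc1 s t)‖ ≤ m1 * (x.size * ω.w p s t) :=
    ((y.2 s).le_opNorm _).trans (mul_le_mul (h.dag s has (hst.trans htb)) (x.norm_inc1_le hst)
      (norm_nonneg _) hm1)
  have h3 := h.rem s t has hst htb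
  rw [ω.rpow_half hσ hst] at h3
  have h4 : m2 * (ω.w p s t * ω.w p s t) ≤ m2 * (ω.D p σ * ω.w p s t) := by
    gcongr; exact ω.w_le_D hσ hst
  calc _ ≤ m1 * (x.size * ω.w p s t) + m2 * (ω.D p σ * ω.w p s t) :=
        (norm_add_le _ _).trans (add_le_add h2 (h3.trans h4))
    _ = _ := by ring

/-- The germ of `z♭`, up to the term `x¹ ⊗ z`. -/
def flatGerm (z : CRP x p (p / 2) W) (s t : Time T) : Tensor U W :=
  idTensor (z.dag s) (x.inc2 s t) + tmul U W (x.lev1 s) (z.path t - z.path s)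

/-- Adding x¹_s ⊗ z_{s,t} turns the multiplicative relation for z♭ into plain additivity, so that
sewing applies. The multiplicative relation for x² cancels the leading term x¹_{r,s} ⊗ z†_r x¹_{s,t}
of the defect, and every remaining term has order ω^(3/p). -/
lemma flatGerm_defect (z : CRP x p (p / 2) W) (r s t : Time T) :
    flatGerm z r s + flatGerm z s t - flatGerm z r t =
      idTensor (z.dag s - z.dag r) (x.inc2 s t) +
        tmul U W (x.inc1 r s) (z.sharp s t + (z.dag s - z.dag r) (x.inc1 s t)) := by
  have h1 : z.sharp s t + (z.dag s - z.dag r) (x.inc1 s t) =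
      z.path t - z.path s - z.dag r (x.inc1 s t) := by
    unfold CRP.sharp
    rw [sub_apply]; abel
  rw [h1, idTensor_sub]
  unfold flatGerm
  rw [x.inc2_mul r s t]
  simp only [map_add, map_sub, idTensor_tmul, RoughPath.inc1, sub_apply]
  abel

/-- The constant in the bound of the defect of the germ of `z♭`. -/
def flatConst (x : RoughPath ω p U) (σ : ℝ) : ℝ := ω.D p σ * (2 * x.size + x.size * x.size)

lemma flatConst_nonneg : 0 ≤ flatConst x σ := by
  have h := x.size_nonneg
  have h2 := zero_le_one.trans (ω.one_le_D (p := p) (σ := σ))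
  unfold flatConst
  positivity

/-- The defect carries three factors ω^(1/p); one is traded for ω^(σ/p), so that the same sewing
exponent serves here and for the integral. -/
lemma flatGerm_sewBound (hσ : Expo p σ) (z : CRP x p (p / 2) W) {a b : Time T} {m0 M : ℝ}
    (hM : 0 ≤ M) (hz : IvBd x p (p / 2) z.1 a b m0 M M) :
    SewBound ω ((2 + σ) / p) a b (flatGerm z) (M * flatConst x σ) := by
  intro r s t har hrs hst htb
  have hX := x.size_nonneg
  have hD := zero_le_one.trans (ω.one_le_D (p := p) (σ := σ))
  have hrt := hrs.trans hst
  rw [flatGerm_defect, ω.rpow_theta hσ hrt]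
  set w := ω.w p r t
  set v := ω.v p σ r t
  have hw : 0 ≤ w := ω.w_nonneg hrt
  have hv : 0 ≤ v := ω.v_nonneg hrt
  have w1 : ω.w p r s ≤ w := ω.w_mono hσ le_rfl hrs hst
  have w2 : ω.w p s t ≤ w := ω.w_mono hσ hrs hst le_rfl
  have w1' := ω.w_nonneg (p := p) hrs
  have w2' := ω.w_nonneg (p := p) hst
  have b1 : ‖z.dag s - z.dag r‖ ≤ M * w := (hz.var r s har hrs (hst.trans htb)).trans
    (mul_le_mul_of_nonneg_left w1 hM)
  have b2 : ‖x.inc2 s t‖ ≤ x.size * (w * w) := (x.norm_inc2_le_w hσ hst).trans (by gcongr)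
  have b3 : ‖x.inc1 r s‖ ≤ x.size * w := (x.norm_inc1_le hrs).trans (by gcongr; exact w1)
  have b4 : ‖x.inc1 s t‖ ≤ x.size * w := (x.norm_inc1_le hst).trans (by gcongr; exact w2)
  have b5 : ‖z.sharp s t‖ ≤ M * (w * w) := by
    have := hz.rem s t (har.trans hrs) hst htb
    rw [ω.rpow_half hσ hst] at this
    exact this.trans (by gcongr)
  have b6 : ‖z.sharp s t + (z.dag s - z.dag r) (x.inc1 s t)‖ ≤
      M * (w * w) + M * w * (x.size * w) :=
    (norm_add_le _ _).trans (add_le_add b5 (((z.dag s - z.dag r).le_opNorm _).trans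
      (mul_le_mul b1 b4 (norm_nonneg _) (by positivity))))
  calc _ ≤ M * w * (x.size * (w * w)) +
        x.size * w * (M * (w * w) + M * w * (x.size * w)) :=
        (norm_add_le _ _).trans (add_le_add ((norm_idTensor_le _ _).trans
          (mul_le_mul b1 b2 (norm_nonneg _) (by positivity)))
          ((norm_tmul_le _ _).trans (mul_le_mul b3 b6 (norm_nonneg _) (by positivity))))
    _ = M * (2 * x.size + x.size * x.size) * (w * w) * w := by ring
    _ ≤ M * (2 * x.size + x.size * x.size) * (w * w) * (ω.D p σ * v) := by
        gcongr; exact ω.w_le_D_mul_v hσ hrt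
    _ = _ := by unfold flatConst; ring

/-- The path is bounded together with its increments by a multiple of the norm. -/
lemma CRP.ivBd_self (hσ : Expo p σ) (z : CRP x p (p / 2) W) :
    IvBd x p (p / 2) z.1 t0 tT (supConst x p (p / 2) * ‖z‖) (supConst x p (p / 2) * ‖z‖)
      (supConst x p (p / 2) * ‖z‖) :=
  (z.ivBd hσ.p_pos.le hσ.p_pos.le (by linarith [hσ.p_pos])).mono le_rfl le_rfl
    (le_mul_of_one_le_left (norm_nonneg z) (one_le_supConst x _ _))

/-- Sewing gives an additive path J, and subtracting x¹_s ⊗ z_{s,t} from its increments restores the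
multiplicative relation. The estimate uses only bounds for z on the interval concerned. -/
lemma exists_flat (hσ : Expo p σ) (z : CRP x p (p / 2) W) :
    ∃ φ : Time T → Time T → Tensor U W,
      (∀ a b c, φ a b + φ b c + tmul U W (x.inc1 a b) (z.path c - z.path b) = φ a c) ∧
      ∀ a b m0 M, a ≤ b → 0 ≤ M → IvBd x p (p / 2) z.1 a b m0 M M →
        ‖φ a b - idTensor (z.dag a) (x.inc2 a b)‖ ≤
          sewConst ((2 + σ) / p) * (M * flatConst x σ) * ω a b ^ ((2 + σ) / p) := by
  have hC := zero_le_one.trans (one_le_supConst x p (p / 2))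
  obtain ⟨J, -, hJ⟩ := exists_sewing (ω := ω) hσ.one_lt (Ξ := flatGerm z)
    ⟨_, fun a b => flatGerm_sewBound hσ z (mul_nonneg hC (norm_nonneg z))
      ((z.ivBd_self hσ).restrict (t0_le a) (le_tT b))⟩
  refine ⟨fun s t => J t - J s - tmul U W (x.lev1 s) (z.path t - z.path s),
    fun a b c => ?_, fun a b m0 M hab hM hz => ?_⟩
  · simp only [RoughPath.inc1, map_sub, sub_apply]
    abel
  · have := hJ a b _ hab (mul_nonneg hM flatConst_nonneg) (flatGerm_sewBound hσ z hM hz)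
    refine le_of_eq_of_le (congrArg _ ?_) this
    exact (sub_sub _ _ _).trans (congrArg _ (add_comm _ _))

/-- The family `z♭`. -/
def flat (hσ : Expo p σ) (z : CRP x p (p / 2) W) : Time T → Time T → Tensor U W :=
  (exists_flat hσ z).choose

lemma flat_isFlat (hσ : Expo p σ) (z : CRP x p (p / 2) W) : IsFlat z (flat hσ z) :=
  ⟨fun a b c _ _ => (exists_flat hσ z).choose_spec.1 a b c, (2 + σ) / p, hσ.one_lt, _,
    fun s t hst => (exists_flat hσ z).choose_spec.2 s t _ _ hst
      (mul_nonneg (zero_le_one.trans (one_le_supConst x p (p / 2))) (norm_nonneg z))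
      ((z.ivBd_self hσ).restrict (t0_le s) (le_tT t))⟩

/-- The tensor terms cancel in the difference of the two families, which is therefore additive; it
is also negligible, hence zero. -/
lemma IsFlat.eq {z : CRP x p (p / 2) W} {φ ψ : Time T → Time T → Tensor U W} (hφ : IsFlat z φ)
    (hψ : IsFlat z ψ) {s t : Time T} (hst : s ≤ t) : φ s t = ψ s t := by
  have h1 : Negligible ω fun s t => φ s t - idTensor (z.dag s) (x.inc2 s t) := hφ.2
  have h2 : Negligible ω fun s t => ψ s t - idTensor (z.dag s) (x.inc2 s t) := hψ.2
  have h := (h1.sub h2).congr (B := fun s t => φ s t - ψ s t) fun s t _ => by abel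
  refine sub_eq_zero.1 (h.eq_zero (fun a b c hab hbc => ?_) hst)
  rw [← hφ.1 a b c hab hbc, ← hψ.1 a b c hab hbc]
  abel

lemma IsFlat.add {z z' : CRP x p (p / 2) W} {φ ψ : Time T → Time T → Tensor U W}
    (hφ : IsFlat z φ) (hψ : IsFlat z' ψ) : IsFlat (z + z') fun s t => φ s t + ψ s t := by
  refine ⟨fun a b c hab hbc => ?_, ?_⟩
  · simp only [← hφ.1 a b c hab hbc, ← hψ.1 a b c hab hbc, CRP.path_add, map_sub, map_add]
    abel
  · have h1 : Negligible ω fun s t => φ s t - idTensor (z.dag s) (x.inc2 s t) := hφ.2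
    refine (h1.add (B := fun s t => ψ s t - idTensor (z'.dag s) (x.inc2 s t)) hψ.2).congr
      fun s t _ => ?_
    rw [CRP.dag_add, idTensor_add]
    exact (add_sub_add_comm _ _ _ _).symm

lemma IsFlat.smul (c : ℝ) {z : CRP x p (p / 2) W} {φ : Time T → Time T → Tensor U W}
    (hφ : IsFlat z φ) : IsFlat (c • z) fun s t => c • φ s t := by
  refine ⟨fun a b d hab hbc => ?_, ?_⟩
  · simp only [← hφ.1 a b d hab hbc, CRP.path_smul, ← smul_sub, map_smul, smul_add]
  · have h1 : Negligible ω fun s t => φ s t - idTensor (z.dag s) (x.inc2 s t) := hφ.2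
    refine (h1.smul c).congr fun s t _ => ?_
    rw [CRP.dag_smul, idTensor_smul, smul_sub]

/-- The constant in the bound of `z♭`. -/
def flatNorm (x : RoughPath ω p U) (σ : ℝ) : ℝ := x.size + sewConst ((2 + σ) / p) * flatConst x σ * ω.D p σ

lemma flatNorm_nonneg (hσ : Expo p σ) : 0 ≤ flatNorm x σ := by
  have h := x.size_nonneg
  have h1 := zero_le_one.trans (ω.one_le_D (p := p) (σ := σ))
  have h2 := flatConst_nonneg (x := x) (σ := σ)
  have h3 := (sewConst_pos hσ.one_lt).le
  unfold flatNorm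
  positivity

lemma norm_flat_le (hσ : Expo p σ) {z : CRP x p (p / 2) W} {a b : Time T} {m0 M : ℝ}
    (hM : 0 ≤ M) (hz : IvBd x p (p / 2) z.1 a b m0 M M) {s t : Time T} (has : a ≤ s)
    (hst : s ≤ t) (htb : t ≤ b) :
    ‖flat hσ z s t‖ ≤ M * flatNorm x σ * (ω.w p s t * ω.w p s t) := by
  have h := (exists_flat hσ z).choose_spec.2 s t _ _ hst hM (hz.restrict has htb)
  rw [ω.rpow_theta hσ hst] at h
  have hX := x.size_nonneg
  have hS := (sewConst_pos hσ.one_lt).le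
  have hF := flatConst_nonneg (x := x) (σ := σ)
  have hw := ω.w_nonneg (p := p) hst
  have hv := ω.v_nonneg (p := p) (σ := σ) hst
  have hvD := ω.v_le_D hσ hst
  have e : flat hσ z s t = (flat hσ z s t - idTensor (z.dag s) (x.inc2 s t)) +
    idTensor (z.dag s) (x.inc2 s t) := by abel
  rw [e]
  have h2 : ‖idTensor (z.dag s) (x.inc2 s t)‖ ≤ M * (x.size * (ω.w p s t * ω.w p s t)) :=
    (norm_idTensor_le _ _).trans (mul_le_mul (hz.dag s has (hst.trans htb))
      (x.norm_inc2_le_w hσ hst) (norm_nonneg _) hM)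
  refine (norm_add_le _ _).trans ((add_le_add h h2).trans ?_)
  calc _ ≤ sewConst ((2 + σ) / p) * (M * flatConst x σ) * (ω.w p s t * ω.w p s t * ω.D p σ) +
        M * (x.size * (ω.w p s t * ω.w p s t)) := by gcongr
    _ = _ := by unfold flatNorm; ring

end Flat

/-! ### The rough integral -/

section Integration

variable {T : ℝ} [Fact (0 < T)] {ω : Control T} {p σ : ℝ}
variable {U V W : Type*} [NormedAddCommGroup U] [NormedSpace ℝ U]
  [NormedAddCommGroup V] [NormedSpace ℝ V] [CompleteSpace V]
  [NormedAddCommGroup W] [NormedSpace ℝ W]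
variable {x : RoughPath ω p U}

/-- The germ of the integral `∫ Y dz`. -/
def intGerm (hσ : Expo p σ) (Y : CRP x (p / σ) (p / (1 + σ)) (W →L[ℝ] V))
    (z : CRP x p (p / 2) W) (s t : Time T) : V :=
  Y.path s (z.path t - z.path s) + tlift (Y.dag s) (flat hσ z s t)

/-- The term x¹_{r,s} ⊗ z_{s,t} in the relation for z♭, hit by Y†_r, removes the first-order part of
Y_{r,s}. What remains pairs Y♯ with an increment of z and an increment of Y† with z♭, both of order
ω^((2+σ)/p). -/
lemma intGerm_defect (hσ : Expo p σ) (Y : CRP x (p / σ) (p / (1 + σ)) (W →L[ℝ] V))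
    (z : CRP x p (p / 2) W) {r s t : Time T} (hrs : r ≤ s) (hst : s ≤ t) :
    intGerm hσ Y z r s + intGerm hσ Y z s t - intGerm hσ Y z r t =
      Y.sharp r s (z.path t - z.path s) + tlift (Y.dag s - Y.dag r) (flat hσ z s t) := by
  unfold intGerm
  rw [← (flat_isFlat hσ z).1 r s t hrs hst, tlift_sub]
  simp only [map_add, tlift_tmul, CRP.sharp, sub_apply, map_sub]
  abel

/-- The constant in the bound of the defect of the germ of the integral. -/
def intConst (x : RoughPath ω p U) (σ : ℝ) : ℝ := x.size + ω.D p σ + flatNorm x σ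

lemma intConst_nonneg (hσ : Expo p σ) : 0 ≤ intConst x σ := by
  have h := x.size_nonneg
  have h1 := zero_le_one.trans (ω.one_le_D (p := p) (σ := σ))
  have h2 := flatNorm_nonneg (x := x) hσ
  unfold intConst
  positivity

lemma intGerm_sewBound (hσ : Expo p σ) {Y : CRP x (p / σ) (p / (1 + σ)) (W →L[ℝ] V)}
    {z : CRP x p (p / 2) W} {a b : Time T} {n0 n1 n2 m0 M : ℝ} (hM : 0 ≤ M) (hn : 0 ≤ n2)
    (hY : IvBd x (p / σ) (p / (1 + σ)) Y.1 a b n0 n1 n2)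
    (hz : IvBd x p (p / 2) z.1 a b m0 M M) :
    SewBound ω ((2 + σ) / p) a b (intGerm hσ Y z) (n2 * M * intConst x σ) := by
  intro r s t har hrs hst htb
  have hX := x.size_nonneg
  have hD := zero_le_one.trans (ω.one_le_D (p := p) (σ := σ))
  have hrt := hrs.trans hst
  have hF := flatNorm_nonneg (x := x) hσ
  rw [intGerm_defect hσ Y z hrs hst, ω.rpow_theta hσ hrt]
  have b1 := hY.rem r s har hrs (hst.trans htb)
  rw [ω.rpow_r hσ hrs] at b1
  have b2 := hY.var r s har hrs (hst.trans htb)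
  rw [ω.rpow_q] at b2
  have b3 := hz.norm_path_sub_le hσ hM (har.trans hrs) hst htb
  have b4 := norm_flat_le hσ hM hz (har.trans hrs) hst htb
  set w := ω.w p r t
  set v := ω.v p σ r t
  have hw : 0 ≤ w := ω.w_nonneg hrt
  have hv : 0 ≤ v := ω.v_nonneg hrt
  have w1 : ω.w p r s ≤ w := ω.w_mono hσ le_rfl hrs hst
  have w2 : ω.w p s t ≤ w := ω.w_mono hσ hrs hst le_rfl
  have v1 : ω.v p σ r s ≤ v := ω.v_mono hσ le_rfl hrs hst
  have w1' := ω.w_nonneg (p := p) hrs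
  have w2' := ω.w_nonneg (p := p) hst
  have v1' := ω.v_nonneg (p := p) (σ := σ) hrs
  calc _ ≤ (n2 * (ω.w p r s * ω.v p σ r s)) * ((M * x.size + M * ω.D p σ) * ω.w p s t) +
        (n2 * ω.v p σ r s) * (M * flatNorm x σ * (ω.w p s t * ω.w p s t)) :=
        (norm_add_le _ _).trans (add_le_add
          (((Y.sharp r s).le_opNorm _).trans (mul_le_mul b1 b3 (norm_nonneg _) (by positivity)))
          ((norm_tlift_le _ _).trans (mul_le_mul b2 b4 (norm_nonneg _) (by positivity))))
    _ ≤ (n2 * (w * v)) * ((M * x.size + M * ω.D p σ) * w) +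
        (n2 * v) * (M * flatNorm x σ * (w * w)) := by gcongr
    _ = _ := by unfold intConst; ring

lemma CRP.ivBd_integrand (hσ : Expo p σ) {E : Type*} [NormedAddCommGroup E] [NormedSpace ℝ E]
    (Y : CRP x (p / σ) (p / (1 + σ)) E) :
    IvBd x (p / σ) (p / (1 + σ)) Y.1 t0 tT (supConst x (p / σ) (p / (1 + σ)) * ‖Y‖)
      (supConst x (p / σ) (p / (1 + σ)) * ‖Y‖) ‖Y‖ := by
  have h1 := hσ.p_pos
  have h2 := hσ.pos
  exact Y.ivBd (by positivity) (by positivity) (by positivity)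

lemma exists_integral (hσ : Expo p σ) (Y : CRP x (p / σ) (p / (1 + σ)) (W →L[ℝ] V))
    (z : CRP x p (p / 2) W) :
    ∃ J : Time T → V, J t0 = 0 ∧ ∀ a b n0 n1 n2 m0 M, a ≤ b → 0 ≤ M → 0 ≤ n2 →
      IvBd x (p / σ) (p / (1 + σ)) Y.1 a b n0 n1 n2 → IvBd x p (p / 2) z.1 a b m0 M M →
        ‖J b - J a - intGerm hσ Y z a b‖ ≤
          sewConst ((2 + σ) / p) * (n2 * M * intConst x σ) * ω a b ^ ((2 + σ) / p) := by
  have hC := zero_le_one.trans (one_le_supConst x p (p / 2))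
  have hCz := mul_nonneg hC (norm_nonneg z)
  obtain ⟨J, hJ0, hJ⟩ := exists_sewing (ω := ω) hσ.one_lt (Ξ := intGerm hσ Y z)
    ⟨_, fun a b => intGerm_sewBound hσ hCz (norm_nonneg Y)
      ((Y.ivBd_integrand hσ).restrict (t0_le a) (le_tT b))
      ((z.ivBd_self hσ).restrict (t0_le a) (le_tT b))⟩
  refine ⟨J, hJ0, fun a b n0 n1 n2 m0 M hab hM hn hY hz => ?_⟩
  exact hJ a b _ hab (mul_nonneg (mul_nonneg hn hM) (intConst_nonneg hσ))
    (intGerm_sewBound hσ hM hn hY hz)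

/-- The integral `∫₀ᵗ Y dz`. -/
def integral (hσ : Expo p σ) (Y : CRP x (p / σ) (p / (1 + σ)) (W →L[ℝ] V))
    (z : CRP x p (p / 2) W) : Time T → V := (exists_integral hσ Y z).choose

lemma integral_zero (hσ : Expo p σ) (Y : CRP x (p / σ) (p / (1 + σ)) (W →L[ℝ] V))
    (z : CRP x p (p / 2) W) : integral hσ Y z t0 = 0 := (exists_integral hσ Y z).choose_spec.1

lemma norm_integral_sub_le (hσ : Expo p σ) {Y : CRP x (p / σ) (p / (1 + σ)) (W →L[ℝ] V)}
    {z : CRP x p (p / 2) W} {a b : Time T} {n0 n1 n2 m0 M : ℝ} (hM : 0 ≤ M) (hn : 0 ≤ n2)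
    (hY : IvBd x (p / σ) (p / (1 + σ)) Y.1 a b n0 n1 n2)
    (hz : IvBd x p (p / 2) z.1 a b m0 M M) {s t : Time T} (has : a ≤ s) (hst : s ≤ t)
    (htb : t ≤ b) :
    ‖integral hσ Y z t - integral hσ Y z s - intGerm hσ Y z s t‖ ≤
      sewConst ((2 + σ) / p) * (n2 * M * intConst x σ) *
        (ω.w p s t * ω.w p s t * ω.v p σ s t) := by
  rw [← ω.rpow_theta hσ hst]
  exact (exists_integral hσ Y z).choose_spec.2 s t n0 n1 n2 m0 M hst hM hn
    (hY.restrict has htb) (hz.restrict has htb)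

lemma negligible_integral (hσ : Expo p σ) (Y : CRP x (p / σ) (p / (1 + σ)) (W →L[ℝ] V))
    (z : CRP x p (p / 2) W) :
    Negligible ω fun s t => integral hσ Y z t - integral hσ Y z s - intGerm hσ Y z s t := by
  refine ⟨_, hσ.one_lt, _, fun s t hst => (exists_integral hσ Y z).choose_spec.2 s t _ _ _ _ _
    hst (mul_nonneg (zero_le_one.trans (one_le_supConst x p (p / 2))) (norm_nonneg z))
    (norm_nonneg Y) ((Y.ivBd_integrand hσ).restrict (t0_le s) (le_tT t))
    ((z.ivBd_self hσ).restrict (t0_le s) (le_tT t))⟩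

lemma eq_of_negligible {J J' : Time T → V} {Ξ : Time T → Time T → V} (h0 : J t0 = J' t0)
    (h : Negligible ω fun s t => J t - J s - Ξ s t)
    (h' : Negligible ω fun s t => J' t - J' s - Ξ s t) : J = J' := by
  funext t
  have hd := (h.sub h').congr (B := fun s t => (J t - J' t) - (J s - J' s)) fun s t _ => by abel
  have := hd.eq_zero (fun r s t _ _ => by abel) (t0_le t)
  rw [h0, sub_self, sub_zero] at this
  exact sub_eq_zero.1 this

/-- The definition leaves the exponent, the constant and the family z♭ free. Uniqueness in both
sewing steps shows that this freedom does not change the integral. -/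
lemma isIntegral_iff (hσ : Expo p σ) (Y : CRP x (p / σ) (p / (1 + σ)) (W →L[ℝ] V))
    (z : CRP x p (p / 2) W) (J : Time T → V) :
    IsIntegral Y.path Y.dag z J ↔ J = integral hσ Y z := by
  constructor
  · rintro ⟨h0, φ, hφ, hJ⟩
    refine eq_of_negligible (Ξ := intGerm hσ Y z) (h0.trans (integral_zero hσ Y z).symm) ?_
      (negligible_integral hσ Y z)
    have hJ' : Negligible ω fun s t =>
      J t - J s - Y.path s (z.path t - z.path s) - tlift (Y.dag s) (φ s t) := hJ
    refine hJ'.congr fun s t hst => ?_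
    rw [hφ.eq (flat_isFlat hσ z) hst]
    unfold intGerm
    abel
  · rintro rfl
    refine ⟨integral_zero hσ Y z, flat hσ z, flat_isFlat hσ z, ?_⟩
    refine (negligible_integral hσ Y z).congr fun s t _ => ?_
    unfold intGerm
    abel

/-- Linearity follows from uniqueness: both sides start at 0 and differ from the same germ by
negligible terms. The three lemmas that follow use the same argument. -/
lemma integral_add_left (hσ : Expo p σ) (Y Y' : CRP x (p / σ) (p / (1 + σ)) (W →L[ℝ] V))
    (z : CRP x p (p / 2) W) :
    integral hσ (Y + Y') z = integral hσ Y z + integral hσ Y' z := by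
  refine eq_of_negligible (Ξ := intGerm hσ (Y + Y') z) (by simp [integral_zero])
    (negligible_integral hσ _ z) ?_
  refine ((negligible_integral hσ Y z).add (negligible_integral hσ Y' z)).congr fun s t _ => ?_
  simp only [intGerm, CRP.path_add, CRP.dag_add, tlift_add, Pi.add_apply, add_apply]
  abel

lemma integral_smul_left (hσ : Expo p σ) (c : ℝ) (Y : CRP x (p / σ) (p / (1 + σ)) (W →L[ℝ] V))
    (z : CRP x p (p / 2) W) : integral hσ (c • Y) z = c • integral hσ Y z := by
  refine eq_of_negligible (Ξ := intGerm hσ (c • Y) z) (by simp [integral_zero])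
    (negligible_integral hσ _ z) ?_
  refine ((negligible_integral hσ Y z).smul c).congr fun s t _ => ?_
  simp only [intGerm, CRP.path_smul, CRP.dag_smul, tlift_smul, Pi.smul_apply, smul_apply,
    smul_sub, smul_add]

lemma integral_add_right (hσ : Expo p σ) (Y : CRP x (p / σ) (p / (1 + σ)) (W →L[ℝ] V))
    (z z' : CRP x p (p / 2) W) :
    integral hσ Y (z + z') = integral hσ Y z + integral hσ Y z' := by
  refine eq_of_negligible (Ξ := intGerm hσ Y (z + z')) (by simp [integral_zero])
    (negligible_integral hσ Y _) ?_
  refine ((negligible_integral hσ Y z).add (negligible_integral hσ Y z')).congr fun s t hst => ?_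
  -- The family z♭ is obtained by choice, so its additivity in z also has to come from uniqueness.
  simp only [intGerm, CRP.path_add,
    (flat_isFlat hσ (z + z')).eq ((flat_isFlat hσ z).add (flat_isFlat hσ z')) hst,
    Pi.add_apply, map_add, map_sub]
  abel

lemma integral_smul_right (hσ : Expo p σ) (c : ℝ) (Y : CRP x (p / σ) (p / (1 + σ)) (W →L[ℝ] V))
    (z : CRP x p (p / 2) W) : integral hσ Y (c • z) = c • integral hσ Y z := by
  refine eq_of_negligible (Ξ := intGerm hσ Y (c • z)) (by simp [integral_zero])
    (negligible_integral hσ Y _) ?_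
  refine ((negligible_integral hσ Y z).smul c).congr fun s t hst => ?_
  simp only [intGerm, CRP.path_smul,
    (flat_isFlat hσ (c • z)).eq ((flat_isFlat hσ z).smul c) hst,
    Pi.smul_apply, ← smul_sub, map_smul, ← smul_add]

/-- The integral as a controlled rough path, as a pair of paths. -/
def intPair (hσ : Expo p σ) (Y : CRP x (p / σ) (p / (1 + σ)) (W →L[ℝ] V))
    (z : CRP x p (p / 2) W) : (Time T → V) × (Time T → (U →L[ℝ] V)) :=
  (integral hσ Y z, fun t => (Y.path t).comp (z.dag t))

/-- The constant in the local bounds of the integral. -/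
def intBd (x : RoughPath ω p U) (σ : ℝ) : ℝ :=
  (1 + x.size + flatNorm x σ + sewConst ((2 + σ) / p) * intConst x σ) * (1 + x.size) *
    ω.D p σ ^ 3

lemma intBd_pos (hσ : Expo p σ) : 0 < intBd x σ := by
  have h := x.size_nonneg
  have h1 := zero_lt_one.trans_le (ω.one_le_D (p := p) (σ := σ))
  have h2 := flatNorm_nonneg (x := x) hσ
  have h3 := intConst_nonneg (x := x) hσ
  have h4 := sewConst_pos hσ.one_lt
  unfold intBd
  positivity

/-- The shape of the three bounds is what later makes integration contractive. The path moves by a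
multiple of the small number ω(a, b)^(σ/p), the derivative sees only the sup bound n0, and the
variation bound n2 of the integrand enters the new variations only with the small factor. The other
contributions are triangular and are handled by weights. -/
lemma intPair_ivBd (hσ : Expo p σ) {Y : CRP x (p / σ) (p / (1 + σ)) (W →L[ℝ] V)}
    {z : CRP x p (p / 2) W} {a b : Time T} {n0 n1 n2 m0 M : ℝ} (hab : a ≤ b) (hM : 0 ≤ M)
    (hn : 0 ≤ n2) (hY : IvBd x (p / σ) (p / (1 + σ)) Y.1 a b n0 n1 n2)
    (hz : IvBd x p (p / 2) z.1 a b m0 M M) :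
    IvBd x p (p / 2) (intPair hσ Y z) a b
      (‖integral hσ Y z a‖ + ω.v p σ a b * (M * intBd x σ * (n0 + n1 + n2))) (n0 * M)
      (M * intBd x σ * (n0 + n1 + ω.v p σ a b * n2)) := by
  obtain ⟨hn0, hn1⟩ := hY.nonneg hab
  have hX := x.size_nonneg
  have hD := ω.one_le_D (p := p) (σ := σ)
  have hF := flatNorm_nonneg (x := x) hσ
  have hS := (sewConst_pos hσ.one_lt).le
  have hI := intConst_nonneg (x := x) hσ
  have he := ω.v_nonneg (p := p) (σ := σ) hab
  have heD := ω.v_le_D hσ hab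
  set e := ω.v p σ a b
  set D := ω.D p σ
  set S := sewConst ((2 + σ) / p)
  set B1 := 1 + x.size + flatNorm x σ + S * intConst x σ with hB1
  have hB1' : 1 + x.size ≤ B1 := by have := mul_nonneg hS hI; linarith
  have hB1n : 1 ≤ B1 := by linarith
  have hB : intBd x σ = B1 * (1 + x.size) * D ^ 3 := rfl
  have hBB : B1 ≤ intBd x σ := by
    rw [hB, mul_assoc]
    refine le_mul_of_one_le_right (by linarith) ?_
    exact one_le_mul_of_one_le_of_one_le (by linarith) (one_le_pow₀ hD)
  have hrem : ∀ s t, a ≤ s → s ≤ t → t ≤ b → ‖remainder x (intPair hσ Y z) s t‖ ≤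
      M * B1 * (n0 + n1 + e * n2) * (ω.w p s t * ω.w p s t) := by
    intro s t has hst htb
    have hw := ω.w_nonneg (p := p) hst
    have hv := ω.v_nonneg (p := p) (σ := σ) hst
    have hve : ω.v p σ s t ≤ e := ω.v_mono hσ has hst htb
    have k1 := norm_integral_sub_le hσ hM hn hY hz has hst htb
    have k2 : ‖Y.path s (z.sharp s t)‖ ≤ n0 * (M * (ω.w p s t * ω.w p s t)) := by
      have h := hz.rem s t has hst htb
      rw [ω.rpow_half hσ hst] at h
      exact ((Y.path s).le_opNorm _).trans (mul_le_mul (hY.path s has (hst.trans htb)) h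
        (norm_nonneg _) hn0)
    have k3 : ‖tlift (Y.dag s) (flat hσ z s t)‖ ≤
        n1 * (M * flatNorm x σ * (ω.w p s t * ω.w p s t)) :=
      (norm_tlift_le _ _).trans (mul_le_mul (hY.dag s has (hst.trans htb))
        (norm_flat_le hσ hM hz has hst htb) (norm_nonneg _) hn1)
    -- The remainder is the sewing error plus Y_s z♯ + Y†_s z♭. Only the sewing error involves n2,
    -- and it carries the extra factor ω^(σ/p).
    have e1 : remainder x (intPair hσ Y z) s t =
        (integral hσ Y z t - integral hσ Y z s - intGerm hσ Y z s t) +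
          Y.path s (z.sharp s t) + tlift (Y.dag s) (flat hσ z s t) := by
      simp only [remainder, intPair, intGerm, CRP.sharp, map_sub, ContinuousLinearMap.comp_apply]
      abel
    rw [e1]
    refine norm_add₃_le.trans ((add_le_add (add_le_add k1 k2) k3).trans ?_)
    calc _ ≤ S * (n2 * M * intConst x σ) * (ω.w p s t * ω.w p s t * e) +
          n0 * (M * (ω.w p s t * ω.w p s t)) +
          n1 * (M * flatNorm x σ * (ω.w p s t * ω.w p s t)) := by gcongr
      _ = M * (S * intConst x σ * (e * n2) + 1 * n0 + flatNorm x σ * n1) *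
          (ω.w p s t * ω.w p s t) := by ring
      _ ≤ M * (B1 * (e * n2) + B1 * n0 + B1 * n1) * (ω.w p s t * ω.w p s t) := by
          gcongr
          · linarith
          · have := mul_nonneg hS hI; linarith
      _ = _ := by ring
  have hdag : ∀ t, a ≤ t → t ≤ b → ‖(intPair hσ Y z).2 t‖ ≤ n0 * M := fun t hat htb =>
    (ContinuousLinearMap.opNorm_comp_le _ _).trans
      (mul_le_mul (hY.path t hat htb) (hz.dag t hat htb) (norm_nonneg _) hn0)
  refine ⟨fun t hat htb => ?_, hdag, fun s t has hst htb => ?_, fun s t has hst htb => ?_⟩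
  · have hw := ω.w_nonneg (p := p) hat
    have k1 := hrem a t le_rfl hat htb
    have k2 : ‖(intPair hσ Y z).2 a (x.inc1 a t)‖ ≤ n0 * M * (x.size * ω.w p a t) :=
      (((intPair hσ Y z).2 a).le_opNorm _).trans (mul_le_mul (hdag a le_rfl hab)
        (x.norm_inc1_le hat) (norm_nonneg _) (by positivity))
    have e1 : (intPair hσ Y z).1 t = integral hσ Y z a + ((intPair hσ Y z).2 a (x.inc1 a t) +
        remainder x (intPair hσ Y z) a t) := by
      simp only [remainder, intPair]; abel
    -- Each term in the increment of the integral has at least one factor ω^(1/p); this one is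
    -- turned into the small factor e.
    have hwe : ω.w p a t ≤ D * e := (ω.w_le_D_mul_v hσ hat).trans
      (mul_le_mul_of_nonneg_left (ω.v_mono hσ le_rfl hat htb) (by linarith))
    have hwD := ω.w_le_D hσ hat
    rw [e1]
    refine (norm_add_le _ _).trans (add_le_add le_rfl ((norm_add_le _ _).trans
      ((add_le_add k2 k1).trans ?_)))
    calc _ ≤ n0 * M * (x.size * (D * e)) + M * B1 * (n0 + n1 + D * n2) * (D * (D * e)) := by
          gcongr
      _ = e * M * (x.size * D * 1 * n0 + B1 * 1 * (D * D) * 1 * (n0 + n1) +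
            B1 * 1 * D ^ 3 * n2) := by ring
      _ ≤ e * M * (x.size * D * (B1 * D ^ 2) * n0 + B1 * 1 * (D * D) * D * (n0 + n1) +
            B1 * 1 * D ^ 3 * n2) := by
          gcongr
          exact one_le_mul_of_one_le_of_one_le hB1n (one_le_pow₀ hD)
      _ ≤ e * M * (x.size * D * (B1 * D ^ 2) * (n0 + n1 + n2) + B1 * 1 * (D * D) * D * (n0 + n1) +
            B1 * 1 * D ^ 3 * n2) := by
          gcongr; linarith
      _ = _ := by rw [hB]; ring
  · have hw := ω.w_nonneg (p := p) hst
    have hv := ω.v_nonneg (p := p) (σ := σ) hst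
    have hve : ω.v p σ s t ≤ e := ω.v_mono hσ has hst htb
    have k1 : ‖Y.path t - Y.path s‖ ≤ n1 * (x.size * ω.w p s t) + n2 * (ω.w p s t * e) := by
      rw [Y.path_eq s t]
      have h := hY.rem s t has hst htb
      rw [ω.rpow_r hσ hst] at h
      refine (norm_add_le _ _).trans (add_le_add (((Y.dag s).le_opNorm _).trans
        (mul_le_mul (hY.dag s has (hst.trans htb)) (x.norm_inc1_le hst) (norm_nonneg _) hn1))
        (h.trans (by gcongr)))
    have e1 : (intPair hσ Y z).2 t - (intPair hσ Y z).2 s =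
        (Y.path t - Y.path s).comp (z.dag t) + (Y.path s).comp (z.dag t - z.dag s) := by
      simp only [intPair, ContinuousLinearMap.sub_comp, ContinuousLinearMap.comp_sub]
      abel
    rw [e1]
    refine (norm_add_le _ _).trans ((add_le_add
      ((ContinuousLinearMap.opNorm_comp_le _ _).trans (mul_le_mul k1
        (hz.dag t (has.trans hst) htb) (norm_nonneg _) (by positivity)))
      ((ContinuousLinearMap.opNorm_comp_le _ _).trans (mul_le_mul
        (hY.path s has (hst.trans htb)) (hz.var s t has hst htb) (norm_nonneg _) hn0))).trans ?_)
    change _ + n0 * (M * ω.w p s t) ≤ _ * ω.w p s t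
    calc _ = M * (1 * n0 + x.size * n1 + 1 * (e * n2)) * ω.w p s t := by ring
      _ ≤ M * (B1 * n0 + B1 * n1 + B1 * (e * n2)) * ω.w p s t := by
          gcongr; linarith
      _ = M * B1 * (n0 + n1 + e * n2) * ω.w p s t := by ring
      _ ≤ _ := by gcongr
  · rw [ω.rpow_half hσ hst]
    refine (hrem s t has hst htb).trans ?_
    have hw := ω.w_nonneg (p := p) hst
    gcongr

lemma intPair_ivBd_total (hσ : Expo p σ) (Y : CRP x (p / σ) (p / (1 + σ)) (W →L[ℝ] V))
    (z : CRP x p (p / 2) W) :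
    IvBd x p (p / 2) (intPair hσ Y z) t0 tT
      (ω.v p σ t0 tT * (supConst x p (p / 2) * ‖z‖ * intBd x σ *
        (supConst x (p / σ) (p / (1 + σ)) * ‖Y‖ + supConst x (p / σ) (p / (1 + σ)) * ‖Y‖ + ‖Y‖)))
      (supConst x (p / σ) (p / (1 + σ)) * ‖Y‖ * (supConst x p (p / 2) * ‖z‖))
      (supConst x p (p / 2) * ‖z‖ * intBd x σ * (supConst x (p / σ) (p / (1 + σ)) * ‖Y‖ +
        supConst x (p / σ) (p / (1 + σ)) * ‖Y‖ + ω.v p σ t0 tT * ‖Y‖)) := by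
  have h := intPair_ivBd hσ (t0_le tT) (mul_nonneg (zero_le_one.trans
    (one_le_supConst x p (p / 2))) (norm_nonneg z)) (norm_nonneg Y) (Y.ivBd_integrand hσ)
    (z.ivBd_self hσ)
  rwa [integral_zero, norm_zero, zero_add] at h

/-- The integral as a bounded bilinear map between spaces of controlled rough paths. -/
def intL (x : RoughPath ω p U) (V W : Type*) [NormedAddCommGroup V] [NormedSpace ℝ V]
    [CompleteSpace V] [NormedAddCommGroup W] [NormedSpace ℝ W] (hσ : Expo p σ) :
    CRP x (p / σ) (p / (1 + σ)) (W →L[ℝ] V) →L[ℝ] CRP x p (p / 2) W →L[ℝ] CRP x p (p / 2) V :=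
  LinearMap.mkContinuous₂
    (LinearMap.mk₂ ℝ (fun Y z => CRP.ofMem (intPair hσ Y z) (intPair_ivBd_total hσ Y z).mem)
      (fun Y Y' z => CRP.ext (fun t => congrFun (integral_add_left hσ Y Y' z) t)
        fun t => ContinuousLinearMap.add_comp _ _ _)
      (fun c Y z => CRP.ext (fun t => congrFun (integral_smul_left hσ c Y z) t)
        fun t => ContinuousLinearMap.smul_comp _ _ _)
      (fun Y z z' => CRP.ext (fun t => congrFun (integral_add_right hσ Y z z') t)
        fun t => ContinuousLinearMap.comp_add _ _ _)
      (fun c Y z => CRP.ext (fun t => congrFun (integral_smul_right hσ c Y z) t)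
        fun t => ContinuousLinearMap.comp_smul _ _ _))
    (ω.v p σ t0 tT * (supConst x p (p / 2) * intBd x σ *
        (supConst x (p / σ) (p / (1 + σ)) + supConst x (p / σ) (p / (1 + σ)) + 1)) +
      supConst x (p / σ) (p / (1 + σ)) * supConst x p (p / 2) +
      2 * (supConst x p (p / 2) * intBd x σ * (supConst x (p / σ) (p / (1 + σ)) +
        supConst x (p / σ) (p / (1 + σ)) + ω.v p σ t0 tT)))
    fun Y z => by
      have h1 := zero_le_one.trans (one_le_supConst x p (p / 2))
      have h2 := zero_le_one.trans (one_le_supConst x (p / σ) (p / (1 + σ)))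
      have h3 := (intBd_pos (x := x) hσ).le
      have h4 := ω.v_nonneg (p := p) (σ := σ) (t0_le (tT : Time T))
      refine (IvBd.norm_le (y := CRP.ofMem (intPair hσ Y z) (intPair_ivBd_total hσ Y z).mem)
        (intPair_ivBd_total hσ Y z) (by positivity)).trans_eq ?_
      ring

lemma intL_path (hσ : Expo p σ) (Y : CRP x (p / σ) (p / (1 + σ)) (W →L[ℝ] V))
    (z : CRP x p (p / 2) W) (t : Time T) : (intL x V W hσ Y z).path t = integral hσ Y z t := rfl

end Integration

/-! ### Products, constants and linear images of controlled rough paths -/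

section Products

variable {T : ℝ} [Fact (0 < T)] {ω : Control T} {p σ : ℝ}
variable {U V E : Type*} [NormedAddCommGroup U] [NormedSpace ℝ U]
  [NormedAddCommGroup V] [NormedSpace ℝ V] [NormedAddCommGroup E] [NormedSpace ℝ E]
variable {x : RoughPath ω p U}

/-- The product of a path of linear maps and a path. -/
def mulPair (A : CRP x (p / σ) (p / (1 + σ)) (V →L[ℝ] E)) (h : CRP x p (p / 2) V) :
    (Time T → E) × (Time T → (U →L[ℝ] E)) :=
  (fun t => A.path t (h.path t),
    fun t => (A.dag t).flip (h.path t) + (A.path t).comp (h.dag t))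

/-- The constant in the bounds of products. -/
def mulConst (x : RoughPath ω p U) (σ : ℝ) : ℝ := 3 * (1 + x.size + ω.D p σ) ^ 3

lemma mulConst_pos : 0 < mulConst x σ := by
  have h := x.size_nonneg
  have h1 := ω.one_le_D (p := p) (σ := σ)
  unfold mulConst
  positivity

/-- Leibniz rule. Increments of A and h both have order ω^(1/p), so the mixed term in the remainder
has order ω^(2/p), which is better than the ω^((1+σ)/p) required. The sup and derivative bounds of
the product do not involve m2; this is needed for the weighted estimates. -/
lemma mulPair_ivBd (hσ : Expo p σ) {A : CRP x (p / σ) (p / (1 + σ)) (V →L[ℝ] E)}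
    {h : CRP x p (p / 2) V} {a b : Time T} {N m0 m1 m2 : ℝ} (hab : a ≤ b) (hm2 : 0 ≤ m2)
    (hA : IvBd x (p / σ) (p / (1 + σ)) A.1 a b N N N) (hh : IvBd x p (p / 2) h.1 a b m0 m1 m2) :
    IvBd x (p / σ) (p / (1 + σ)) (mulPair A h) a b (N * m0) (N * (m0 + m1))
      (N * mulConst x σ * (m0 + m1 + m2)) := by
  obtain ⟨hm0, hm1⟩ := hh.nonneg hab
  have hN := (hA.nonneg hab).1
  have hX := x.size_nonneg
  have hD1 := ω.one_le_D (p := p) (σ := σ)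
  have hD := zero_le_one.trans hD1
  set D := ω.D p σ with hDdef
  have hdec : ∀ s t, a ≤ s → s ≤ t → t ≤ b →
      ‖h.path t - h.path s‖ ≤ (m1 * x.size + m2 * D) * ω.w p s t ∧
      ‖A.path t - A.path s‖ ≤ N * (x.size + D) * ω.w p s t ∧
      ‖A.dag t - A.dag s‖ ≤ N * ω.v p σ s t ∧ ‖A.sharp s t‖ ≤ N * (ω.w p s t * ω.v p σ s t) ∧
      ‖h.sharp s t‖ ≤ m2 * (ω.w p s t * ω.w p s t) := by
    intro s t has hst htb
    have hw := ω.w_nonneg (p := p) hst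
    have hv := ω.v_nonneg (p := p) (σ := σ) hst
    have hvD : ω.v p σ s t ≤ D := ω.v_le_D hσ hst
    have h1 := hA.rem s t has hst htb
    rw [ω.rpow_r hσ hst] at h1
    have h2 := hA.var s t has hst htb
    rw [ω.rpow_q] at h2
    have h3 := hh.rem s t has hst htb
    rw [ω.rpow_half hσ hst] at h3
    refine ⟨hh.norm_path_sub_le hσ hm2 has hst htb, ?_, h2, h1, h3⟩
    rw [A.path_eq s t]
    calc _ ≤ N * (x.size * ω.w p s t) + N * (ω.w p s t * ω.v p σ s t) :=
          (norm_add_le _ _).trans (add_le_add (((A.dag s).le_opNorm _).trans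
            (mul_le_mul (hA.dag s has (hst.trans htb)) (x.norm_inc1_le hst) (norm_nonneg _) hN))
            h1)
      _ ≤ N * (x.size * ω.w p s t) + N * (ω.w p s t * D) := by gcongr
      _ = _ := by ring
  have hflip : ∀ (B : U →L[ℝ] V →L[ℝ] E) (v : V), ‖B.flip v‖ ≤ ‖B‖ * ‖v‖ := fun B v => by
    simpa using B.flip.le_opNorm v
  refine ⟨fun t hat htb => ?_, fun t hat htb => ?_, fun s t has hst htb => ?_,
    fun s t has hst htb => ?_⟩
  · exact ((A.path t).le_opNorm _).trans
      (mul_le_mul (hA.path t hat htb) (hh.path t hat htb) (norm_nonneg _) hN)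
  · rw [mul_add]
    exact (norm_add_le _ _).trans (add_le_add ((hflip _ _).trans
      (mul_le_mul (hA.dag t hat htb) (hh.path t hat htb) (norm_nonneg _) hN))
      ((ContinuousLinearMap.opNorm_comp_le _ _).trans
      (mul_le_mul (hA.path t hat htb) (hh.dag t hat htb) (norm_nonneg _) hN)))
  · obtain ⟨h1, h2, h3, h4, h5⟩ := hdec s t has hst htb
    have hw := ω.w_nonneg (p := p) hst
    have hv := ω.v_nonneg (p := p) (σ := σ) hst
    have hwD : ω.w p s t ≤ D * ω.v p σ s t := ω.w_le_D_mul_v hσ hst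
    have hat := has.trans hst
    have hsb := hst.trans htb
    have e1 : (mulPair A h).2 t - (mulPair A h).2 s =
        ((A.dag t - A.dag s).flip (h.path t) + (A.dag s).flip (h.path t - h.path s)) +
        ((A.path t - A.path s).comp (h.dag t) + (A.path s).comp (h.dag t - h.dag s)) := by
      ext u
      simp [mulPair]
      abel
    rw [e1, ω.rpow_q]
    have hvar := hh.var s t has hst htb
    change ‖h.dag t - h.dag s‖ ≤ m2 * ω.w p s t at hvar
    calc _ ≤ (N * ω.v p σ s t * m0 + N * ((m1 * x.size + m2 * D) * ω.w p s t)) +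
          (N * (x.size + D) * ω.w p s t * m1 + N * (m2 * ω.w p s t)) := by
          refine (norm_add_le _ _).trans (add_le_add ((norm_add_le _ _).trans (add_le_add ?_ ?_))
            ((norm_add_le _ _).trans (add_le_add ?_ ?_)))
          · exact (hflip _ _).trans (mul_le_mul h3 (hh.path t hat htb) (norm_nonneg _)
              (by positivity))
          · exact (hflip _ _).trans (mul_le_mul (hA.dag s has hsb) h1 (norm_nonneg _) hN)
          · exact (ContinuousLinearMap.opNorm_comp_le _ _).trans
              (mul_le_mul h2 (hh.dag t hat htb) (norm_nonneg _) (by positivity))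
          · exact (ContinuousLinearMap.opNorm_comp_le _ _).trans
              (mul_le_mul (hA.path s has hsb) hvar (norm_nonneg _) hN)
      _ ≤ (N * ω.v p σ s t * m0 + N * ((m1 * x.size + m2 * D) * (D * ω.v p σ s t))) +
          (N * (x.size + D) * (D * ω.v p σ s t) * m1 + N * (m2 * (D * ω.v p σ s t))) := by
          gcongr
      _ ≤ _ := by
          -- The constant is a power of 1 + |x| + D, so that after expansion the difference of the
          -- two sides has only non-negative terms.
          refine sub_nonneg.1 ?_
          unfold mulConst
          rw [← hDdef]
          ring_nf
          positivity
  · obtain ⟨h1, h2, h3, h4, h5⟩ := hdec s t has hst htb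
    have hw := ω.w_nonneg (p := p) hst
    have hv := ω.v_nonneg (p := p) (σ := σ) hst
    have hwD : ω.w p s t ≤ D * ω.v p σ s t := ω.w_le_D_mul_v hσ hst
    have hat := has.trans hst
    have hsb := hst.trans htb
    have e1 : remainder x (mulPair A h) s t = A.sharp s t (h.path s) + A.path s (h.sharp s t) +
        (A.path t - A.path s) (h.path t - h.path s) := by
      simp [remainder, mulPair, CRP.sharp]
      abel
    rw [e1, ω.rpow_r hσ hst]
    calc _ ≤ N * (ω.w p s t * ω.v p σ s t) * m0 + N * (m2 * (ω.w p s t * ω.w p s t)) +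
          N * (x.size + D) * ω.w p s t * ((m1 * x.size + m2 * D) * ω.w p s t) := by
          refine norm_add₃_le.trans (add_le_add (add_le_add ?_ ?_) ?_)
          · exact ((A.sharp s t).le_opNorm _).trans
              (mul_le_mul h4 (hh.path s has hsb) (norm_nonneg _) (by positivity))
          · exact ((A.path s).le_opNorm _).trans
              (mul_le_mul (hA.path s has hsb) h5 (norm_nonneg _) hN)
          · exact ((A.path t - A.path s).le_opNorm _).trans
              (mul_le_mul h2 h1 (norm_nonneg _) (by positivity))
      _ ≤ N * (ω.w p s t * ω.v p σ s t) * m0 + N * (m2 * (ω.w p s t * (D * ω.v p σ s t))) +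
          N * (x.size + D) * ω.w p s t * ((m1 * x.size + m2 * D) * (D * ω.v p σ s t)) := by
          gcongr
      _ ≤ _ := by
          refine sub_nonneg.1 ?_
          unfold mulConst
          rw [← hDdef]
          ring_nf
          positivity

lemma mulPair_ivBd_total (hσ : Expo p σ) (A : CRP x (p / σ) (p / (1 + σ)) (V →L[ℝ] E))
    (h : CRP x p (p / 2) V) :
    IvBd x (p / σ) (p / (1 + σ)) (mulPair A h) t0 tT
      (supConst x (p / σ) (p / (1 + σ)) * ‖A‖ * (supConst x p (p / 2) * ‖h‖))
      (supConst x (p / σ) (p / (1 + σ)) * ‖A‖ *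
        (supConst x p (p / 2) * ‖h‖ + supConst x p (p / 2) * ‖h‖))
      (supConst x (p / σ) (p / (1 + σ)) * ‖A‖ * mulConst x σ *
        (supConst x p (p / 2) * ‖h‖ + supConst x p (p / 2) * ‖h‖ + supConst x p (p / 2) * ‖h‖)) :=
  mulPair_ivBd hσ (t0_le tT) (mul_nonneg (zero_le_one.trans (one_le_supConst x _ _))
    (norm_nonneg h)) ((A.ivBd_integrand hσ).mono le_rfl le_rfl
      (le_mul_of_one_le_left (norm_nonneg A) (one_le_supConst x _ _))) (h.ivBd_self hσ)

lemma mulPair_dag_add_left (A A' : CRP x (p / σ) (p / (1 + σ)) (V →L[ℝ] E))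
    (h : CRP x p (p / 2) V) (t : Time T) :
    (mulPair (A + A') h).2 t = (mulPair A h).2 t + (mulPair A' h).2 t := by
  ext u
  simp only [mulPair, CRP.dag_add, CRP.path_add, add_apply, ContinuousLinearMap.flip_apply,
    ContinuousLinearMap.comp_apply]
  abel

lemma mulPair_dag_smul_left (c : ℝ) (A : CRP x (p / σ) (p / (1 + σ)) (V →L[ℝ] E))
    (h : CRP x p (p / 2) V) (t : Time T) :
    (mulPair (c • A) h).2 t = c • (mulPair A h).2 t := by
  ext u
  simp only [mulPair, CRP.dag_smul, CRP.path_smul, add_apply, smul_apply,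
    ContinuousLinearMap.flip_apply, ContinuousLinearMap.comp_apply, smul_add]

lemma mulPair_dag_add_right (A : CRP x (p / σ) (p / (1 + σ)) (V →L[ℝ] E))
    (h h' : CRP x p (p / 2) V) (t : Time T) :
    (mulPair A (h + h')).2 t = (mulPair A h).2 t + (mulPair A h').2 t := by
  ext u
  simp only [mulPair, CRP.dag_add, CRP.path_add, add_apply, ContinuousLinearMap.flip_apply,
    ContinuousLinearMap.comp_apply, map_add]
  abel

lemma mulPair_dag_smul_right (c : ℝ) (A : CRP x (p / σ) (p / (1 + σ)) (V →L[ℝ] E))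
    (h : CRP x p (p / 2) V) (t : Time T) :
    (mulPair A (c • h)).2 t = c • (mulPair A h).2 t := by
  ext u
  simp only [mulPair, CRP.dag_smul, CRP.path_smul, add_apply, smul_apply,
    ContinuousLinearMap.flip_apply, ContinuousLinearMap.comp_apply, map_smul, smul_add]

/-- The product as a bounded bilinear map. -/
def mulL (x : RoughPath ω p U) (V E : Type*) [NormedAddCommGroup V] [NormedSpace ℝ V]
    [NormedAddCommGroup E] [NormedSpace ℝ E] (hσ : Expo p σ) :
    CRP x (p / σ) (p / (1 + σ)) (V →L[ℝ] E) →L[ℝ] CRP x p (p / 2) V →L[ℝ]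
      CRP x (p / σ) (p / (1 + σ)) E :=
  LinearMap.mkContinuous₂
    (LinearMap.mk₂ ℝ (fun A h => CRP.ofMem (mulPair A h) (mulPair_ivBd_total hσ A h).mem)
      (fun A A' h => CRP.ext (fun t => rfl) fun t => mulPair_dag_add_left A A' h t)
      (fun c A h => CRP.ext (fun t => rfl) fun t => mulPair_dag_smul_left c A h t)
      (fun A h h' => CRP.ext (fun t => map_add _ _ _) fun t => mulPair_dag_add_right A h h' t)
      (fun c A h => CRP.ext (fun t => map_smul _ _ _) fun t => mulPair_dag_smul_right c A h t))
    (supConst x (p / σ) (p / (1 + σ)) * supConst x p (p / 2) * (3 + 6 * mulConst x σ))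
    fun A h => by
      have h1 := zero_le_one.trans (one_le_supConst x p (p / 2))
      have h2 := zero_le_one.trans (one_le_supConst x (p / σ) (p / (1 + σ)))
      have h3 := (mulConst_pos (x := x) (σ := σ)).le
      refine (IvBd.norm_le (y := CRP.ofMem (mulPair A h) (mulPair_ivBd_total hσ A h).mem)
        (mulPair_ivBd_total hσ A h) (by positivity)).trans_eq ?_
      ring

variable {q r : ℝ}

lemma const_ivBd (x : RoughPath ω p U) (q r : ℝ) (a : V) :
    IvBd x q r (fun _ => a, fun _ => (0 : U →L[ℝ] V)) t0 tT ‖a‖ 0 0 :=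
  ⟨fun _ _ _ => le_rfl, fun _ _ _ => norm_zero.le, fun _ _ _ _ _ => by simp,
    fun _ _ _ _ _ => by simp [remainder]⟩

/-- The constant paths. -/
def constL (x : RoughPath ω p U) (q r : ℝ) (V : Type*) [NormedAddCommGroup V] [NormedSpace ℝ V] :
    V →L[ℝ] CRP x q r V :=
  let φ : V →ₗ[ℝ] CRP x q r V :=
    { toFun := fun a => CRP.ofMem (fun _ => a, fun _ => 0) (const_ivBd x q r a).mem
      map_add' := fun _ _ => CRP.ext (fun _ => rfl) fun _ => (add_zero _).symm
      map_smul' := fun c _ => CRP.ext (fun _ => rfl) fun _ => (smul_zero c).symm }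
  φ.mkContinuous 1 fun a =>
    (IvBd.norm_le (y := φ a) (const_ivBd x q r a) le_rfl).trans_eq (by ring)

/-- The image of a pair of paths under a linear map. -/
def compPair (b : V →L[ℝ] E) (z : (Time T → V) × (Time T → (U →L[ℝ] V))) :
    (Time T → E) × (Time T → (U →L[ℝ] E)) :=
  (fun t => b (z.1 t), fun t => b.comp (z.2 t))

lemma IvBd.comp (b : V →L[ℝ] E) {z : (Time T → V) × (Time T → (U →L[ℝ] V))} {c d : Time T}
    {m0 m1 m2 : ℝ} (h : IvBd x q r z c d m0 m1 m2) :
    IvBd x q r (compPair b z) c d (‖b‖ * m0) (‖b‖ * m1) (‖b‖ * m2) := by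
  refine ⟨fun t h1 h2 => ?_, fun t h1 h2 => ?_, fun s t h1 h2 h3 => ?_, fun s t h1 h2 h3 => ?_⟩
  · exact (b.le_opNorm _).trans (mul_le_mul_of_nonneg_left (h.path t h1 h2) (norm_nonneg b))
  · exact (ContinuousLinearMap.opNorm_comp_le _ _).trans
      (mul_le_mul_of_nonneg_left (h.dag t h1 h2) (norm_nonneg b))
  · change ‖b.comp (z.2 t) - b.comp (z.2 s)‖ ≤ _
    rw [← ContinuousLinearMap.comp_sub, mul_assoc]
    exact (ContinuousLinearMap.opNorm_comp_le _ _).trans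
      (mul_le_mul_of_nonneg_left (h.var s t h1 h2 h3) (norm_nonneg b))
  · have : remainder x (compPair b z) s t = b (remainder x z s t) := by
      simp [remainder, compPair]
    rw [this, mul_assoc]
    exact (b.le_opNorm _).trans (mul_le_mul_of_nonneg_left (h.rem s t h1 h2 h3) (norm_nonneg b))

/-- The image of a controlled rough path under a linear map, as a bounded bilinear map. -/
def compL (x : RoughPath ω p U) (V E : Type*) [NormedAddCommGroup V] [NormedSpace ℝ V]
    [NormedAddCommGroup E] [NormedSpace ℝ E] (hσ : Expo p σ) :
    (V →L[ℝ] E) →L[ℝ] CRP x p (p / 2) V →L[ℝ] CRP x p (p / 2) E :=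
  LinearMap.mkContinuous₂
    (LinearMap.mk₂ ℝ (fun b z => CRP.ofMem (compPair b z.1) ((z.ivBd_self hσ).comp b).mem)
      (fun b b' z => CRP.ext (fun t => rfl) fun t => ContinuousLinearMap.add_comp _ _ _)
      (fun c b z => CRP.ext (fun t => rfl) fun t => ContinuousLinearMap.smul_comp _ _ _)
      (fun b z z' => CRP.ext (fun t => map_add _ _ _) fun t => ContinuousLinearMap.comp_add _ _ _)
      (fun c b z => CRP.ext (fun t => map_smul _ _ _)
        fun t => ContinuousLinearMap.comp_smul _ _ _))
    (4 * supConst x p (p / 2)) fun b z => by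
      have h1 := zero_le_one.trans (one_le_supConst x p (p / 2))
      refine (IvBd.norm_le (y := CRP.ofMem (compPair b z.1) ((z.ivBd_self hσ).comp b).mem)
        ((z.ivBd_self hσ).comp b) (by positivity)).trans_eq ?_
      ring

end Products

/-! ### Hölder spaces of functions -/

section HolderFunctions

variable {V E : Type*} [NormedAddCommGroup V] [NormedSpace ℝ V]
  [NormedAddCommGroup E] [NormedSpace ℝ E] {n : ℕ} {γ : ℝ}

lemma HolderSpace.bound (f : HolderSpace V E n γ) : HolderBound n γ Set.univ f.1 ‖f‖ := by
  refine ⟨fun j hj v hv => le_leastConst f.exists_bound fun C _ hC => hC.1 j hj v hv,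
    fun v hv v' hv' => le_leastConst_mul f.exists_bound (Real.rpow_nonneg (norm_nonneg _) _)
      fun C _ hC => hC.2 v hv v' hv'⟩

lemma HolderSpace.contDiff (f : HolderSpace V E n γ) : ContDiff ℝ n f.1 := f.2.contDiff

lemma HolderBound.fderiv {f : V → E} {C : ℝ} (h : HolderBound (n + 1) γ Set.univ f C) :
    HolderBound n γ Set.univ (fderiv ℝ f) C := by
  refine ⟨fun j hj v hv => ?_, fun v hv v' hv' => ?_⟩
  · rw [norm_iteratedFDeriv_fderiv]
    exact h.1 (j + 1) (by omega) v hv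
  · rw [← norm_iteratedFDeriv_succ_sub]
    exact h.2 v hv v' hv'

variable (V E n γ) in
/-- The derivative as a bounded linear map between spaces of Hölder functions. -/
def derivL : HolderSpace V E (n + 1) γ →L[ℝ] HolderSpace V (V →L[ℝ] E) n γ :=
  LinearMap.mkContinuous
    { toFun := fun f => ⟨fderiv ℝ f.1, (f.contDiff.fderiv_right (by simp)).contDiffOn,
        ‖f‖, f.bound.fderiv⟩
      map_add' := fun f g => Subtype.ext (funext fun v => fderiv_add
        (f.contDiff.differentiable (by simp) v) (g.contDiff.differentiable (by simp) v))
      map_smul' := fun c f => Subtype.ext (funext fun v => fderiv_const_smul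
        (f.contDiff.differentiable (by simp) v) c) }
    1 fun f => by
      rw [one_mul]
      exact leastConst_le (norm_nonneg f) f.bound.fderiv

/-- `f` and its derivative are bounded by `F`, and the derivative is `γ`-Hölder with
constant `F`. -/
structure C1Holder (γ : ℝ) (f : V → E) (F : ℝ) : Prop where
  diff : Differentiable ℝ f
  bound : ∀ v, ‖f v‖ ≤ F
  bound_fderiv : ∀ v, ‖fderiv ℝ f v‖ ≤ F
  holder : ∀ v v', ‖fderiv ℝ f v - fderiv ℝ f v'‖ ≤ F * ‖v - v'‖ ^ γ

lemma C1Holder.nonneg {f : V → E} {F : ℝ} (h : C1Holder γ f F) : 0 ≤ F :=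
  (norm_nonneg _).trans (h.bound 0)

/-- The analytic estimates use only the first derivative and its Hölder constant. With a second
derivative available, Df is Lipschitz, which gives the Hölder bound at distances up to 1; beyond
that the trivial bound 2‖f‖ suffices and explains the factor 2. -/
lemma HolderSpace.c1Holder (h0 : 0 ≤ γ) (h1 : γ ≤ 1) (f : HolderSpace V E (n + 1) γ) :
    C1Holder γ f.1 (2 * ‖f‖) := by
  have hf := norm_nonneg f
  have hb0 : ∀ v, ‖f.1 v‖ ≤ ‖f‖ := fun v => by
    simpa using f.bound.1 0 (Nat.zero_le _) v (Set.mem_univ v)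
  have hb1 : ∀ v, ‖fderiv ℝ f.1 v‖ ≤ ‖f‖ := fun v => by
    have := f.bound.1 1 (by omega) v (Set.mem_univ v)
    rwa [norm_iteratedFDeriv_one] at this
  refine ⟨f.contDiff.differentiable (by simp), fun v => (hb0 v).trans (by linarith),
    fun v => (hb1 v).trans (by linarith), fun v v' => ?_⟩
  have hr := Real.rpow_nonneg (norm_nonneg (v - v')) γ
  rcases n with _ | n
  · have := f.bound.fderiv.2 v (Set.mem_univ v) v' (Set.mem_univ v')
    have e : ‖iteratedFDeriv ℝ 0 (fderiv ℝ f.1) v - iteratedFDeriv ℝ 0 (fderiv ℝ f.1) v'‖ =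
        ‖fderiv ℝ f.1 v - fderiv ℝ f.1 v'‖ := by
      simp only [iteratedFDeriv_zero_eq_comp, Function.comp_apply, ← map_sub,
        LinearIsometryEquiv.norm_map]
    rw [e] at this
    refine this.trans (mul_le_mul_of_nonneg_right (by linarith) hr)
  · have hd : Differentiable ℝ (fderiv ℝ f.1) :=
      (f.contDiff.fderiv_right (m := 1) (by norm_cast; omega)).differentiable one_ne_zero
    have hb2 : ∀ v, ‖fderiv ℝ (fderiv ℝ f.1) v‖ ≤ ‖f‖ := fun v => by
      have := f.bound.fderiv.1 1 (by omega) v (Set.mem_univ v)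
      rwa [norm_iteratedFDeriv_one] at this
    have hlip : ‖fderiv ℝ f.1 v - fderiv ℝ f.1 v'‖ ≤ ‖f‖ * ‖v - v'‖ :=
      convex_univ.norm_image_sub_le_of_norm_fderiv_le (fun v _ => hd v) (fun v _ => hb2 v)
        (Set.mem_univ v') (Set.mem_univ v)
    rcases le_total ‖v - v'‖ 1 with hle | hle
    · have h2 : ‖v - v'‖ ≤ ‖v - v'‖ ^ γ := by
        rcases (norm_nonneg (v - v')).eq_or_lt with h | h
        · exact h ▸ hr
        · simpa using Real.rpow_le_rpow_of_exponent_ge h hle h1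
      nlinarith
    · have h2 : 1 ≤ ‖v - v'‖ ^ γ := Real.one_le_rpow hle h0
      have h3 := norm_sub_le (fderiv ℝ f.1 v) (fderiv ℝ f.1 v')
      nlinarith [hb1 v, hb1 v']

lemma C1Holder.taylor {f : V → E} {F : ℝ} (h0 : 0 ≤ γ) (h : C1Holder γ f F) (a b : V) :
    ‖f b - f a - fderiv ℝ f a (b - a)‖ ≤ F * ‖b - a‖ ^ γ * ‖b - a‖ := by
  have hF := h.nonneg
  refine (convex_segment a b).norm_image_sub_le_of_norm_fderiv_le' (𝕜 := ℝ)
    (fun v _ => h.diff v) (fun v hv => ?_) (left_mem_segment ℝ a b) (right_mem_segment ℝ a b)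
  refine (h.holder v a).trans ?_
  have : ‖v - a‖ ≤ ‖b - a‖ := by
    obtain ⟨t, ht, rfl⟩ := (segment_eq_image' ℝ a b) ▸ hv
    simp only [add_sub_cancel_left, norm_smul, Real.norm_eq_abs, abs_of_nonneg ht.1]
    exact mul_le_of_le_one_left (norm_nonneg _) ht.2
  gcongr

end HolderFunctions

/-! ### Composition of controlled rough paths with Hölder functions -/

section Composition

/-- The exponents of the main theorem. -/
structure HolderExpo (p κ γ : ℝ) : Prop where
  two_le : 2 ≤ p
  κ_pos : 0 < κ
  κ_lt : κ < 1
  γ_pos : 0 < γ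
  γ_le : γ ≤ 1
  lt : p < 2 + κ * γ

lemma HolderExpo.expo {p κ γ : ℝ} (h : HolderExpo p κ γ) : Expo p (κ * γ) where
  two_le := h.two_le
  pos := mul_pos h.κ_pos h.γ_pos
  le_one := mul_le_one₀ h.κ_lt.le h.γ_pos.le h.γ_le
  lt := h.lt

lemma rpow_le_one_add {a e : ℝ} (ha : 0 ≤ a) (h0 : 0 ≤ e) (h1 : e ≤ 1) : a ^ e ≤ 1 + a := by
  rcases le_total a 1 with h | h
  · exact (Real.rpow_le_one ha h h0).trans (by linarith)
  · calc a ^ e ≤ a ^ (1 : ℝ) := Real.rpow_le_rpow_of_exponent_le h h1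
      _ ≤ 1 + a := by rw [Real.rpow_one]; linarith

lemma le_rpow_of_le_one {a e : ℝ} (ha : 0 ≤ a) (h : a ≤ 1) (h1 : e ≤ 1) :
    a ≤ a ^ e := by
  rcases ha.eq_or_lt with rfl | ha
  · exact Real.rpow_nonneg le_rfl _
  · simpa using Real.rpow_le_rpow_of_exponent_ge ha h h1

/-- Interpolation between two upper bounds; this is where κ divides the exponent γ. -/
lemma le_rpow_mul_rpow {z a b κ : ℝ} (hz : 0 ≤ z) (ha : z ≤ a) (hb : z ≤ b) (h0 : 0 ≤ κ)
    (h1 : κ ≤ 1) : z ≤ a ^ κ * b ^ (1 - κ) := by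
  have h : z = z ^ κ * z ^ (1 - κ) := by
    rw [← Real.rpow_add_of_nonneg hz h0 (by linarith)]
    simp
  rw [h]
  have := Real.rpow_le_rpow hz ha h0
  have := Real.rpow_le_rpow hz hb (sub_nonneg.2 h1)
  have := Real.rpow_nonneg (hz.trans ha) κ
  gcongr

/-! ### Interpolated second differences of a Hölder derivative -/

section Functions

variable {V E : Type*} [NormedAddCommGroup V] [NormedSpace ℝ V]
  [NormedAddCommGroup E] [NormedSpace ℝ E] {p κ γ F : ℝ} {f : V → E}

lemma C1Holder.norm_sub_le (hf : C1Holder γ f F) (a b : V) : ‖f a - f b‖ ≤ F * ‖a - b‖ :=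
  convex_univ.norm_image_sub_le_of_norm_fderiv_le (fun v _ => hf.diff v)
    (fun v _ => hf.bound_fderiv v) (Set.mem_univ b) (Set.mem_univ a)

lemma C1Holder.norm_fderiv_sub_le (hf : C1Holder γ f F) (h0 : 0 ≤ γ) {a b : V} {r : ℝ}
    (h : ‖a - b‖ ≤ r) : ‖fderiv ℝ f a - fderiv ℝ f b‖ ≤ F * r ^ γ := by
  have hF := hf.nonneg
  refine (hf.holder a b).trans ?_
  gcongr

/-- Grouped along time, the second difference is at most 2F r^γ; grouped across the two paths, it is
at most 2F ε^γ. Interpolation keeps r^(κγ) for the variation in time and ε^((1-κ)γ) for the Hölder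
dependence on the path. -/
lemma C1Holder.second_difference (hf : C1Holder γ f F) (he : HolderExpo p κ γ)
    {a b a' b' : V} {r ε : ℝ} (h1 : ‖a - b‖ ≤ r) (h2 : ‖a' - b'‖ ≤ r) (h3 : ‖a - a'‖ ≤ ε)
    (h4 : ‖b - b'‖ ≤ ε) :
    ‖(fderiv ℝ f a - fderiv ℝ f b) - (fderiv ℝ f a' - fderiv ℝ f b')‖ ≤
      2 * F * r ^ (κ * γ) * ε ^ ((1 - κ) * γ) := by
  have hF := hf.nonneg
  have hr := (norm_nonneg _).trans h1
  have hε := (norm_nonneg _).trans h3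
  have e1 : ‖(fderiv ℝ f a - fderiv ℝ f b) - (fderiv ℝ f a' - fderiv ℝ f b')‖ ≤
      2 * F * r ^ γ := by
    refine (_root_.norm_sub_le _ _).trans ?_
    have := hf.norm_fderiv_sub_le he.γ_pos.le h1
    have := hf.norm_fderiv_sub_le he.γ_pos.le h2
    linarith
  have e2 : ‖(fderiv ℝ f a - fderiv ℝ f b) - (fderiv ℝ f a' - fderiv ℝ f b')‖ ≤
      2 * F * ε ^ γ := by
    rw [sub_sub_sub_comm]
    refine (_root_.norm_sub_le _ _).trans ?_
    have := hf.norm_fderiv_sub_le he.γ_pos.le h3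
    have := hf.norm_fderiv_sub_le he.γ_pos.le h4
    linarith
  refine (le_rpow_mul_rpow (norm_nonneg _) e1 e2 he.κ_pos.le he.κ_lt.le).trans_eq ?_
  have h2F : 0 ≤ 2 * F := by positivity
  rw [Real.mul_rpow h2F (by positivity), Real.mul_rpow h2F (by positivity),
    ← Real.rpow_mul hr, ← Real.rpow_mul hε, mul_mul_mul_comm, ← Real.rpow_add_of_nonneg
    (by positivity) he.κ_pos.le (sub_nonneg.2 he.κ_lt.le), mul_comm γ, mul_comm γ]
  simp [mul_assoc]

end Functions

variable {T : ℝ} [Fact (0 < T)] {ω : Control T} {p κ γ : ℝ}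

lemma Control.w_rpow_mul {s t : Time T} (hst : s ≤ t) :
    ω.w p s t ^ (κ * γ) = ω.v p (κ * γ) s t := by
  rw [Control.w, Control.v, ← Real.rpow_mul (ω.nonneg s t hst)]
  congr 1
  ring

/-- If ω^(1/p) ≤ 1, lowering the exponent from γ to κγ increases the power. Otherwise the power γ is
at most ω^(1/p) itself, which is bounded by a multiple of ω^(κγ/p). -/
lemma Control.w_rpow_le (he : HolderExpo p κ γ) {s t : Time T} (hst : s ≤ t) :
    ω.w p s t ^ γ ≤ ω.D p (κ * γ) * ω.v p (κ * γ) s t := by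
  have hp := he.expo.p_pos
  have hw := ω.w_nonneg (p := p) hst
  have hv := ω.v_nonneg (p := p) (σ := κ * γ) hst
  rcases le_total (ω.w p s t) 1 with h | h
  · calc ω.w p s t ^ γ ≤ ω.w p s t ^ (κ * γ) := by
          rcases hw.eq_or_lt with h0 | h0
          · rw [← h0, Real.zero_rpow he.γ_pos.ne', Real.zero_rpow he.expo.pos.ne']
          · exact Real.rpow_le_rpow_of_exponent_ge h0 h
              (mul_le_of_le_one_left he.γ_pos.le he.κ_lt.le)
      _ = 1 * ω.v p (κ * γ) s t := by rw [Control.w_rpow_mul hst, one_mul]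
      _ ≤ _ := by gcongr; exact ω.one_le_D
  · calc ω.w p s t ^ γ ≤ ω.w p s t ^ (1 : ℝ) := Real.rpow_le_rpow_of_exponent_le h he.γ_le
      _ = ω.w p s t := Real.rpow_one _
      _ ≤ _ := ω.w_le_D_mul_v he.expo hst

lemma Control.mul_w_rpow_le (he : HolderExpo p κ γ) {s t : Time T} (hst : s ≤ t) {R : ℝ}
    (hR : 0 ≤ R) : (R * ω.w p s t) ^ γ ≤ (1 + R) * (ω.D p (κ * γ) * ω.v p (κ * γ) s t) := by
  rw [Real.mul_rpow hR (ω.w_nonneg hst)]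
  exact mul_le_mul (rpow_le_one_add hR he.γ_pos.le he.γ_le) (ω.w_rpow_le he hst)
    (Real.rpow_nonneg (ω.w_nonneg hst) _) (by positivity)

lemma Control.mul_w_rpow_mul_le (he : HolderExpo p κ γ) {s t : Time T} (hst : s ≤ t) {R : ℝ}
    (hR : 0 ≤ R) : (R * ω.w p s t) ^ (κ * γ) ≤ (1 + R) * ω.v p (κ * γ) s t := by
  rw [Real.mul_rpow hR (ω.w_nonneg hst), ω.w_rpow_mul hst]
  exact mul_le_mul_of_nonneg_right (rpow_le_one_add hR he.expo.pos.le he.expo.le_one)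
    (ω.v_nonneg hst)

variable {U V E : Type*} [NormedAddCommGroup U] [NormedSpace ℝ U]
  [NormedAddCommGroup V] [NormedSpace ℝ V] [NormedAddCommGroup E] [NormedSpace ℝ E]
variable {x : RoughPath ω p U}

/-- The path `f(y)` with the derivative `Df(y) y†`. -/
def omegaPair (f : V → E) (y : CRP x p (p / 2) V) : (Time T → E) × (Time T → (U →L[ℝ] E)) :=
  (fun t => f (y.path t), fun t => (fderiv ℝ f (y.path t)).comp (y.dag t))

/-- The constant in the bound of the variation of `f(y)`. -/
def omegaConst (x : RoughPath ω p U) (σ R : ℝ) : ℝ :=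
  (1 + R * (x.size + ω.D p σ)) * (R + R * (x.size + ω.D p σ)) * ω.D p σ + R * ω.D p σ

lemma omegaConst_nonneg {σ R : ℝ} (hR : 0 ≤ R) : 0 ≤ omegaConst x σ R := by
  have h := x.size_nonneg
  have h1 := zero_le_one.trans (ω.one_le_D (p := p) (σ := σ))
  unfold omegaConst
  positivity

/-- The remainder of f(y) is a Taylor remainder of order |y_{s,t}|^(1+γ) plus Df(y_s) y♯. No bound
on y itself enters, since f and Df are bounded globally, and all bounds are linear in F. -/
lemma omega_ivBd (he : HolderExpo p κ γ) {f : V → E} {F : ℝ} (hf : C1Holder γ f F)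
    {y : CRP x p (p / 2) V} {a b : Time T} {m0 R : ℝ} (hR : 0 ≤ R)
    (hy : IvBd x p (p / 2) y.1 a b m0 R R) :
    IvBd x (p / (κ * γ)) (p / (1 + κ * γ)) (omegaPair f y) a b F (F * R)
      (F * omegaConst x (κ * γ) R) := by
  have hσ := he.expo
  have hF := hf.nonneg
  have hX := x.size_nonneg
  have hD1 := ω.one_le_D (p := p) (σ := κ * γ)
  have hD := zero_le_one.trans hD1
  set D := ω.D p (κ * γ) with hDdef
  set R' := R * (x.size + D) with hR'
  have hR'0 : 0 ≤ R' := by positivity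
  have hinc : ∀ s t, a ≤ s → s ≤ t → t ≤ b → ‖y.path t - y.path s‖ ≤ R' * ω.w p s t :=
    fun s t h1 h2 h3 => (hy.norm_path_sub_le hσ hR h1 h2 h3).trans_eq (by rw [hR', mul_add])
  have hpow := fun (s t : Time T) (hst : s ≤ t) => ω.mul_w_rpow_le (p := p) he hst hR'0
  refine ⟨fun t _ _ => hf.bound _, fun t h1 h2 => ?_, fun s t h1 h2 h3 => ?_,
    fun s t h1 h2 h3 => ?_⟩
  · exact (ContinuousLinearMap.opNorm_comp_le _ _).trans
      (mul_le_mul (hf.bound_fderiv _) (hy.dag t h1 h2) (norm_nonneg _) hF)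
  · have hw := ω.w_nonneg (p := p) h2
    have hv := ω.v_nonneg (p := p) (σ := κ * γ) h2
    have hwD : ω.w p s t ≤ D * ω.v p (κ * γ) s t := ω.w_le_D_mul_v hσ h2
    have e1 : (omegaPair f y).2 t - (omegaPair f y).2 s =
        (fderiv ℝ f (y.path t) - fderiv ℝ f (y.path s)).comp (y.dag t) +
          (fderiv ℝ f (y.path s)).comp (y.dag t - y.dag s) := by
      ext u; simp [omegaPair]
    rw [e1, ω.rpow_q]
    calc _ ≤ F * ((1 + R') * (D * ω.v p (κ * γ) s t)) * R + F * (R * ω.w p s t) := by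
          refine (norm_add_le _ _).trans (add_le_add ?_ ?_)
          · exact (ContinuousLinearMap.opNorm_comp_le _ _).trans (mul_le_mul
              ((hf.norm_fderiv_sub_le he.γ_pos.le (hinc s t h1 h2 h3)).trans
                (mul_le_mul_of_nonneg_left (hpow s t h2) hF))
              (hy.dag t (h1.trans h2) h3) (norm_nonneg _) (by positivity))
          · exact (ContinuousLinearMap.opNorm_comp_le _ _).trans (mul_le_mul
              (hf.bound_fderiv _) (hy.var s t h1 h2 h3) (norm_nonneg _) hF)
      _ ≤ F * ((1 + R') * (D * ω.v p (κ * γ) s t)) * R + F * (R * (D * ω.v p (κ * γ) s t)) := by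
          gcongr
      _ ≤ _ := by
          refine sub_nonneg.1 ?_
          unfold omegaConst
          rw [← hDdef, ← hR']
          ring_nf
          positivity
  · have hw := ω.w_nonneg (p := p) h2
    have hv := ω.v_nonneg (p := p) (σ := κ * γ) h2
    have hwD : ω.w p s t ≤ D * ω.v p (κ * γ) s t := ω.w_le_D_mul_v hσ h2
    have hrem := hy.rem s t h1 h2 h3
    rw [ω.rpow_half hσ h2] at hrem
    have e1 : remainder x (omegaPair f y) s t =
        (f (y.path t) - f (y.path s) - fderiv ℝ f (y.path s) (y.path t - y.path s)) +
          fderiv ℝ f (y.path s) (y.sharp s t) := by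
      simp [remainder, omegaPair, CRP.sharp]
    rw [e1, ω.rpow_r hσ h2]
    calc _ ≤ F * ((1 + R') * (D * ω.v p (κ * γ) s t)) * (R' * ω.w p s t) +
          F * (R * (ω.w p s t * ω.w p s t)) := by
          refine (norm_add_le _ _).trans (add_le_add ?_ ?_)
          · refine (hf.taylor he.γ_pos.le _ _).trans (mul_le_mul (mul_le_mul_of_nonneg_left
              (le_trans ?_ (hpow s t h2)) hF) (hinc s t h1 h2 h3) (norm_nonneg _) (by positivity))
            exact Real.rpow_le_rpow (norm_nonneg _) (hinc s t h1 h2 h3) he.γ_pos.le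
          · exact ((fderiv ℝ f _).le_opNorm _).trans (mul_le_mul
              (hf.bound_fderiv _) hrem (norm_nonneg _) hF)
      _ ≤ F * ((1 + R') * (D * ω.v p (κ * γ) s t)) * (R' * ω.w p s t) +
          F * (R * (ω.w p s t * (D * ω.v p (κ * γ) s t))) := by gcongr
      _ ≤ _ := by
          refine sub_nonneg.1 ?_
          unfold omegaConst
          rw [← hDdef, ← hR']
          ring_nf
          positivity

/-- The constant in the Hölder bound of `y ↦ f(y)`. -/
def omegaHolderConst (x : RoughPath ω p U) (σ R : ℝ) : ℝ :=
  2 * (1 + R * (x.size + ω.D p σ)) * (R + R * (x.size + ω.D p σ)) +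
    (1 + R * (x.size + ω.D p σ)) * ω.D p σ * (1 + x.size + ω.D p σ) + (R + 1) * ω.D p σ

lemma omegaHolderConst_nonneg {σ R : ℝ} (hR : 0 ≤ R) : 0 ≤ omegaHolderConst x σ R := by
  have h := x.size_nonneg
  have h1 := zero_le_one.trans (ω.one_le_D (p := p) (σ := σ))
  unfold omegaHolderConst
  positivity

/-- Mean value inequality along the two segments run in parallel. The derivative of the difference
splits into a second difference of Df applied to one increment and an increment of Df applied to the
difference of the increments. -/
lemma C1Holder.norm_taylor_sub_le (he : HolderExpo p κ γ) {f : V → E} {F : ℝ}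
    (hf : C1Holder γ f F) {a b a' b' : V} {r ε η : ℝ} (h1 : ‖b - a‖ ≤ r) (h2 : ‖b' - a'‖ ≤ r)
    (h3 : ‖a - a'‖ ≤ ε) (h4 : ‖b - b'‖ ≤ ε) (h5 : ‖(b - a) - (b' - a')‖ ≤ η) :
    ‖(f b - f a - fderiv ℝ f a (b - a)) - (f b' - f a' - fderiv ℝ f a' (b' - a'))‖ ≤
      2 * F * r ^ (κ * γ) * ε ^ ((1 - κ) * γ) * r + F * r ^ γ * η := by
  have hF := hf.nonneg
  have hr := (norm_nonneg _).trans h1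
  have hε := (norm_nonneg _).trans h3
  have hη := (norm_nonneg _).trans h5
  -- The difference of the Taylor remainders is g 1 - g 0.
  let g : ℝ → E := fun τ => (f (a + τ • (b - a)) - τ • fderiv ℝ f a (b - a)) -
    (f (a' + τ • (b' - a')) - τ • fderiv ℝ f a' (b' - a'))
  let g' : ℝ → E := fun τ =>
    (fderiv ℝ f (a + τ • (b - a)) (b - a) - fderiv ℝ f a (b - a)) -
    (fderiv ℝ f (a' + τ • (b' - a')) (b' - a') - fderiv ℝ f a' (b' - a'))
  have aux : ∀ (c d : V) (τ : ℝ),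
      HasDerivAt (fun τ : ℝ => f (c + τ • d) - τ • fderiv ℝ f c d)
        (fderiv ℝ f (c + τ • d) d - fderiv ℝ f c d) τ := fun c d τ => by
    have e1 : HasDerivAt (fun τ : ℝ => c + τ • d) d τ := by
      simpa using ((hasDerivAt_id τ).smul_const d).const_add c
    have e2 := (hf.diff (c + τ • d)).hasFDerivAt.comp_hasDerivAt τ e1
    have e3 : HasDerivAt (fun τ : ℝ => τ • fderiv ℝ f c d) (fderiv ℝ f c d) τ := by
      simpa using (hasDerivAt_id τ).smul_const (fderiv ℝ f c d)
    exact e2.sub e3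
  have hg : ∀ τ ∈ Set.Icc (0 : ℝ) 1, HasDerivWithinAt g (g' τ) (Set.Icc 0 1) τ := fun τ _ =>
    ((aux a (b - a) τ).sub (aux a' (b' - a') τ)).hasDerivWithinAt
  have hb : ∀ τ ∈ Set.Ico (0 : ℝ) 1, ‖g' τ‖ ≤
      2 * F * r ^ (κ * γ) * ε ^ ((1 - κ) * γ) * r + F * r ^ γ * η := fun τ hτ => by
    have hτ1 : |τ| ≤ 1 := by rw [abs_of_nonneg hτ.1]; exact hτ.2.le
    have n1 : ∀ d : V, ‖d‖ ≤ r → ∀ c : V, ‖c + τ • d - c‖ ≤ r := fun d hd c => by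
      rw [add_sub_cancel_left, norm_smul, Real.norm_eq_abs]
      exact (mul_le_of_le_one_left (norm_nonneg _) hτ1).trans hd
    have n2 : ‖(a + τ • (b - a)) - (a' + τ • (b' - a'))‖ ≤ ε := by
      have : (a + τ • (b - a)) - (a' + τ • (b' - a')) = (1 - τ) • (a - a') + τ • (b - b') := by
        module
      rw [this]
      refine (norm_add_le _ _).trans ?_
      rw [norm_smul, norm_smul, Real.norm_eq_abs, Real.norm_eq_abs, abs_of_nonneg hτ.1,
        abs_of_nonneg (sub_nonneg.2 hτ.2.le)]
      have := mul_le_mul_of_nonneg_left h3 (sub_nonneg.2 hτ.2.le)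
      have := mul_le_mul_of_nonneg_left h4 hτ.1
      linarith
    have e : g' τ = ((fderiv ℝ f (a + τ • (b - a)) - fderiv ℝ f a) -
        (fderiv ℝ f (a' + τ • (b' - a')) - fderiv ℝ f a')) (b - a) +
        (fderiv ℝ f (a' + τ • (b' - a')) - fderiv ℝ f a') ((b - a) - (b' - a')) := by
      simp only [g', sub_apply, map_sub]
      abel
    rw [e]
    refine (norm_add_le _ _).trans (add_le_add ?_ ?_)
    · exact (ContinuousLinearMap.le_opNorm _ _).trans (mul_le_mul
        (hf.second_difference he (n1 _ h1 a) (n1 _ h2 a') n2 h3) h1 (norm_nonneg _)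
        (by positivity))
    · exact (ContinuousLinearMap.le_opNorm _ _).trans (mul_le_mul
        (hf.norm_fderiv_sub_le he.γ_pos.le (n1 _ h2 a')) h5 (norm_nonneg _) (by positivity))
  have := norm_image_sub_le_of_norm_deriv_le_segment_01' hg hb
  refine le_trans (le_of_eq ?_) this
  congr 1
  simp only [g, one_smul, zero_smul, add_zero, add_sub_cancel, sub_zero]
  abel

/-- Every term is a second difference of Df, a difference of Taylor remainders, or a product with
one factor measuring y - y'. The first two kinds are interpolated and lose regularity in ε, down to
the exponent (1-κ)γ. The third kind has at least the power γ of ε. -/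
lemma omega_sub_ivBd (he : HolderExpo p κ γ) {f : V → E} {F : ℝ} (hf : C1Holder γ f F)
    {y y' : CRP x p (p / 2) V} {a b : Time T} {m0 m0' R ε : ℝ} (hR : 0 ≤ R) (hε : 0 ≤ ε)
    (hε1 : ε ≤ 1) (hy : IvBd x p (p / 2) y.1 a b m0 R R)
    (hy' : IvBd x p (p / 2) y'.1 a b m0' R R)
    (hh : IvBd x p (p / 2) (y - y').1 a b ε ε ε) :
    IvBd x (p / (κ * γ)) (p / (1 + κ * γ)) (omegaPair f y - omegaPair f y') a b
      (F * ε ^ ((1 - κ) * γ)) (F * (R + 1) * ε ^ ((1 - κ) * γ))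
      (F * omegaHolderConst x (κ * γ) R * ε ^ ((1 - κ) * γ)) := by
  have hσ := he.expo
  have hF := hf.nonneg
  have hX := x.size_nonneg
  have hD1 := ω.one_le_D (p := p) (σ := κ * γ)
  have hD := zero_le_one.trans hD1
  have hβ0 : 0 ≤ (1 - κ) * γ := mul_nonneg (sub_nonneg.2 he.κ_lt.le) he.γ_pos.le
  have hβγ : (1 - κ) * γ ≤ γ := mul_le_of_le_one_left he.γ_pos.le (by linarith [he.κ_pos])
  set β := (1 - κ) * γ with hβ
  -- Since ε ≤ 1, the powers ε and ε^γ are dominated by ε^((1-κ)γ), so one power serves for all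
  -- terms.
  have hεβ : ε ≤ ε ^ β := le_rpow_of_le_one hε hε1 (hβγ.trans he.γ_le)
  have hεγ : ε ^ γ ≤ ε ^ β := by
    rcases hε.eq_or_lt with h | h
    · rw [← h, Real.zero_rpow he.γ_pos.ne', Real.zero_rpow
        (mul_pos (sub_pos.2 he.κ_lt) he.γ_pos).ne']
    · exact Real.rpow_le_rpow_of_exponent_ge h hε1 hβγ
  have hε0 := Real.rpow_nonneg hε β
  set η := ε ^ β
  set D := ω.D p (κ * γ) with hDdef
  set R' := R * (x.size + D) with hR'
  have hR'0 : 0 ≤ R' := by positivity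
  have hinc : ∀ s t, a ≤ s → s ≤ t → t ≤ b → ‖y.path t - y.path s‖ ≤ R' * ω.w p s t :=
    fun s t h1 h2 h3 => (hy.norm_path_sub_le hσ hR h1 h2 h3).trans_eq (by rw [hR', mul_add])
  have hinc' : ∀ s t, a ≤ s → s ≤ t → t ≤ b → ‖y'.path t - y'.path s‖ ≤ R' * ω.w p s t :=
    fun s t h1 h2 h3 => (hy'.norm_path_sub_le hσ hR h1 h2 h3).trans_eq (by rw [hR', mul_add])
  have hpow := fun (s t : Time T) (hst : s ≤ t) => ω.mul_w_rpow_le (p := p) he hst hR'0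
  have hpow' := fun (s t : Time T) (hst : s ≤ t) => ω.mul_w_rpow_mul_le (p := p) he hst hR'0
  have hd : ∀ t, a ≤ t → t ≤ b → ‖y.path t - y'.path t‖ ≤ ε := fun t h1 h2 => hh.path t h1 h2
  have hΔ : ∀ t, a ≤ t → t ≤ b →
      ‖fderiv ℝ f (y.path t) - fderiv ℝ f (y'.path t)‖ ≤ F * η := fun t h1 h2 =>
    (hf.norm_fderiv_sub_le he.γ_pos.le (hd t h1 h2)).trans (mul_le_mul_of_nonneg_left hεγ hF)
  have hdd : ∀ t, a ≤ t → t ≤ b → ‖y.dag t - y'.dag t‖ ≤ η := fun t h1 h2 =>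
    (hh.dag t h1 h2).trans hεβ
  refine ⟨fun t h1 h2 => ?_, fun t h1 h2 => ?_, fun s t h1 h2 h3 => ?_, fun s t h1 h2 h3 => ?_⟩
  · exact (hf.norm_sub_le _ _).trans
      (mul_le_mul_of_nonneg_left ((hd t h1 h2).trans hεβ) hF)
  · have e1 : (omegaPair f y - omegaPair f y').2 t =
        (fderiv ℝ f (y.path t) - fderiv ℝ f (y'.path t)).comp (y.dag t) +
          (fderiv ℝ f (y'.path t)).comp (y.dag t - y'.dag t) := by
      ext u; simp [omegaPair]
    rw [e1]
    calc _ ≤ F * η * R + F * η := (norm_add_le _ _).trans (add_le_add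
          ((ContinuousLinearMap.opNorm_comp_le _ _).trans
            (mul_le_mul (hΔ t h1 h2) (hy.dag t h1 h2) (norm_nonneg _) (by positivity)))
          ((ContinuousLinearMap.opNorm_comp_le _ _).trans
            (mul_le_mul (hf.bound_fderiv _) (hdd t h1 h2) (norm_nonneg _) hF)))
      _ = _ := by ring
  · have h12 := h1.trans h2
    have h23 := h2.trans h3
    have hw := ω.w_nonneg (p := p) h2
    have hv := ω.v_nonneg (p := p) (σ := κ * γ) h2
    have hwD : ω.w p s t ≤ D * ω.v p (κ * γ) s t := ω.w_le_D_mul_v hσ h2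
    have e1 : (omegaPair f y - omegaPair f y').2 t - (omegaPair f y - omegaPair f y').2 s =
        (((fderiv ℝ f (y.path t) - fderiv ℝ f (y.path s)) -
          (fderiv ℝ f (y'.path t) - fderiv ℝ f (y'.path s))).comp (y.dag t) +
        (fderiv ℝ f (y.path s) - fderiv ℝ f (y'.path s)).comp (y.dag t - y.dag s)) +
        ((fderiv ℝ f (y'.path t) - fderiv ℝ f (y'.path s)).comp (y.dag t - y'.dag t) +
        (fderiv ℝ f (y'.path s)).comp ((y.dag t - y'.dag t) - (y.dag s - y'.dag s))) := by
      ext u; simp [omegaPair]; abel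
    have hvar : ‖(y.dag t - y'.dag t) - (y.dag s - y'.dag s)‖ ≤ η * ω.w p s t :=
      (hh.var s t h1 h2 h3).trans (mul_le_mul_of_nonneg_right hεβ hw)
    have hsec := hf.second_difference he (hinc s t h1 h2 h3) (hinc' s t h1 h2 h3)
      (hd t h12 h3) (hd s h1 h23)
    rw [← hβ] at hsec
    rw [e1, ω.rpow_q]
    calc _ ≤ (2 * F * ((1 + R') * ω.v p (κ * γ) s t) * η * R + F * η * (R * ω.w p s t)) +
          (F * ((1 + R') * (D * ω.v p (κ * γ) s t)) * η + F * (η * ω.w p s t)) := by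
          refine (norm_add_le _ _).trans (add_le_add ((norm_add_le _ _).trans (add_le_add ?_ ?_))
            ((norm_add_le _ _).trans (add_le_add ?_ ?_)))
          · refine (ContinuousLinearMap.opNorm_comp_le _ _).trans (mul_le_mul
              (hsec.trans ?_) (hy.dag t h12 h3) (norm_nonneg _) (by positivity))
            have := hpow' s t h2
            gcongr
          · exact (ContinuousLinearMap.opNorm_comp_le _ _).trans (mul_le_mul
              (hΔ s h1 h23) (hy.var s t h1 h2 h3) (norm_nonneg _) (by positivity))
          · exact (ContinuousLinearMap.opNorm_comp_le _ _).trans (mul_le_mul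
              ((hf.norm_fderiv_sub_le he.γ_pos.le (hinc' s t h1 h2 h3)).trans
                (mul_le_mul_of_nonneg_left (hpow s t h2) hF))
              (hdd t h12 h3) (norm_nonneg _) (by positivity))
          · exact (ContinuousLinearMap.opNorm_comp_le _ _).trans (mul_le_mul
              (hf.bound_fderiv _) hvar (norm_nonneg _) hF)
      _ ≤ (2 * F * ((1 + R') * ω.v p (κ * γ) s t) * η * R +
            F * η * (R * (D * ω.v p (κ * γ) s t))) +
          (F * ((1 + R') * (D * ω.v p (κ * γ) s t)) * η +
            F * (η * (D * ω.v p (κ * γ) s t))) := by gcongr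
      _ ≤ _ := by
          refine sub_nonneg.1 ?_
          unfold omegaHolderConst
          rw [← hDdef, ← hR']
          ring_nf
          positivity
  · have h12 := h1.trans h2
    have h23 := h2.trans h3
    have hw := ω.w_nonneg (p := p) h2
    have hv := ω.v_nonneg (p := p) (σ := κ * γ) h2
    have hwD : ω.w p s t ≤ D * ω.v p (κ * γ) s t := ω.w_le_D_mul_v hσ h2
    have hrem := hy.rem s t h1 h2 h3
    rw [ω.rpow_half hσ h2] at hrem
    have hrem' := hh.rem s t h1 h2 h3
    rw [ω.rpow_half hσ h2] at hrem'
    have hinch : ‖(y.path t - y.path s) - (y'.path t - y'.path s)‖ ≤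
        η * (x.size + D) * ω.w p s t := by
      have := hh.norm_path_sub_le hσ hε h1 h2 h3
      rw [← mul_add] at this
      rw [sub_sub_sub_comm]
      refine this.trans ?_
      gcongr
    have e1 : remainder x (omegaPair f y - omegaPair f y') s t =
        ((f (y.path t) - f (y.path s) - fderiv ℝ f (y.path s) (y.path t - y.path s)) -
        (f (y'.path t) - f (y'.path s) - fderiv ℝ f (y'.path s) (y'.path t - y'.path s))) +
        ((fderiv ℝ f (y.path s) - fderiv ℝ f (y'.path s)) (y.sharp s t) +
          fderiv ℝ f (y'.path s) ((y - y').sharp s t)) := by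
      rw [CRP.sharp_sub]
      simp only [remainder, omegaPair, CRP.sharp, Prod.fst_sub, Prod.snd_sub,
        Pi.sub_apply, sub_apply, ContinuousLinearMap.comp_apply, map_sub]
      abel
    have htay := hf.norm_taylor_sub_le he (hinc s t h1 h2 h3) (hinc' s t h1 h2 h3)
      (hd s h1 h23) (hd t h12 h3) hinch
    rw [← hβ] at htay
    rw [e1, ω.rpow_r hσ h2]
    calc _ ≤ (2 * F * ((1 + R') * ω.v p (κ * γ) s t) * η * (R' * ω.w p s t) +
            F * ((1 + R') * (D * ω.v p (κ * γ) s t)) * (η * (x.size + D) * ω.w p s t)) +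
          (F * η * (R * (ω.w p s t * ω.w p s t)) + F * (η * (ω.w p s t * ω.w p s t))) := by
          refine (norm_add_le _ _).trans (add_le_add (htay.trans (add_le_add ?_ ?_))
            ((norm_add_le _ _).trans (add_le_add ?_ ?_)))
          · have := hpow' s t h2
            gcongr
          · have := hpow s t h2
            gcongr
          · exact (ContinuousLinearMap.le_opNorm _ _).trans (mul_le_mul
              (hΔ s h1 h23) hrem (norm_nonneg _) (by positivity))
          · exact (ContinuousLinearMap.le_opNorm _ _).trans (mul_le_mul (hf.bound_fderiv _)
              (hrem'.trans (mul_le_mul_of_nonneg_right hεβ (by positivity))) (norm_nonneg _) hF)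
      _ ≤ (2 * F * ((1 + R') * ω.v p (κ * γ) s t) * η * (R' * ω.w p s t) +
            F * ((1 + R') * (D * ω.v p (κ * γ) s t)) * (η * (x.size + D) * ω.w p s t)) +
          (F * η * (R * (ω.w p s t * (D * ω.v p (κ * γ) s t))) +
            F * (η * (ω.w p s t * (D * ω.v p (κ * γ) s t)))) := by gcongr
      _ ≤ _ := by
          refine sub_nonneg.1 ?_
          unfold omegaHolderConst
          rw [← hDdef, ← hR']
          ring_nf
          positivity

end Composition

/-! ### The composition operator and its derivatives -/

section MeanValue

variable {T : ℝ} [Fact (0 < T)] {ω : Control T} {p q r : ℝ}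
variable {U E : Type*} [NormedAddCommGroup U] [NormedSpace ℝ U]
  [NormedAddCommGroup E] [NormedSpace ℝ E] {x : RoughPath ω p U}

/-- The mean value inequality for curves of controlled rough paths that are differentiable at
every time. -/
lemma CRP.norm_sub_le_of_deriv {g g' : ℝ → CRP x q r E} {C : ℝ}
    (h1 : ∀ t, ∀ τ ∈ Set.Icc (0 : ℝ) 1, HasDerivAt (fun τ => (g τ).path t) ((g' τ).path t) τ)
    (h2 : ∀ t, ∀ τ ∈ Set.Icc (0 : ℝ) 1, HasDerivAt (fun τ => (g τ).dag t) ((g' τ).dag t) τ)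
    (hC : ∀ τ ∈ Set.Icc (0 : ℝ) 1, ‖g' τ‖ ≤ C) : ‖g 1 - g 0‖ ≤ 4 * C := by
  have hC0 : 0 ≤ C := (norm_nonneg _).trans (hC 0 ⟨le_rfl, zero_le_one⟩)
  have hI : ∀ τ ∈ Set.Ico (0 : ℝ) 1, τ ∈ Set.Icc (0 : ℝ) 1 := fun τ h => ⟨h.1, h.2.le⟩
  refine (CRP.norm_le (K0 := C) (K1 := C) (K2 := C) (K3 := C) ?_ ?_ hC0 (fun s t hst => ?_) hC0
    fun s t hst => ?_).trans_eq (by ring)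
  · exact norm_image_sub_le_of_norm_deriv_le_segment_01'
      (fun τ hτ => (h1 t0 τ hτ).hasDerivWithinAt)
      fun τ hτ => ((g' τ).norm_path_zero_le).trans (hC τ (hI τ hτ))
  · exact norm_image_sub_le_of_norm_deriv_le_segment_01'
      (fun τ hτ => (h2 t0 τ hτ).hasDerivWithinAt)
      fun τ hτ => ((g' τ).norm_dag_zero_le).trans (hC τ (hI τ hτ))
  · have := norm_image_sub_le_of_norm_deriv_le_segment_01'
      (fun τ hτ => ((h2 t τ hτ).sub (h2 s τ hτ)).hasDerivWithinAt)
      fun τ hτ => ((g' τ).norm_dag_sub_le hst).trans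
        (mul_le_mul_of_nonneg_right (hC τ (hI τ hτ)) (ω.rpow_nonneg _ hst))
    refine le_trans (le_of_eq ?_) this
    rw [CRP.dag_sub, CRP.dag_sub]
    congr 1
    simp only [Pi.sub_apply]
    abel
  · have := norm_image_sub_le_of_norm_deriv_le_segment_01'
      (fun τ hτ => (((h1 t τ hτ).sub (h1 s τ hτ)).sub
        ((h2 s τ hτ).clm_apply (hasDerivAt_const τ (x.inc1 s t)))).hasDerivWithinAt)
      (C := C * ω s t ^ (1 / r)) fun τ hτ => by
        rw [map_zero, add_zero]
        exact ((g' τ).norm_sharp_le hst).trans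
          (mul_le_mul_of_nonneg_right (hC τ (hI τ hτ)) (ω.rpow_nonneg _ hst))
    rw [CRP.sharp_sub]
    exact this

end MeanValue

/-! ### Fréchet derivative of the composition operator -/

section Omega

variable {T : ℝ} [Fact (0 < T)] {ω : Control T} {p κ γ : ℝ}
variable {U V E : Type*} [NormedAddCommGroup U] [NormedSpace ℝ U]
  [NormedAddCommGroup V] [NormedSpace ℝ V] [NormedAddCommGroup E] [NormedSpace ℝ E]
variable {x : RoughPath ω p U} {n : ℕ}

lemma HolderSpace.differentiable (f : HolderSpace V E (n + 1) γ) : Differentiable ℝ f.1 :=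
  f.contDiff.differentiable (by simp)

lemma omegaPair_ivBd_total (he : HolderExpo p κ γ) (y : CRP x p (p / 2) V)
    (f : HolderSpace V E (n + 1) γ) :
    IvBd x (p / (κ * γ)) (p / (1 + κ * γ)) (omegaPair f.1 y) t0 tT (2 * ‖f‖)
      (2 * ‖f‖ * (supConst x p (p / 2) * ‖y‖))
      (2 * ‖f‖ * omegaConst x (κ * γ) (supConst x p (p / 2) * ‖y‖)) :=
  omega_ivBd he (f.c1Holder he.γ_pos.le he.γ_le)
    (mul_nonneg (zero_le_one.trans (one_le_supConst x _ _)) (norm_nonneg y))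
    (y.ivBd_self he.expo)

/-- The composition `f ↦ f(y)` as a bounded linear operator. -/
def omegaL (n : ℕ) (he : HolderExpo p κ γ) (E : Type*) [NormedAddCommGroup E] [NormedSpace ℝ E]
    (y : CRP x p (p / 2) V) :
    HolderSpace V E (n + 1) γ →L[ℝ] CRP x (p / (κ * γ)) (p / (1 + κ * γ)) E :=
  let φ : HolderSpace V E (n + 1) γ →ₗ[ℝ] CRP x (p / (κ * γ)) (p / (1 + κ * γ)) E :=
    { toFun := fun f => CRP.ofMem (omegaPair f.1 y) (omegaPair_ivBd_total he y f).mem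
      map_add' := fun f g => CRP.ext (fun _ => rfl) fun t => by
        change (fderiv ℝ (f.1 + g.1) (y.path t)).comp (y.dag t) = _
        rw [fderiv_add (f.differentiable _) (g.differentiable _), ContinuousLinearMap.add_comp]
        rfl
      map_smul' := fun c f => CRP.ext (fun _ => rfl) fun t => by
        change (fderiv ℝ (c • f.1) (y.path t)).comp (y.dag t) = _
        rw [fderiv_const_smul (f.differentiable _), ContinuousLinearMap.smul_comp]
        rfl }
  φ.mkContinuous (2 * (1 + supConst x p (p / 2) * ‖y‖ +
      2 * omegaConst x (κ * γ) (supConst x p (p / 2) * ‖y‖))) fun f => by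
    have h0 := mul_nonneg (zero_le_one.trans (one_le_supConst x p (p / 2))) (norm_nonneg y)
    have h1 := omegaConst_nonneg (x := x) (σ := κ * γ) h0
    refine (IvBd.norm_le (y := φ f) (omegaPair_ivBd_total he y f) (by positivity)).trans_eq ?_
    ring

/-- The modulus of continuity of the composition operator on bounded sets. -/
lemma norm_omegaL_sub_le (he : HolderExpo p κ γ) {y y' : CRP x p (p / 2) V} {M : ℝ}
    (hy : ‖y‖ ≤ M) (hy' : ‖y'‖ ≤ M) (hh : supConst x p (p / 2) * ‖y - y'‖ ≤ 1) :
    ‖omegaL n he E y - omegaL n he E y'‖ ≤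
      2 * (2 + supConst x p (p / 2) * M +
        2 * omegaHolderConst x (κ * γ) (supConst x p (p / 2) * M)) *
        (supConst x p (p / 2) * ‖y - y'‖) ^ ((1 - κ) * γ) := by
  have hS := zero_le_one.trans (one_le_supConst x p (p / 2))
  have hM := (norm_nonneg _).trans hy
  have hε := mul_nonneg hS (norm_nonneg (y - y'))
  have h1 := omegaHolderConst_nonneg (x := x) (σ := κ * γ) (mul_nonneg hS hM)
  have hr := Real.rpow_nonneg hε ((1 - κ) * γ)
  refine ContinuousLinearMap.opNorm_le_bound _ (by positivity) fun f => ?_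
  have hb := mul_le_mul_of_nonneg_left hy hS
  have hb' := mul_le_mul_of_nonneg_left hy' hS
  have key := omega_sub_ivBd he (f.c1Holder he.γ_pos.le he.γ_le) (mul_nonneg hS hM) hε hh
    ((y.ivBd_self he.expo).mono hb hb hb) ((y'.ivBd_self he.expo).mono hb' hb' hb')
    ((y - y').ivBd_self he.expo)
  refine (IvBd.norm_le (y := (omegaL n he E y - omegaL n he E y') f) key
    (by positivity)).trans_eq ?_
  ring

lemma omegaL_isBigO (he : HolderExpo p κ γ) (y : CRP x p (p / 2) V) :
    (fun a : CRP x p (p / 2) V × CRP x p (p / 2) V =>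
      omegaL n he E a.1 - omegaL n he E a.2) =O[𝓝 (y, y)]
      fun a => ‖a.1 - a.2‖ ^ ((1 - κ) * γ) := by
  have hS1 := one_le_supConst x p (p / 2)
  have hS := zero_le_one.trans hS1
  set S := supConst x p (p / 2)
  refine Asymptotics.IsBigO.of_bound (2 * (2 + S * (‖y‖ + 1) +
        2 * omegaHolderConst x (κ * γ) (S * (‖y‖ + 1))) * S ^ ((1 - κ) * γ)) ?_
  have e1 : ∀ᶠ a : CRP x p (p / 2) V × CRP x p (p / 2) V in 𝓝 (y, y), ‖a.1‖ < ‖y‖ + 1 :=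
    (continuous_fst.norm.tendsto (y, y)).eventually_lt_const (by simp)
  have e2 : ∀ᶠ a : CRP x p (p / 2) V × CRP x p (p / 2) V in 𝓝 (y, y), ‖a.2‖ < ‖y‖ + 1 :=
    (continuous_snd.norm.tendsto (y, y)).eventually_lt_const (by simp)
  have e3 : ∀ᶠ a : CRP x p (p / 2) V × CRP x p (p / 2) V in 𝓝 (y, y),
      S * ‖a.1 - a.2‖ < 1 :=
    ((continuous_const.mul (continuous_fst.sub continuous_snd).norm).tendsto
      (y, y)).eventually_lt_const (by simp)
  filter_upwards [e1, e2, e3] with a h1 h2 h3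
  refine (norm_omegaL_sub_le he h1.le h2.le h3.le).trans_eq ?_
  rw [Real.mul_rpow hS (norm_nonneg _), Real.norm_eq_abs,
    abs_of_nonneg (Real.rpow_nonneg (norm_nonneg _) _)]
  ring

lemma continuous_omegaL (he : HolderExpo p κ γ) :
    Continuous (omegaL n he E : CRP x p (p / 2) V → _) := by
  have hβ : 0 < (1 - κ) * γ := mul_pos (sub_pos.2 he.κ_lt) he.γ_pos
  refine continuous_iff_continuousAt.2 fun y => ?_
  rw [ContinuousAt, tendsto_iff_norm_sub_tendsto_zero]
  have h1 := (omegaL_isBigO (E := E) (n := n) he y).comp_tendsto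
    (k := fun y' => (y', y)) (l' := 𝓝 y) ((Continuous.prodMk_left y).tendsto' _ _ rfl)
  have h2 : Filter.Tendsto (fun y' => ‖y' - y‖ ^ ((1 - κ) * γ)) (𝓝 y)
      (𝓝 (‖y - y‖ ^ ((1 - κ) * γ))) :=
    ((continuous_id.sub continuous_const).norm.rpow_const fun _ => Or.inr hβ.le).tendsto y
  rw [sub_self, norm_zero, Real.zero_rpow hβ.ne'] at h2
  simpa using (h1.trans_tendsto h2).norm

variable (V E) in
/-- The operator that turns the composition with `Df` into the derivative of the composition
with `f`. -/
def thetaL (x : RoughPath ω p U) (n : ℕ) (hσ : Expo p (κ * γ)) :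
    (HolderSpace V (V →L[ℝ] E) (n + 1) γ →L[ℝ]
      CRP x (p / (κ * γ)) (p / (1 + κ * γ)) (V →L[ℝ] E)) →L[ℝ]
    CRP x p (p / 2) V →L[ℝ] (HolderSpace V E (n + 1 + 1) γ →L[ℝ]
      CRP x (p / (κ * γ)) (p / (1 + κ * γ)) E) :=
  ((ContinuousLinearMap.flipₗᵢ ℝ (HolderSpace V E (n + 1 + 1) γ) (CRP x p (p / 2) V)
      (CRP x (p / (κ * γ)) (p / (1 + κ * γ)) E)).toContinuousLinearEquiv :
        (HolderSpace V E (n + 1 + 1) γ →L[ℝ] CRP x p (p / 2) V →L[ℝ]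
          CRP x (p / (κ * γ)) (p / (1 + κ * γ)) E) →L[ℝ] _).comp
    ((ContinuousLinearMap.compL ℝ (HolderSpace V E (n + 1 + 1) γ) _ _ (mulL x V E hσ)).comp
      ((ContinuousLinearMap.compL ℝ _ _ _).flip (derivL V E (n + 1) γ)))

lemma thetaL_apply (hσ : Expo p (κ * γ))
    (L : HolderSpace V (V →L[ℝ] E) (n + 1) γ →L[ℝ]
      CRP x (p / (κ * γ)) (p / (1 + κ * γ)) (V →L[ℝ] E))
    (h : CRP x p (p / 2) V) (f : HolderSpace V E (n + 1 + 1) γ) :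
    thetaL V E x n hσ L h f = mulL x V E hσ (L (derivL V E (n + 1) γ f)) h := rfl

lemma hasDerivAt_line {X : Type*} [NormedAddCommGroup X] [NormedSpace ℝ X] (c d : X) (τ : ℝ) :
    HasDerivAt (fun τ : ℝ => c + τ • d) d τ := by
  simpa using ((hasDerivAt_id τ).smul_const d).const_add c

/-- Differentiating Df(y) y† puts the direction into the first slot of D²f, whereas the derivative
of the product Df(y) h has it in the second slot. Symmetry of the second derivative reconciles them.
-/
lemma hasDerivAt_comp_line {f : V → E} (hf : ContDiff ℝ 2 f) (a b : V) (A B : U →L[ℝ] V)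
    (τ : ℝ) :
    HasDerivAt (fun τ : ℝ => f (a + τ • b)) (fderiv ℝ f (a + τ • b) b) τ ∧
    HasDerivAt (fun τ : ℝ => (fderiv ℝ f (a + τ • b)).comp (A + τ • B))
      (((fderiv ℝ (fderiv ℝ f) (a + τ • b)).comp (A + τ • B)).flip b +
        (fderiv ℝ f (a + τ • b)).comp B) τ := by
  have hl := hasDerivAt_line a b τ
  have hd := (hf.differentiable two_ne_zero (a + τ • b)).hasFDerivAt
  have hd' := ((hf.fderiv_right (m := 1) (by norm_num)).differentiable one_ne_zero
    (a + τ • b)).hasFDerivAt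
  have h1 : HasDerivAt (fun τ : ℝ => fderiv ℝ f (a + τ • b))
      (fderiv ℝ (fderiv ℝ f) (a + τ • b) b) τ := hd'.comp_hasDerivAt τ hl
  have h2 := h1.clm_comp (hasDerivAt_line A B τ)
  have hsym : IsSymmSndFDerivAt ℝ f (a + τ • b) :=
    hf.contDiffAt.isSymmSndFDerivAt (by simp)
  have e : ((fderiv ℝ (fderiv ℝ f) (a + τ • b)).comp (A + τ • B)).flip b =
      (fderiv ℝ (fderiv ℝ f) (a + τ • b) b).comp (A + τ • B) := by
    ext u
    exact hsym _ _
  refine ⟨hd.comp_hasDerivAt τ hl, ?_⟩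
  rw [e]
  exact h2

lemma mulL_path (hσ : Expo p (κ * γ))
    (A : CRP x (p / (κ * γ)) (p / (1 + κ * γ)) (V →L[ℝ] E)) (h : CRP x p (p / 2) V)
    (t : Time T) : (mulL x V E hσ A h).path t = A.path t (h.path t) := rfl

lemma mulL_dag (hσ : Expo p (κ * γ))
    (A : CRP x (p / (κ * γ)) (p / (1 + κ * γ)) (V →L[ℝ] E)) (h : CRP x p (p / 2) V)
    (t : Time T) : (mulL x V E hσ A h).dag t =
      (A.dag t).flip (h.path t) + (A.path t).comp (h.dag t) := rfl

lemma omegaL_path (he : HolderExpo p κ γ) (y : CRP x p (p / 2) V)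
    (f : HolderSpace V E (n + 1) γ) (t : Time T) :
    (omegaL n he E y f).path t = f.1 (y.path t) := rfl

lemma omegaL_dag (he : HolderExpo p κ γ) (y : CRP x p (p / 2) V)
    (f : HolderSpace V E (n + 1) γ) (t : Time T) :
    (omegaL n he E y f).dag t = (fderiv ℝ f.1 (y.path t)).comp (y.dag t) := rfl

lemma derivL_val (f : HolderSpace V E (n + 1) γ) : (derivL V E n γ f).1 = fderiv ℝ f.1 := rfl

/-- The derivative of `y ↦ f(y)` along a line, at a fixed time. -/
lemma hasDerivAt_omegaL (he : HolderExpo p κ γ) (y h : CRP x p (p / 2) V)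
    (f : HolderSpace V E (n + 1 + 1) γ) (t : Time T) (τ : ℝ) :
    HasDerivAt (fun τ : ℝ => (omegaL (n + 1) he E (y + τ • h) f).path t)
      ((mulL x V E he.expo (omegaL n he _ (y + τ • h) (derivL V E (n + 1) γ f)) h).path t) τ ∧
    HasDerivAt (fun τ : ℝ => (omegaL (n + 1) he E (y + τ • h) f).dag t)
      ((mulL x V E he.expo (omegaL n he _ (y + τ • h) (derivL V E (n + 1) γ f)) h).dag t) τ := by
  simp only [mulL_path, mulL_dag, omegaL_path, omegaL_dag, CRP.path_add, CRP.dag_add,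
    CRP.path_smul, CRP.dag_smul, derivL_val]
  exact hasDerivAt_comp_line (f.contDiff.of_le (by norm_cast; omega)) _ _ _ _ τ

/-- At fixed times the derivative of f(y) along a line is the product of Df(y) with the direction.
The mean value inequality lifts this to the norm of controlled rough paths, and the error is
governed by the continuity in y of the operator g ↦ g(y), evaluated at g = Df. That continuity holds
in operator norm, hence uniformly over f in the unit ball. -/
lemma hasFDerivAt_omegaL (he : HolderExpo p κ γ) (y : CRP x p (p / 2) V) :
    HasFDerivAt (omegaL (n + 1) he E) (thetaL V E x n he.expo (omegaL n he _ y)) y := by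
  rw [hasFDerivAt_iff_isLittleO_nhds_zero, Asymptotics.isLittleO_iff]
  intro c hc
  have hcont := (continuous_omegaL (x := x) (n := n) (E := V →L[ℝ] E) he).tendsto y
  set M := ‖mulL x V E he.expo‖ with hM
  -- The 4 compensates the factor in the mean value inequality, and M + 1 the norm of the product
  -- without dividing by zero.
  obtain ⟨δ, hδ, hball⟩ := Metric.tendsto_nhds_nhds.1 hcont (c / (4 * (M + 1)))
    (by positivity)
  filter_upwards [Metric.ball_mem_nhds (0 : CRP x p (p / 2) V) hδ] with h hh
  rw [mem_ball_zero_iff] at hh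
  refine ContinuousLinearMap.opNorm_le_bound _ (by positivity) fun f => ?_
  let A : ℝ → CRP x (p / (κ * γ)) (p / (1 + κ * γ)) (V →L[ℝ] E) :=
    fun τ => omegaL n he _ (y + τ • h) (derivL V E (n + 1) γ f)
  let B := omegaL n he _ y (derivL V E (n + 1) γ f)
  -- The linear part is subtracted along the segment, so that g 1 - g 0 is the full error of the
  -- linearisation and g' involves only the change of Df along the segment.
  let g : ℝ → CRP x (p / (κ * γ)) (p / (1 + κ * γ)) E := fun τ =>
    omegaL (n + 1) he E (y + τ • h) f - τ • mulL x V E he.expo B h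
  let g' : ℝ → CRP x (p / (κ * γ)) (p / (1 + κ * γ)) E := fun τ =>
    mulL x V E he.expo (A τ) h - mulL x V E he.expo B h
  have key := CRP.norm_sub_le_of_deriv (g := g) (g' := g')
    (C := c / 4 * ‖h‖ * ‖f‖)
    (fun t τ _ => by
      have h2 := (hasDerivAt_id τ).smul_const ((mulL x V E he.expo B h).path t)
      rw [one_smul] at h2
      exact (hasDerivAt_omegaL he y h f t τ).1.sub h2)
    (fun t τ _ => by
      have h2 := (hasDerivAt_id τ).smul_const ((mulL x V E he.expo B h).dag t)
      rw [one_smul] at h2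
      exact (hasDerivAt_omegaL he y h f t τ).2.sub h2)
    fun τ hτ => by
      have e : g' τ = mulL x V E he.expo ((omegaL n he (V →L[ℝ] E) (y + τ • h) -
          omegaL n he (V →L[ℝ] E) y) (derivL V E (n + 1) γ f)) h := by
        simp only [g', A, B, sub_apply, map_sub]
      have hd : dist (y + τ • h) y < δ := by
        rw [dist_eq_norm, add_sub_cancel_left, norm_smul, Real.norm_eq_abs, abs_of_nonneg hτ.1]
        exact (mul_le_of_le_one_left (norm_nonneg _) hτ.2).trans_lt hh
      have h3 := (hball hd).le
      rw [dist_eq_norm] at h3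
      have h4 : ‖derivL V E (n + 1) γ f‖ ≤ ‖f‖ := by
        refine ((derivL V E (n + 1) γ).le_of_opNorm_le (LinearMap.mkContinuous_norm_le _
          zero_le_one _) f).trans_eq (one_mul _)
      have h5 := ((omegaL n he (V →L[ℝ] E) (y + τ • h) - omegaL n he _ y).le_of_opNorm_le h3
        (derivL V E (n + 1) γ f))
      rw [e]
      calc _ ≤ M * (c / (4 * (M + 1)) * ‖f‖) * ‖h‖ := by
            refine ((mulL x V E he.expo).le_opNorm₂ _ _).trans ?_
            gcongr
            exact h5.trans (by gcongr)
        _ = M / (M + 1) * (c / 4 * ‖h‖ * ‖f‖) := by field_simp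
        _ ≤ _ := by
            have hM0 : 0 ≤ M := hM ▸ norm_nonneg (mulL x V E he.expo)
            refine mul_le_of_le_one_left (by positivity) ((div_le_one (by positivity)).2 ?_)
            linarith
  have e2 : (omegaL (n + 1) he E (y + h) - omegaL (n + 1) he E y -
      thetaL V E x n he.expo (omegaL n he _ y) h) f = g 1 - g 0 := by
    simp only [g, one_smul, zero_smul, add_zero, sub_zero, sub_apply, thetaL_apply, B]
    abel
  rw [e2]
  refine key.trans_eq ?_
  ring

end Omega

/-! ### Higher regularity of the composition operator -/

section Regularity

lemma CkHolderAt.clm_comp {E F G : Type*} [NormedAddCommGroup E] [NormedSpace ℝ E]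
    [NormedAddCommGroup F] [NormedSpace ℝ F] [NormedAddCommGroup G] [NormedSpace ℝ G]
    {n : ℕ} {β : ℝ} {f : E → F} {a : E} (h0 : 0 ≤ β) (hβ : β ≤ 1) (L : F →L[ℝ] G)
    (hf : CkHolderAt n β f a) : CkHolderAt n β (fun y => L (f y)) a :=
  CkHolderAt.comp (g := L) h0 hβ (.of_contDiffAt hβ L.contDiff.contDiffAt) hf
    (Or.inl L.contDiff.contDiffAt)

universe u v w

variable {T : ℝ} [Fact (0 < T)] {ω : Control T} {p κ γ : ℝ}
variable {U : Type u} {V : Type v} [NormedAddCommGroup U] [NormedSpace ℝ U]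
  [NormedAddCommGroup V] [NormedSpace ℝ V]
variable {x : RoughPath ω p U}

/-- The derivative of the operator on functions with values in E is a fixed bounded linear map
applied to the operator, one order lower, on functions with values in L(V, E). The induction
therefore runs over all target spaces at once, and their universe is chosen to contain L(V, E)
again. -/
lemma ckHolderAt_omegaL (he : HolderExpo p κ γ) (n : ℕ) : ∀ (E : Type (max v w))
    [NormedAddCommGroup E] [NormedSpace ℝ E] (y : CRP x p (p / 2) V),
    CkHolderAt n ((1 - κ) * γ) (omegaL n he E) y := by
  have hβ0 : 0 ≤ (1 - κ) * γ := mul_nonneg (sub_nonneg.2 he.κ_lt.le) he.γ_pos.le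
  have hβ1 : (1 - κ) * γ ≤ 1 :=
    mul_le_one₀ (by linarith [he.κ_pos]) he.γ_pos.le he.γ_le
  induction n with
  | zero =>
    intro E _ _ y
    exact ⟨contDiffAt_zero.2 ⟨Set.univ, Filter.univ_mem, (continuous_omegaL he).continuousOn⟩,
      isBigO_iteratedFDeriv_zero_iff.2 (omegaL_isBigO he y)⟩
  | succ n ih =>
    intro E _ _ y
    refine CkHolderAt.of_hasFDerivAt (fun y => hasFDerivAt_omegaL he y) ?_
    exact CkHolderAt.clm_comp (F := HolderSpace V (V →L[ℝ] E) (n + 1) γ →L[ℝ]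
        CRP x (p / (κ * γ)) (p / (1 + κ * γ)) (V →L[ℝ] E))
      (G := CRP x p (p / 2) V →L[ℝ] (HolderSpace V E (n + 1 + 1) γ →L[ℝ]
        CRP x (p / (κ * γ)) (p / (1 + κ * γ)) E))
      hβ0 hβ1 (thetaL V E x n he.expo) (ih (V →L[ℝ] E) y)

end Regularity

/-! ### Local bounds with exponential weights -/

section Local

variable {T : ℝ} [Fact (0 < T)] {ω : Control T} {p σ : ℝ}
variable {U V W : Type*} [NormedAddCommGroup U] [NormedSpace ℝ U]
  [NormedAddCommGroup V] [NormedSpace ℝ V] [NormedAddCommGroup W] [NormedSpace ℝ W]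
variable {x : RoughPath ω p U}

lemma Control.exists_v_le (hσ : Expo p σ) {ε : ℝ} (hε : 0 < ε) :
    ∃ δ > 0, ∀ s t : Time T, s ≤ t → (t : ℝ) - s ≤ δ → ω.v p σ s t ≤ ε := by
  have hp := hσ.p_pos
  have h0 := hσ.pos
  obtain ⟨δ, hδ, h⟩ := ω.exists_small (ε := ε ^ (p / σ)) (Real.rpow_pos_of_pos hε _)
  refine ⟨δ / 2, half_pos hδ, fun s t hst hd => ?_⟩
  have h1 := (h s t hst (hd.trans_lt (half_lt_self hδ))).le
  calc ω.v p σ s t ≤ (ε ^ (p / σ)) ^ (σ / p) :=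
        Real.rpow_le_rpow (ω.nonneg s t hst) h1 (by positivity)
    _ = ε := by
        rw [← Real.rpow_mul hε.le, div_mul_div_cancel₀ h0.ne', div_self hp.ne', Real.rpow_one]

/-- On every interval of length at most `δ`, the path, its derivative and its variation are bounded
by `K`, `K / μ` and `K / μ ^ 2`, up to an exponential weight. -/
def LocBd (x : RoughPath ω p U) (δ μ K : ℝ) (h : (Time T → V) × (Time T → (U →L[ℝ] V))) :
    Prop :=
  ∀ a b : Time T, a ≤ b → (b : ℝ) - a ≤ δ →
    IvBd x p (p / 2) h a b (K * 2 ^ ((a : ℝ) / δ)) (K / μ * 2 ^ ((a : ℝ) / δ))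
      (K / μ ^ 2 * 2 ^ ((a : ℝ) / δ))

lemma one_le_weight {δ : ℝ} (hδ : 0 < δ) (a : Time T) : (1 : ℝ) ≤ 2 ^ ((a : ℝ) / δ) :=
  Real.one_le_rpow one_le_two (div_nonneg a.2.1 hδ.le)

lemma CRP.locBd (hσ : Expo p σ) {δ μ : ℝ} (hδ : 0 < δ) (hμ : 0 < μ) (hμ1 : μ ≤ 1)
    (h : CRP x p (p / 2) V) : LocBd x δ μ (supConst x p (p / 2) * ‖h‖) h.1 := by
  intro a b _ _
  have hK := mul_nonneg (zero_le_one.trans (one_le_supConst x p (p / 2))) (norm_nonneg h)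
  have hg := one_le_weight hδ a
  have h1 := le_mul_of_one_le_right hK hg
  have h2 : supConst x p (p / 2) * ‖h‖ ≤ supConst x p (p / 2) * ‖h‖ / μ :=
    le_div_self hK hμ hμ1
  have h3 : supConst x p (p / 2) * ‖h‖ ≤ supConst x p (p / 2) * ‖h‖ / μ ^ 2 :=
    le_div_self hK (by positivity) (pow_le_one₀ hμ.le hμ1)
  exact ((h.ivBd_self hσ).restrict (t0_le a) (le_tT b)).mono h1
    (h2.trans (le_mul_of_one_le_right (hK.trans h2) hg))
    (h3.trans (le_mul_of_one_le_right (hK.trans h3) hg))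

lemma CRP.sharp_chain (h : CRP x p (p / 2) V) (s u t : Time T) :
    h.sharp s t = h.sharp s u + h.sharp u t + (h.dag u - h.dag s) (x.inc1 u t) := by
  have : x.inc1 s t = x.inc1 s u + x.inc1 u t := by simp [RoughPath.inc1]
  simp only [CRP.sharp, this, map_add, sub_apply]
  abel

/-- Splitting off a last interval of length δ costs a factor 2 + |x|: two pieces, and for the
remainder also the cross term of an increment of h† with x¹. -/
lemma CRP.chain_bounds (hσ : Expo p σ) {δ K : ℝ} (hδ : 0 < δ) (hK : 0 ≤ K)
    {h : CRP x p (p / 2) V}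
    (hloc : ∀ s t : Time T, s ≤ t → (t : ℝ) - s ≤ δ → ‖h.dag t - h.dag s‖ ≤ K * ω.w p s t ∧
      ‖h.sharp s t‖ ≤ K * (ω.w p s t * ω.w p s t)) (n : ℕ) :
    ∀ s t : Time T, s ≤ t → (t : ℝ) - s ≤ n * δ →
      ‖h.dag t - h.dag s‖ ≤ K * (2 + x.size) ^ n * ω.w p s t ∧
      ‖h.sharp s t‖ ≤ K * (2 + x.size) ^ n * (ω.w p s t * ω.w p s t) := by
  have hX := x.size_nonneg
  have h2X : 1 ≤ 2 + x.size := by linarith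
  have hmono : ∀ n : ℕ, K ≤ K * (2 + x.size) ^ n := fun n =>
    le_mul_of_one_le_right hK (one_le_pow₀ h2X)
  induction n with
  | zero =>
    intro s t hst hd
    rw [pow_zero, mul_one]
    exact hloc s t hst (by rw [Nat.cast_zero, zero_mul] at hd; linarith)
  | succ n ih =>
    intro s t hst hd
    have hw := ω.w_nonneg (p := p) hst
    rcases le_or_gt ((t : ℝ) - s) δ with hsmall | hbig
    · obtain ⟨h1, h2⟩ := hloc s t hst hsmall
      exact ⟨h1.trans (mul_le_mul_of_nonneg_right (hmono _) hw),
        h2.trans (mul_le_mul_of_nonneg_right (hmono _) (mul_nonneg hw hw))⟩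
    · let u : Time T := ⟨(t : ℝ) - δ, by linarith [s.2.1], by linarith [t.2.2]⟩
      have hsu : s ≤ u := Subtype.coe_le_coe.1 (show (s : ℝ) ≤ t - δ by linarith)
      have hut : u ≤ t := Subtype.coe_le_coe.1 (show (t : ℝ) - δ ≤ t by linarith)
      obtain ⟨h1, h2⟩ := ih s u hsu (by push_cast at hd; simp only [u]; linarith)
      obtain ⟨h3, h4⟩ := hloc u t hut (by simp [u])
      have w1 : ω.w p s u ≤ ω.w p s t := ω.w_mono hσ le_rfl hsu hut
      have w2 : ω.w p u t ≤ ω.w p s t := ω.w_mono hσ hsu hut le_rfl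
      have w1' := ω.w_nonneg (p := p) hsu
      have w2' := ω.w_nonneg (p := p) hut
      have he := hmono n
      set e := K * (2 + x.size) ^ n with hedef
      have he0 : 0 ≤ e := hK.trans he
      have hes : K * (2 + x.size) ^ (n + 1) = e * (2 + x.size) := by rw [hedef]; ring
      rw [hes]
      constructor
      · have : h.dag t - h.dag s = (h.dag u - h.dag s) + (h.dag t - h.dag u) := by abel
        rw [this]
        calc _ ≤ e * ω.w p s t + e * ω.w p s t := by
              refine (norm_add_le _ _).trans (add_le_add (h1.trans ?_) (h3.trans ?_)) <;> gcongr
          _ ≤ _ := by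
              have := mul_nonneg (mul_nonneg he0 hX) hw
              linarith
      · rw [h.sharp_chain s u t]
        calc _ ≤ e * (ω.w p s t * ω.w p s t) + e * (ω.w p s t * ω.w p s t) +
              e * ω.w p s t * (x.size * ω.w p s t) := by
              refine norm_add₃_le.trans (add_le_add (add_le_add (h2.trans ?_) (h4.trans ?_)) ?_)
              · gcongr
              · gcongr
              · refine ((h.dag u - h.dag s).le_opNorm _).trans (mul_le_mul (h1.trans ?_)
                  ((x.norm_inc1_le hut).trans ?_) (norm_nonneg _) (by positivity))
                · gcongr
                · exact mul_le_mul_of_nonneg_left w2 hX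
          _ = _ := by ring

/-- Finitely many intervals of length δ cover [0, T], and the weights are bounded there. The
constant depends on δ and μ but not on the path, so geometric decay of local bounds gives geometric
decay of norms. -/
lemma LocBd.norm_le (hσ : Expo p σ) {δ μ : ℝ} (hδ : 0 < δ) (hμ : 0 < μ)
    (x : RoughPath ω p U) :
    ∃ C, 0 ≤ C ∧ ∀ (h : CRP x p (p / 2) V) (K : ℝ), 0 ≤ K → LocBd x δ μ K h.1 →
      ‖h‖ ≤ C * K := by
  obtain ⟨n, hn⟩ := exists_nat_ge (T / δ)
  have hn' : T ≤ n * δ := (div_le_iff₀ hδ).1 hn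
  have hX := x.size_nonneg
  set G : ℝ := 2 ^ (T / δ) with hG
  have hG0 : 0 < G := Real.rpow_pos_of_pos two_pos _
  have hgG : ∀ a : Time T, (2 : ℝ) ^ ((a : ℝ) / δ) ≤ G := fun a =>
    Real.rpow_le_rpow_of_exponent_le one_le_two (by gcongr; exact a.2.2)
  refine ⟨1 + 1 / μ + 2 * (1 / μ ^ 2 * G * (2 + x.size) ^ n), by positivity,
    fun h K hK hloc => ?_⟩
  have hc := CRP.chain_bounds (h := h) hσ hδ (K := K / μ ^ 2 * G) (by positivity)
    (fun s t hst hd => by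
      have hI := hloc s t hst hd
      have hle : K / μ ^ 2 * 2 ^ ((s : ℝ) / δ) ≤ K / μ ^ 2 * G :=
        mul_le_mul_of_nonneg_left (hgG s) (by positivity)
      have hw := ω.w_nonneg (p := p) hst
      refine ⟨(hI.var s t le_rfl hst le_rfl).trans (mul_le_mul_of_nonneg_right hle hw), ?_⟩
      have := hI.rem s t le_rfl hst le_rfl
      rw [ω.rpow_half hσ hst] at this
      exact this.trans (mul_le_mul_of_nonneg_right hle (mul_nonneg hw hw))) n
  have hd : ∀ s t : Time T, (t : ℝ) - s ≤ n * δ := fun s t => by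
    linarith [s.2.1, t.2.2]
  have h0 := hloc t0 t0 le_rfl (by simpa using hδ.le)
  have e0 : (2 : ℝ) ^ (((t0 : Time T) : ℝ) / δ) = 1 := by simp [t0]
  rw [e0, mul_one, mul_one, mul_one] at h0
  refine (CRP.norm_le (h0.path t0 le_rfl le_rfl) (h0.dag t0 le_rfl le_rfl)
    (K2 := K / μ ^ 2 * G * (2 + x.size) ^ n) (by positivity)
    (fun s t hst => (hc s t hst (hd s t)).1)
    (K3 := K / μ ^ 2 * G * (2 + x.size) ^ n) (by positivity)
    (fun s t hst => by rw [ω.rpow_half hσ hst]; exact (hc s t hst (hd s t)).2)).trans_eq ?_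
  ring

/-- The weight doubles over a step of length δ, so an increment of L times the weight keeps f below
2L times the weight. Increments thus accumulate without losing a factor that depends on the number
of steps. -/
lemma le_weight_of_step {δ L : ℝ} (hδ : 0 < δ) (hL : 0 ≤ L) {f : Time T → ℝ} (h0 : f t0 = 0)
    (hf : ∀ s t : Time T, s ≤ t → (t : ℝ) - s ≤ δ → f t ≤ f s + L * 2 ^ ((s : ℝ) / δ))
    (t : Time T) : f t ≤ 2 * L * 2 ^ ((t : ℝ) / δ) := by
  obtain ⟨n, hn⟩ := exists_nat_ge ((t : ℝ) / δ)
  replace hn : (t : ℝ) ≤ n * δ := (div_le_iff₀ hδ).1 hn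
  have hg := fun t : Time T => one_le_weight hδ t
  induction n generalizing t with
  | zero =>
    have : t = t0 := le_antisymm (by
      rw [Nat.cast_zero, zero_mul] at hn
      exact Subtype.coe_le_coe.1 hn) (t0_le t)
    rw [this, h0]
    have := hg (t0 : Time T)
    positivity
  | succ n ih =>
    have h1 := hg t
    have h2 := mul_le_mul_of_nonneg_left h1 hL
    rcases le_or_gt (t : ℝ) δ with hsmall | hbig
    · have := hf t0 t (t0_le t) (by simpa [t0] using hsmall)
      have e0 : (2 : ℝ) ^ (((t0 : Time T) : ℝ) / δ) = 1 := by simp [t0]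
      rw [h0, e0] at this
      linarith
    · let s : Time T := ⟨(t : ℝ) - δ, by linarith, by linarith [t.2.2]⟩
      have hst : s ≤ t := Subtype.coe_le_coe.1 (show (t : ℝ) - δ ≤ t by linarith)
      have h3 := hf s t hst (by simp [s])
      have h4 := ih s (by push_cast at hn; simp only [s]; linarith)
      have e : (2 : ℝ) ^ ((t : ℝ) / δ) = 2 * 2 ^ ((s : ℝ) / δ) := by
        have : (t : ℝ) / δ = 1 + (s : ℝ) / δ := by simp only [s]; field_simp; ring
        rw [this, Real.rpow_add two_pos, Real.rpow_one]
      rw [e]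
      have := mul_nonneg hL (zero_le_one.trans (hg s))
      linarith

/-- The integral of a product against `z` halves the local bounds, if the intervals are short and
the weights are well chosen. -/
theorem exists_halving [CompleteSpace V] (hσ : Expo p σ) (x : RoughPath ω p U) {M N : ℝ}
    (hM : 0 ≤ M) (hN : 0 ≤ N) :
    ∃ μ > 0, μ ≤ 1 ∧ ∃ ε > 0, ∀ δ > 0,
      (∀ s t : Time T, s ≤ t → (t : ℝ) - s ≤ δ → ω.v p σ s t ≤ ε) →
      ∀ (A : CRP x (p / σ) (p / (1 + σ)) (V →L[ℝ] W →L[ℝ] V)) (z : CRP x p (p / 2) W),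
      (∀ a b : Time T, a ≤ b → (b : ℝ) - a ≤ δ →
        IvBd x (p / σ) (p / (1 + σ)) A.1 a b N N N) →
      (∀ a b : Time T, a ≤ b → (b : ℝ) - a ≤ δ → IvBd x p (p / 2) z.1 a b M M M) →
      ∀ (h : CRP x p (p / 2) V) (K : ℝ), 0 ≤ K → LocBd x δ μ K h.1 →
        LocBd x δ μ (K / 2) (intL x V W hσ (mulL x V (W →L[ℝ] V) hσ A h) z).1 := by
  have hC := (intBd_pos (x := x) hσ).le
  have hc := (mulConst_pos (x := x) (σ := σ)).le
  set P := M * intBd x σ * N with hP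
  set c := mulConst x σ with hcdef
  have hP0 : 0 ≤ P := by positivity
  have hμd : 0 < 12 * P + 2 * (M * N) + 1 := by positivity
  -- This makes MNμ ≤ 1/2, which halves the derivative, and P(2μ² + μ) ≤ 1/4, which handles the part
  -- of the variations without a small factor.
  obtain ⟨μ, hμ⟩ : ∃ μ : ℝ, μ = 1 / (12 * P + 2 * (M * N) + 1) := ⟨_, rfl⟩
  have hμ0 : 0 < μ := by rw [hμ]; positivity
  have hμe : 12 * P * μ + 2 * (M * N) * μ + μ = 1 := by rw [hμ]; field_simp
  have hMN : 0 ≤ M * N * μ := by positivity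
  have hPμ : 0 ≤ P * μ := by positivity
  have hμ1 : μ ≤ 1 := by linarith
  obtain ⟨S, hS⟩ : ∃ S : ℝ, S = P * (2 + 1 / μ + c * (1 + 1 / μ + 1 / μ ^ 2)) := ⟨_, rfl⟩
  have hS0 : 0 ≤ S := by rw [hS]; positivity
  have hεd : 0 < 8 * S + 12 * (P * c) + 1 := by positivity
  -- Chosen after μ: Sε ≤ 1/8 controls the path, whose estimate loses a factor 4, and 3Pcε ≤ 1/4
  -- controls the rest of the variations.
  obtain ⟨ε, hε⟩ : ∃ ε : ℝ, ε = 1 / (8 * S + 12 * (P * c) + 1) := ⟨_, rfl⟩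
  have hε0 : 0 < ε := by rw [hε]; positivity
  have hεe : 8 * S * ε + 12 * (P * c) * ε + ε = 1 := by rw [hε]; field_simp
  have hSε : 0 ≤ S * ε := by positivity
  have hPcε : 0 ≤ P * c * ε := by positivity
  refine ⟨μ, hμ0, hμ1, ε, hε0, fun δ hδ hv A z hA hz h K hK hh => ?_⟩
  have key : ∀ a b : Time T, a ≤ b → (b : ℝ) - a ≤ δ →
      IvBd x p (p / 2) (intL x V W hσ (mulL x V (W →L[ℝ] V) hσ A h) z).1 a b
        (‖(intL x V W hσ (mulL x V (W →L[ℝ] V) hσ A h) z).path a‖ +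
          S * ε * K * 2 ^ ((a : ℝ) / δ))
        (K / 2 / μ * 2 ^ ((a : ℝ) / δ)) (K / 2 / μ ^ 2 * 2 ^ ((a : ℝ) / δ)) := by
    intro a b hab hd
    have hg := zero_le_one.trans (one_le_weight hδ a)
    set g : ℝ := 2 ^ ((a : ℝ) / δ)
    have hva := hv a b hab hd
    have hv0 := ω.v_nonneg (p := p) (σ := σ) hab
    have h1 := mulPair_ivBd hσ hab (by positivity) (hA a b hab hd) (hh a b hab hd)
    have h2 := intPair_ivBd hσ (Y := mulL x V (W →L[ℝ] V) hσ A h) hab hM (by positivity) h1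
      (hz a b hab hd)
    refine h2.mono (add_le_add le_rfl ?_) ?_ ?_
    · calc _ ≤ ε * (M * intBd x σ * (N * (K * g) + N * (K * g + K / μ * g) +
            N * mulConst x σ * (K * g + K / μ * g + K / μ ^ 2 * g))) := by gcongr
        _ = S * ε * K * g := by rw [hS, hP, hcdef]; field_simp; ring
    · have : M * N * μ ≤ 1 / 2 := by linarith
      calc N * (K * g) * M = M * N * μ * (K / μ * g) := by field_simp
        _ ≤ 1 / 2 * (K / μ * g) := by gcongr
        _ = _ := by ring
    · have e1 : P * (2 * μ ^ 2 + μ) ≤ 1 / 4 := by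
        have : P * μ ^ 2 ≤ P * μ := by nlinarith
        linarith
      have e2 : P * c * ε * (μ ^ 2 + μ + 1) ≤ 1 / 4 := by
        have : μ ^ 2 ≤ 1 := pow_le_one₀ hμ0.le hμ1
        have : P * c * ε * (μ ^ 2 + μ + 1) ≤ P * c * ε * 3 :=
          mul_le_mul_of_nonneg_left (by linarith) hPcε
        linarith
      calc _ ≤ M * intBd x σ * (N * (K * g) + N * (K * g + K / μ * g) +
            ε * (N * mulConst x σ * (K * g + K / μ * g + K / μ ^ 2 * g))) := by gcongr
        _ = (P * (2 * μ ^ 2 + μ) + P * c * ε * (μ ^ 2 + μ + 1)) * (K / μ ^ 2 * g) := by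
            rw [hP, hcdef]; field_simp; ring
        _ ≤ (1 / 4 + 1 / 4) * (K / μ ^ 2 * g) := by gcongr
        _ = _ := by ring
  set B := intL x V W hσ (mulL x V (W →L[ℝ] V) hσ A h) z with hB
  -- On one interval the path is bounded only relative to its value at the left end. Summing the
  -- steps from time 0, where the integral vanishes, gives an absolute bound.
  have hstep := le_weight_of_step (f := fun t => ‖B.path t‖) hδ (L := S * ε * K)
    (by positivity) (by rw [hB, intL_path, integral_zero, norm_zero])
    fun s t hst hd => (key s t hst hd).path t hst le_rfl
  intro a b hab hd
  have hk := key a b hab hd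
  refine ⟨fun t hat htb => ?_, hk.dag, hk.var, hk.rem⟩
  have hg := zero_le_one.trans (one_le_weight hδ a)
  have e : (2 : ℝ) ^ ((t : ℝ) / δ) ≤ 2 * 2 ^ ((a : ℝ) / δ) := by
    have h1 : (t : ℝ) / δ ≤ 1 + (a : ℝ) / δ := by
      rw [div_le_iff₀ hδ, add_mul, div_mul_cancel₀ _ hδ.ne']
      have : (t : ℝ) ≤ b := htb
      linarith
    calc _ ≤ (2 : ℝ) ^ (1 + (a : ℝ) / δ) := Real.rpow_le_rpow_of_exponent_le one_le_two h1
      _ = _ := by rw [Real.rpow_add two_pos, Real.rpow_one]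
  have h8 : S * ε ≤ 1 / 8 := by linarith
  calc ‖B.path t‖ ≤ 2 * (S * ε * K) * 2 ^ ((t : ℝ) / δ) := hstep t
    _ ≤ 2 * (1 / 8 * K) * (2 * 2 ^ ((a : ℝ) / δ)) := by gcongr
    _ = _ := by ring

/-- The operator `1 - B` is invertible if `B` integrates a product against a fixed path. -/
theorem isUnit_one_sub_integral [CompleteSpace V] (hσ : Expo p σ)
    (A : CRP x (p / σ) (p / (1 + σ)) (V →L[ℝ] W →L[ℝ] V)) (z : CRP x p (p / 2) W)
    (B : CRP x p (p / 2) V →L[ℝ] CRP x p (p / 2) V)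
    (hB : ∀ h, B h = intL x V W hσ (mulL x V (W →L[ℝ] V) hσ A h) z) : IsUnit (1 - B) := by
  have hS := zero_le_one.trans (one_le_supConst x p (p / 2))
  have hS' := zero_le_one.trans (one_le_supConst x (p / σ) (p / (1 + σ)))
  obtain ⟨μ, hμ, hμ1, ε, hε, hhalf⟩ := exists_halving (V := V) (W := W) hσ x
    (mul_nonneg hS (norm_nonneg z)) (mul_nonneg hS' (norm_nonneg A))
  obtain ⟨δ, hδ, hv⟩ := ω.exists_v_le hσ hε
  obtain ⟨C, hC, hnorm⟩ := LocBd.norm_le (V := V) hσ hδ hμ x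
  -- The operator need not be a contraction in the original norm, but its iterates decay
  -- geometrically in the local bounds.
  have hiter : ∀ (n : ℕ) (h : CRP x p (p / 2) V),
      LocBd x δ μ (supConst x p (p / 2) * ‖h‖ / 2 ^ n) ((B ^ n) h).1 := fun n h => by
    induction n with
    | zero => simpa using h.locBd hσ hδ hμ hμ1
    | succ n ih =>
      have e : (B ^ (n + 1)) h = intL x V W hσ (mulL x V (W →L[ℝ] V) hσ A ((B ^ n) h)) z := by
        rw [pow_succ', ← hB]
        rfl
      rw [e, pow_succ (2 : ℝ), ← div_div]
      exact hhalf δ hδ hv A z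
        (fun a b _ _ => ((A.ivBd_integrand hσ).mono le_rfl le_rfl
          (le_mul_of_one_le_left (norm_nonneg A) (one_le_supConst x _ _))).restrict
            (t0_le a) (le_tT b))
        (fun a b _ _ => (z.ivBd_self hσ).restrict (t0_le a) (le_tT b)) _ _ (by positivity) ih
  obtain ⟨n, hn⟩ := pow_unbounded_of_one_lt (C * supConst x p (p / 2)) one_lt_two
  have hlt : ‖B ^ n‖ < 1 := by
    refine lt_of_le_of_lt (ContinuousLinearMap.opNorm_le_bound _
      (M := C * supConst x p (p / 2) / 2 ^ n) (by positivity) fun h => ?_)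
      ((div_lt_one (by positivity)).2 hn)
    refine (hnorm _ _ (by positivity) (hiter n h)).trans_eq ?_
    ring
  have := CRP.completeSpace (x := x) (E := V) hσ.p_pos.le hσ.p_pos.le
    (by linarith [hσ.p_pos] : 0 ≤ p / 2)
  have hu : IsUnit (1 - B ^ n) := isUnit_one_sub_of_norm_lt_one hlt
  -- A unit 1 - B^n that is a product of the commuting factors 1 - B and the geometric sum has both
  -- factors as units.
  rw [← mul_neg_geom_sum] at hu
  have hcomm : Commute (1 - B) (∑ i ∈ Finset.range n, B ^ i) :=
    Commute.sum_right _ _ _ fun i _ =>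
      (Commute.one_left _).sub_left ((Commute.refl B).pow_right i)
  exact (hcomm.isUnit_mul_iff.1 hu).1

/-- The mean value inequality for local bounds. -/
lemma IvBd.of_deriv (hσ : Expo p σ) {g g' : ℝ → CRP x p (p / 2) V} {a b : Time T}
    {m0 m1 m2 : ℝ} (hg : ∀ τ ∈ Set.Icc (0 : ℝ) 1, HasDerivAt g (g' τ) τ)
    (hI : ∀ τ ∈ Set.Icc (0 : ℝ) 1, IvBd x p (p / 2) (g' τ).1 a b m0 m1 m2) :
    IvBd x p (p / 2) (g 1 - g 0).1 a b m0 m1 m2 := by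
  have hp := hσ.p_pos.le
  have hp2 : 0 ≤ p / 2 := by positivity
  have h1 : ∀ t, ∀ τ ∈ Set.Icc (0 : ℝ) 1, HasDerivAt (fun τ => (g τ).path t) ((g' τ).path t) τ :=
    fun t τ hτ => (pathL x p (p / 2) V hp hp hp2 t).hasFDerivAt.comp_hasDerivAt τ (hg τ hτ)
  have h2 : ∀ t, ∀ τ ∈ Set.Icc (0 : ℝ) 1, HasDerivAt (fun τ => (g τ).dag t) ((g' τ).dag t) τ :=
    fun t τ hτ => (dagL x p (p / 2) V hp hp hp2 t).hasFDerivAt.comp_hasDerivAt τ (hg τ hτ)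
  have hI' : ∀ τ ∈ Set.Ico (0 : ℝ) 1, τ ∈ Set.Icc (0 : ℝ) 1 := fun τ h => ⟨h.1, h.2.le⟩
  refine ⟨fun t h h' => ?_, fun t h h' => ?_, fun s t h h' h'' => ?_, fun s t h h' h'' => ?_⟩
  · exact norm_image_sub_le_of_norm_deriv_le_segment_01'
      (fun τ hτ => (h1 t τ hτ).hasDerivWithinAt)
      fun τ hτ => (hI τ (hI' τ hτ)).path t h h'
  · exact norm_image_sub_le_of_norm_deriv_le_segment_01'
      (fun τ hτ => (h2 t τ hτ).hasDerivWithinAt)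
      fun τ hτ => (hI τ (hI' τ hτ)).dag t h h'
  · have := norm_image_sub_le_of_norm_deriv_le_segment_01'
      (fun τ hτ => ((h2 t τ hτ).sub (h2 s τ hτ)).hasDerivWithinAt)
      fun τ hτ => (hI τ (hI' τ hτ)).var s t h h' h''
    refine le_trans (le_of_eq ?_) this
    change ‖(g 1 - g 0).dag t - (g 1 - g 0).dag s‖ = _
    rw [CRP.dag_sub, CRP.dag_sub]
    congr 1
    simp only [Pi.sub_apply]
    abel
  · have := norm_image_sub_le_of_norm_deriv_le_segment_01'
      (fun τ hτ => (((h1 t τ hτ).sub (h1 s τ hτ)).sub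
        ((h2 s τ hτ).clm_apply (hasDerivAt_const τ (x.inc1 s t)))).hasDerivWithinAt)
      (C := m2 * ω s t ^ (1 / (p / 2))) fun τ hτ => by
        rw [map_zero, add_zero]
        exact (hI τ (hI' τ hτ)).rem s t h h' h''
    change ‖(g 1 - g 0).sharp s t‖ ≤ _
    rw [CRP.sharp_sub]
    exact this

end Local

/-! ### The fixed point equation -/

section FixedPoint

variable {T : ℝ} [Fact (0 < T)] {ω : Control T} {p κ γ : ℝ}
variable {U V W : Type*} [NormedAddCommGroup U] [NormedSpace ℝ U]
  [NormedAddCommGroup V] [NormedSpace ℝ V] [CompleteSpace V]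
  [NormedAddCommGroup W] [NormedSpace ℝ W]
variable {x : RoughPath ω p U} {m : ℕ}

/-- The path of a driver, started from zero. -/
def startZero (hσ : Expo p (κ * γ)) : CRP x p (p / 2) W →L[ℝ] CRP x p (p / 2) W :=
  ContinuousLinearMap.id ℝ _ - (constL x p (p / 2) W).comp
    (pathL x p (p / 2) W hσ.p_pos.le hσ.p_pos.le (half_pos hσ.p_pos).le t0)

/-- The integral `∫ f(y) dz`. -/
def driftMap (he : HolderExpo p κ γ) (f : HolderSpace V (W →L[ℝ] V) (m + 1 + 1) γ)
    (z : CRP x p (p / 2) W) (y : CRP x p (p / 2) V) : CRP x p (p / 2) V :=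
  intL x V W he.expo (omegaL (m + 1) he (W →L[ℝ] V) y f) z

/-- The right-hand side of the differential equation. -/
def picardMap (he : HolderExpo p κ γ) (m : ℕ)
    (q : (V × (W →L[ℝ] V) × HolderSpace V (W →L[ℝ] V) (m + 1 + 1) γ × CRP x p (p / 2) W) ×
      CRP x p (p / 2) V) : CRP x p (p / 2) V :=
  constL x p (p / 2) V q.1.1 + driftMap he q.1.2.2.1 q.1.2.2.2 q.2 +
    compL x W V he.expo q.1.2.1 (startZero he.expo q.1.2.2.2)

lemma picardMap_apply (he : HolderExpo p κ γ)
    (θ : V × (W →L[ℝ] V) × HolderSpace V (W →L[ℝ] V) (m + 1 + 1) γ × CRP x p (p / 2) W)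
    (y : CRP x p (p / 2) V) : picardMap he m (θ, y) =
      constL x p (p / 2) V θ.1 + driftMap he θ.2.2.1 θ.2.2.2 y +
        compL x W V he.expo θ.2.1 (startZero he.expo θ.2.2.2) := rfl

lemma picardMap_path (he : HolderExpo p κ γ) (a : V) (b : W →L[ℝ] V)
    (f : HolderSpace V (W →L[ℝ] V) (m + 1 + 1) γ) (z : CRP x p (p / 2) W)
    (y : CRP x p (p / 2) V) (t : Time T) :
    (picardMap he m ((a, b, f, z), y)).path t =
      a + integral he.expo (omegaL (m + 1) he (W →L[ℝ] V) y f) z t +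
        b (z.path t - z.path t0) := rfl

lemma picardMap_dag (he : HolderExpo p κ γ) (a : V) (b : W →L[ℝ] V)
    (f : HolderSpace V (W →L[ℝ] V) (m + 1 + 1) γ) (z : CRP x p (p / 2) W)
    (y : CRP x p (p / 2) V) (t : Time T) :
    (picardMap he m ((a, b, f, z), y)).dag t =
      (f.1 (y.path t)).comp (z.dag t) + b.comp (z.dag t) := by
  change 0 + (f.1 (y.path t)).comp (z.dag t) + b.comp (z.dag t - 0) = _
  rw [zero_add, sub_zero]

/-- The right-hand side produces both the path and its prescribed derivative, so equality of
controlled rough paths encodes both equations, with uniqueness of the integral identifying J. -/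
lemma solves_iff (he : HolderExpo p κ γ) (a : V) (b : W →L[ℝ] V)
    (f : HolderSpace V (W →L[ℝ] V) (m + 1 + 1) γ) (z : CRP x p (p / 2) W)
    (y : CRP x p (p / 2) V) : Solves a b f z y ↔ picardMap he m ((a, b, f, z), y) = y := by
  have hI := isIntegral_iff he.expo (omegaL (m + 1) he (W →L[ℝ] V) y f) z
  constructor
  · rintro ⟨⟨J, hJ, hy⟩, hd⟩
    refine CRP.ext (fun t => ?_) fun t => ?_
    · rw [picardMap_path, hy, (hI J).1 hJ]
    · rw [picardMap_dag, hd]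
  · intro h
    refine ⟨⟨_, (hI _).2 rfl, fun t => ?_⟩, fun t => ?_⟩
    · rw [← picardMap_path, h]
    · rw [← picardMap_dag he a b f z y t, h]

/-- The derivative of `y ↦ ∫ f(y) dz`. -/
def driftDeriv (he : HolderExpo p κ γ) (f : HolderSpace V (W →L[ℝ] V) (m + 1 + 1) γ)
    (z : CRP x p (p / 2) W) (y : CRP x p (p / 2) V) :
    CRP x p (p / 2) V →L[ℝ] CRP x p (p / 2) V :=
  ((intL x V W he.expo).flip z).comp (mulL x V (W →L[ℝ] V) he.expo
    (omegaL m he (V →L[ℝ] W →L[ℝ] V) y (derivL V (W →L[ℝ] V) (m + 1) γ f)))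

lemma driftDeriv_apply (he : HolderExpo p κ γ)
    (f : HolderSpace V (W →L[ℝ] V) (m + 1 + 1) γ) (z : CRP x p (p / 2) W)
    (y h : CRP x p (p / 2) V) : driftDeriv he f z y h =
      intL x V W he.expo (mulL x V (W →L[ℝ] V) he.expo
        (omegaL m he (V →L[ℝ] W →L[ℝ] V) y (derivL V (W →L[ℝ] V) (m + 1) γ f)) h) z := rfl

lemma hasFDerivAt_driftMap (he : HolderExpo p κ γ)
    (f : HolderSpace V (W →L[ℝ] V) (m + 1 + 1) γ) (z : CRP x p (p / 2) W)
    (y : CRP x p (p / 2) V) : HasFDerivAt (driftMap he f z) (driftDeriv he f z y) y := by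
  have h1 := hasFDerivAt_omegaL (n := m) (E := W →L[ℝ] V) he y
  have h2 := ((intL x V W he.expo).flip z).hasFDerivAt.comp y
    (h1.clm_apply (hasFDerivAt_const f y))
  refine h2.congr_fderiv ?_
  ext1 h
  simp [driftDeriv, thetaL_apply]

/-- On paths with fixed local bounds, the integral halves the local bounds of differences. -/
theorem exists_contraction (he : HolderExpo p κ γ)
    (f : HolderSpace V (W →L[ℝ] V) (m + 1 + 1) γ) (z : CRP x p (p / 2) W) {R : ℝ} (hR : 0 ≤ R) :
    ∃ μ > 0, μ ≤ 1 ∧ ∃ ε > 0, ∀ δ > 0,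
      (∀ s t : Time T, s ≤ t → (t : ℝ) - s ≤ δ → ω.v p (κ * γ) s t ≤ ε) →
      ∀ y y' : CRP x p (p / 2) V,
      (∀ a b : Time T, a ≤ b → (b : ℝ) - a ≤ δ → ∃ m0, IvBd x p (p / 2) y.1 a b m0 R R) →
      (∀ a b : Time T, a ≤ b → (b : ℝ) - a ≤ δ → ∃ m0, IvBd x p (p / 2) y'.1 a b m0 R R) →
      ∀ K, 0 ≤ K → LocBd x δ μ K (y - y').1 →
        LocBd x δ μ (K / 2) (driftMap he f z y - driftMap he f z y').1 := by
  have hS := zero_le_one.trans (one_le_supConst x p (p / 2))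
  set Df := derivL V (W →L[ℝ] V) (m + 1) γ f with hDf
  have hF := norm_nonneg Df
  have hG := omegaConst_nonneg (x := x) (σ := κ * γ) hR
  -- The second bound dominates all three local bounds of Df along any path whose derivative and
  -- variations are bounded by R.
  obtain ⟨μ, hμ, hμ1, ε, hε, hhalf⟩ := exists_halving (V := V) (W := W) he.expo x
    (mul_nonneg hS (norm_nonneg z))
    (by positivity : 0 ≤ 2 * ‖Df‖ * (1 + R + omegaConst x (κ * γ) R))
  refine ⟨μ, hμ, hμ1, ε, hε, fun δ hδ hv y y' hy hy' K hK hh => ?_⟩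
  intro a b hab hd
  -- The nonlinear difference reduces to the linear halving estimate: at each point of the segment
  -- from y' to y, the derivative in the direction y - y' is an integral of a product with that
  -- direction.
  have key := IvBd.of_deriv (g := fun τ : ℝ => driftMap he f z (y' + τ • (y - y')))
    (g' := fun τ : ℝ => driftDeriv he f z (y' + τ • (y - y')) (y - y')) he.expo
    (fun τ _ => (hasFDerivAt_driftMap he f z _).comp_hasDerivAt τ
      (hasDerivAt_line y' (y - y') τ))
    fun τ hτ => hhalf δ hδ hv (omegaL m he (V →L[ℝ] W →L[ℝ] V) (y' + τ • (y - y')) Df) z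
      (fun a b hab hd => by
        obtain ⟨m0, h1⟩ := hy a b hab hd
        obtain ⟨m0', h1'⟩ := hy' a b hab hd
        -- The bounds are convex, so the whole segment satisfies them with the same R.
        have h2 := (h1'.smul (1 - τ)).add (h1.smul τ)
        have e : (1 - τ) • y'.1 + τ • y.1 = (y' + τ • (y - y')).1 := by
          rw [CRP.val_add, CRP.val_smul, CRP.val_sub]
          module
        rw [e, abs_of_nonneg hτ.1, abs_of_nonneg (sub_nonneg.2 hτ.2), ← add_mul, sub_add_cancel,
          one_mul] at h2
        refine (omega_ivBd he (Df.c1Holder he.γ_pos.le he.γ_le) hR h2).mono ?_ ?_ ?_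
        · exact le_mul_of_one_le_right (by positivity) (by linarith)
        · exact mul_le_mul_of_nonneg_left (by linarith) (by positivity)
        · exact mul_le_mul_of_nonneg_left (by linarith) (by positivity))
      (fun a b _ _ => (z.ivBd_self he.expo).restrict (t0_le a) (le_tT b)) _ K hK hh a b hab hd
  rw [one_smul, zero_smul, add_zero, add_sub_cancel] at key
  exact key

lemma picardMap_sub (he : HolderExpo p κ γ) (a : V) (b : W →L[ℝ] V)
    (f : HolderSpace V (W →L[ℝ] V) (m + 1 + 1) γ) (z : CRP x p (p / 2) W)
    (y y' : CRP x p (p / 2) V) :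
    picardMap he m ((a, b, f, z), y) - picardMap he m ((a, b, f, z), y') =
      driftMap he f z y - driftMap he f z y' := by
  simp only [picardMap]
  abel

/-- The constants may depend on the two given solutions, so R is taken from their norms. The local
bound of their difference is then halved indefinitely. -/
theorem picardMap_unique (he : HolderExpo p κ γ) (a : V) (b : W →L[ℝ] V)
    (f : HolderSpace V (W →L[ℝ] V) (m + 1 + 1) γ) (z : CRP x p (p / 2) W)
    {y y' : CRP x p (p / 2) V} (hy : picardMap he m ((a, b, f, z), y) = y)
    (hy' : picardMap he m ((a, b, f, z), y') = y') : y = y' := by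
  have hS := zero_le_one.trans (one_le_supConst x p (p / 2))
  set S := supConst x p (p / 2) with hSdef
  have hR : 0 ≤ S * (‖y‖ + ‖y'‖) := by positivity
  obtain ⟨μ, hμ, hμ1, ε, hε, hc⟩ := exists_contraction he f z hR
  obtain ⟨δ, hδ, hv⟩ := ω.exists_v_le he.expo hε
  obtain ⟨C, hC, hnorm⟩ := LocBd.norm_le (V := V) he.expo hδ hμ x
  have hb : S * ‖y‖ ≤ S * (‖y‖ + ‖y'‖) :=
    mul_le_mul_of_nonneg_left (le_add_of_nonneg_right (norm_nonneg _)) hS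
  have hb' : S * ‖y'‖ ≤ S * (‖y‖ + ‖y'‖) :=
    mul_le_mul_of_nonneg_left (le_add_of_nonneg_left (norm_nonneg _)) hS
  have hiter : ∀ n : ℕ, LocBd x δ μ (S * ‖y - y'‖ / 2 ^ n) (y - y').1 := fun n => by
    induction n with
    | zero => simpa using (y - y').locBd he.expo hδ hμ hμ1
    | succ n ih =>
      have h1 := hc δ hδ hv y y'
        (fun a b _ _ => ⟨_, ((y.ivBd_self he.expo).mono le_rfl hb hb).restrict
          (t0_le a) (le_tT b)⟩)
        (fun a b _ _ => ⟨_, ((y'.ivBd_self he.expo).mono le_rfl hb' hb').restrict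
          (t0_le a) (le_tT b)⟩) _ (by positivity) ih
      rw [← picardMap_sub he a b f z, hy, hy', div_div, ← pow_succ] at h1
      exact h1
  refine sub_eq_zero.1 (norm_le_zero_iff.1 ?_)
  have hlim : Filter.Tendsto (fun n : ℕ => C * (S * ‖y - y'‖) * (1 / 2) ^ n) Filter.atTop
      (𝓝 (C * (S * ‖y - y'‖) * 0)) :=
    (tendsto_pow_atTop_nhds_zero_of_lt_one (by norm_num) (by norm_num)).const_mul _
  rw [mul_zero] at hlim
  refine ge_of_tendsto' hlim fun n => (hnorm _ _ (by positivity) (hiter n)).trans_eq ?_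
  rw [one_div, inv_pow]
  ring

/-- The right-hand side of the equation preserves suitable local bounds. -/
lemma exists_invariant (he : HolderExpo p κ γ) (a : V) (b : W →L[ℝ] V)
    (f : HolderSpace V (W →L[ℝ] V) (m + 1 + 1) γ) (z : CRP x p (p / 2) W) :
    ∃ R1 R2, 0 ≤ R1 ∧ 0 ≤ R2 ∧ ∃ ε > 0, ∀ c d : Time T, c ≤ d → ω.v p (κ * γ) c d ≤ ε →
      ∀ (y : CRP x p (p / 2) V) (m0 : ℝ), IvBd x p (p / 2) y.1 c d m0 R1 R2 →
        ∃ m0', IvBd x p (p / 2) (picardMap he m ((a, b, f, z), y)).1 c d m0' R1 R2 := by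
  have hM := mul_nonneg (zero_le_one.trans (one_le_supConst x p (p / 2))) (norm_nonneg z)
  have hC := (intBd_pos (x := x) he.expo).le
  have hf := f.c1Holder he.γ_pos.le he.γ_le
  have hz0 := z.ivBd_self he.expo
  set M := supConst x p (p / 2) * ‖z‖
  set F := 2 * ‖f‖ with hFdef
  have hF : 0 ≤ F := by positivity
  -- The derivative of the image is bounded through f, b and z alone, which fixes R1. Then R2 is
  -- determined by R1; its summand 1 pays for the variation of f(y), which depends on R2 itself but
  -- is multiplied by a small power of ω.
  obtain ⟨R1, hR1⟩ : ∃ R1, R1 = F * M + ‖b‖ * M := ⟨_, rfl⟩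
  have hR1' : 0 ≤ R1 := by rw [hR1]; positivity
  obtain ⟨R2, hR2⟩ : ∃ R2, R2 = M * intBd x (κ * γ) * (F + F * R1 + 1) + ‖b‖ * M := ⟨_, rfl⟩
  have hR2' : 0 ≤ R2 := by rw [hR2]; positivity
  have hG := omegaConst_nonneg (x := x) (σ := κ * γ) (add_nonneg hR1' hR2')
  set G := omegaConst x (κ * γ) (R1 + R2)
  refine ⟨R1, R2, hR1', hR2', 1 / (F * G + 1), by positivity, fun c d hcd hv y m0 hy => ?_⟩
  have hv0 := ω.v_nonneg (p := p) (σ := κ * γ) hcd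
  have hvG : ω.v p (κ * γ) c d * (F * G) ≤ 1 := by
    calc _ ≤ 1 / (F * G + 1) * (F * G) := by gcongr
      _ ≤ 1 := by
        rw [one_div_mul_eq_div]
        exact (div_le_one (by positivity)).2 (by linarith)
  have h1 := omega_ivBd he hf (add_nonneg hR1' hR2')
    (hy.mono le_rfl (le_add_of_nonneg_right hR2') (le_add_of_nonneg_left hR1'))
  -- The general estimate bounds the derivative of f(y) by F(R1 + R2). The sharper F R1 is needed,
  -- since otherwise R2 would appear in its own definition without a small factor.
  have h1' : IvBd x (p / (κ * γ)) (p / (1 + κ * γ)) (omegaL (m + 1) he (W →L[ℝ] V) y f).1 c d F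
      (F * R1) (F * G) :=
    ⟨h1.path, fun t ht ht' => (ContinuousLinearMap.opNorm_comp_le _ _).trans
      (mul_le_mul (hf.bound_fderiv _) (hy.dag t ht ht') (norm_nonneg _) hF), h1.var, h1.rem⟩
  have h2 := intPair_ivBd he.expo hcd hM (by positivity) h1'
    (hz0.restrict (t0_le c) (le_tT d))
  have h3 := (const_ivBd x p (p / 2) a).restrict (t0_le c) (le_tT d)
  have h4 := ((hz0.add ((const_ivBd x p (p / 2) (z.path t0)).smul (-1))).comp b).restrict
    (t0_le c) (le_tT d)
  have h5 := (h3.add h2).add h4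
  have e : (picardMap he m ((a, b, f, z), y)).1 =
      ((fun _ => a, fun _ => (0 : U →L[ℝ] V)) +
        intPair he.expo (omegaL (m + 1) he (W →L[ℝ] V) y f) z) +
      compPair b (z.1 + (-1 : ℝ) • (fun _ => z.path t0, fun _ => (0 : U →L[ℝ] W))) := by
    rw [neg_one_smul, ← sub_eq_add_neg]
    rfl
  rw [e]
  refine ⟨_, h5.mono le_rfl ?_ ?_⟩
  · rw [hR1]
    simp
  · rw [hR2, mul_zero, add_zero, zero_add]
    gcongr

theorem continuous_picardMap (he : HolderExpo p κ γ) (a : V) (b : W →L[ℝ] V)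
    (f : HolderSpace V (W →L[ℝ] V) (m + 1 + 1) γ) (z : CRP x p (p / 2) W) :
    Continuous fun y => picardMap he m ((a, b, f, z), y) := by
  simp only [picardMap_apply]
  have : Continuous (driftMap he f z) :=
    continuous_iff_continuousAt.2 fun y => (hasFDerivAt_driftMap he f z y).continuousAt
  fun_prop

/-- Picard iteration from the constant path a, which trivially satisfies the invariant local bounds.
All iterates keep these bounds, so consecutive differences are halved locally and the sequence is
Cauchy in norm over the whole of [0, T] at once; no solutions on short intervals are glued. -/
theorem exists_picardMap_eq (he : HolderExpo p κ γ) (a : V) (b : W →L[ℝ] V)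
    (f : HolderSpace V (W →L[ℝ] V) (m + 1 + 1) γ) (z : CRP x p (p / 2) W) :
    ∃ y, picardMap he m ((a, b, f, z), y) = y := by
  have hp := he.expo.p_pos
  have hS := zero_le_one.trans (one_le_supConst x p (p / 2))
  obtain ⟨R1, R2, hR1, hR2, ε', hε', hinv⟩ := exists_invariant he a b f z
  obtain ⟨μ, hμ, hμ1, ε, hε, hc⟩ := exists_contraction he f z (add_nonneg hR1 hR2)
  -- One interval length serves both for the invariance of the bounds and for the contraction.
  obtain ⟨δ, hδ, hv⟩ := ω.exists_v_le he.expo (lt_min hε hε')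
  obtain ⟨C, hC, hnorm⟩ := LocBd.norm_le (V := V) he.expo hδ hμ x
  set Ψ : CRP x p (p / 2) V → CRP x p (p / 2) V := fun y => picardMap he m ((a, b, f, z), y)
    with hΨ
  set y0 : CRP x p (p / 2) V := constL x p (p / 2) V a
  have hball : ∀ n : ℕ, ∀ c d : Time T, c ≤ d → (d : ℝ) - c ≤ δ →
      ∃ m0, IvBd x p (p / 2) (Ψ^[n] y0).1 c d m0 R1 R2 := fun n c d hcd hd => by
    induction n with
    | zero => exact ⟨_, ((const_ivBd x p (p / 2) a).mono le_rfl hR1 hR2).restrict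
        (t0_le c) (le_tT d)⟩
    | succ n ih =>
      obtain ⟨m0, h⟩ := ih
      rw [Function.iterate_succ_apply']
      exact hinv c d hcd ((hv c d hcd hd).trans (min_le_right _ _)) _ m0 h
  have hball' : ∀ n : ℕ, ∀ c d : Time T, c ≤ d → (d : ℝ) - c ≤ δ →
      ∃ m0, IvBd x p (p / 2) (Ψ^[n] y0).1 c d m0 (R1 + R2) (R1 + R2) := fun n c d hcd hd => by
    obtain ⟨m0, h⟩ := hball n c d hcd hd
    exact ⟨m0, h.mono le_rfl (le_add_of_nonneg_right hR2) (le_add_of_nonneg_left hR1)⟩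
  set K := supConst x p (p / 2) * ‖Ψ y0 - y0‖
  have hK : 0 ≤ K := by positivity
  have hdiff : ∀ n : ℕ, LocBd x δ μ (K / 2 ^ n) (Ψ^[n + 1] y0 - Ψ^[n] y0).1 := fun n => by
    induction n with
    | zero => simpa using (Ψ y0 - y0).locBd he.expo hδ hμ hμ1
    | succ n ih =>
      have h1 := hc δ hδ (fun s t hst hd => (hv s t hst hd).trans (min_le_left _ _)) _ _
        (hball' (n + 1)) (hball' n) _ (by positivity) ih
      rw [← picardMap_sub he a b f z, div_div, ← pow_succ] at h1
      rw [Function.iterate_succ_apply' _ (n + 1), Function.iterate_succ_apply' _ n]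
      rw [Function.iterate_succ_apply' _ n] at h1
      exact h1
  have hcauchy : CauchySeq fun n : ℕ => Ψ^[n] y0 :=
    cauchySeq_of_le_geometric (1 / 2) (C * K) (by norm_num) fun n => by
      rw [dist_comm, dist_eq_norm]
      refine (hnorm _ _ (by positivity) (hdiff n)).trans_eq ?_
      rw [one_div, inv_pow]
      ring
  have := CRP.completeSpace (x := x) (E := V) hp.le hp.le (half_pos hp).le
  obtain ⟨y, hy⟩ := cauchySeq_tendsto_of_complete hcauchy
  exact ⟨y, isFixedPt_of_tendsto_iterate hy (continuous_picardMap he a b f z).continuousAt⟩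

end FixedPoint

/-! ### Regularity of the right-hand side and of the solution map -/

section Regularity

universe u v w

variable {T : ℝ} [Fact (0 < T)] {ω : Control T} {p κ γ : ℝ}
variable {U : Type u} {V : Type v} {W : Type w} [NormedAddCommGroup U] [NormedSpace ℝ U]
  [NormedAddCommGroup V] [NormedSpace ℝ V] [CompleteSpace V]
  [NormedAddCommGroup W] [NormedSpace ℝ W]
variable {x : RoughPath ω p U} {m : ℕ}

/-- The right-hand side is a smooth map of the data and of the composition operator at y, so the
composition operator is the only source of limited regularity. -/
lemma ckHolderAt_picardMap (he : HolderExpo p κ γ)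
    (q : (V × (W →L[ℝ] V) × HolderSpace V (W →L[ℝ] V) (m + 1 + 1) γ × CRP x p (p / 2) W) ×
      CRP x p (p / 2) V) : CkHolderAt (m + 1) ((1 - κ) * γ) (picardMap he m) q := by
  have hβ0 : 0 ≤ (1 - κ) * γ := mul_nonneg (sub_nonneg.2 he.κ_lt.le) he.γ_pos.le
  have hβ1 : (1 - κ) * γ ≤ 1 :=
    mul_le_one₀ (by linarith [he.κ_pos]) he.γ_pos.le he.γ_le
  let X := V × (W →L[ℝ] V) × HolderSpace V (W →L[ℝ] V) (m + 1 + 1) γ × CRP x p (p / 2) W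
  let P := CRP x p (p / 2) V
  let L := HolderSpace V (W →L[ℝ] V) (m + 1 + 1) γ →L[ℝ]
    CRP x (p / (κ * γ)) (p / (1 + κ * γ)) (W →L[ℝ] V)
  -- The operator f ↦ f(y) is made an independent variable. Then G is a sum of bounded multilinear
  -- expressions, hence smooth, also jointly in f.
  let G : X × L → P := fun r => constL x p (p / 2) V r.1.1 +
    intL x V W he.expo (r.2 r.1.2.2.1) r.1.2.2.2 +
    compL x W V he.expo r.1.2.1 (startZero he.expo r.1.2.2.2)
  have c1 : ContDiff ℝ ⊤ fun r : X × L => r.1.1 := contDiff_fst.comp contDiff_fst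
  have c2 : ContDiff ℝ ⊤ fun r : X × L => r.1.2.1 :=
    contDiff_fst.comp (contDiff_snd.comp contDiff_fst)
  have c3 : ContDiff ℝ ⊤ fun r : X × L => r.1.2.2.1 :=
    contDiff_fst.comp (contDiff_snd.comp (contDiff_snd.comp contDiff_fst))
  have c4 : ContDiff ℝ ⊤ fun r : X × L => r.1.2.2.2 :=
    contDiff_snd.comp (contDiff_snd.comp (contDiff_snd.comp contDiff_fst))
  have hG : ContDiff ℝ ⊤ G :=
    (((constL x p (p / 2) V).contDiff.comp c1).add
      (((intL x V W he.expo).contDiff.comp (contDiff_snd.clm_apply c3)).clm_apply c4)).add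
      (((compL x W V he.expo).contDiff.comp c2).clm_apply
        ((startZero he.expo).contDiff.comp c4))
  have hO : CkHolderAt (m + 1) ((1 - κ) * γ)
      (fun r : X × P => omegaL (m + 1) he (W →L[ℝ] V) r.2) q :=
    CkHolderAt.comp (g := omegaL (m + 1) he (W →L[ℝ] V)) (f := Prod.snd) hβ0 hβ1
      (ckHolderAt_omegaL.{u, v, max v w} he (m + 1) (W →L[ℝ] V) q.2)
      (.of_contDiffAt hβ1 contDiff_snd.contDiffAt) (Or.inr contDiff_snd.contDiffAt)
  have hp : CkHolderAt (m + 1) ((1 - κ) * γ)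
      (fun r : X × P => (r.1, omegaL (m + 1) he (W →L[ℝ] V) r.2)) q :=
    CkHolderAt.prodMk (.of_contDiffAt hβ1 contDiff_fst.contDiffAt) hO
  exact CkHolderAt.comp (g := G) hβ0 hβ1
    (.of_contDiffAt hβ1 (hG.contDiffAt.of_le le_top)) hp (Or.inl (hG.contDiffAt.of_le le_top))

lemma fderiv_comp_inr {X P Q : Type*} [NormedAddCommGroup X] [NormedSpace ℝ X]
    [NormedAddCommGroup P] [NormedSpace ℝ P] [NormedAddCommGroup Q] [NormedSpace ℝ Q]
    {Ψ : X × P → Q} {θ : X} {y : P} (h : DifferentiableAt ℝ Ψ (θ, y)) {L : P →L[ℝ] Q}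
    (hL : HasFDerivAt (fun y => Ψ (θ, y)) L y) : (fderiv ℝ Ψ (θ, y)).comp (.inr ℝ X P) = L :=
  (h.hasFDerivAt.comp y (hasFDerivAt_prodMk_right θ y)).unique hL

lemma hasFDerivAt_picardMap_right (he : HolderExpo p κ γ)
    (θ : V × (W →L[ℝ] V) × HolderSpace V (W →L[ℝ] V) (m + 1 + 1) γ × CRP x p (p / 2) W)
    (y : CRP x p (p / 2) V) :
    HasFDerivAt (fun y => picardMap he m (θ, y)) (driftDeriv he θ.2.2.1 θ.2.2.2 y) y := by
  simp only [picardMap_apply]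
  exact (hasFDerivAt_add_const_iff _).2 ((hasFDerivAt_const_add_iff _).2
    (hasFDerivAt_driftMap he θ.2.2.1 θ.2.2.2 y))

/-- The partial derivative in y is the Volterra operator h ↦ ∫ (Df(y) h) dz. Invertibility holds at
every pair of data and path, not only at solutions. -/
lemma isUnit_picardMap (he : HolderExpo p κ γ)
    (θ : V × (W →L[ℝ] V) × HolderSpace V (W →L[ℝ] V) (m + 1 + 1) γ × CRP x p (p / 2) W)
    (y : CRP x p (p / 2) V) :
    IsUnit (1 - (fderiv ℝ (picardMap he m) (θ, y)).comp
      (.inr ℝ (V × (W →L[ℝ] V) × HolderSpace V (W →L[ℝ] V) (m + 1 + 1) γ × CRP x p (p / 2) W)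
        (CRP x p (p / 2) V))) := by
  have h1 : DifferentiableAt ℝ (picardMap he m) (θ, y) :=
    (ckHolderAt_picardMap he (θ, y)).1.differentiableAt (by simp)
  rw [fderiv_comp_inr h1 (hasFDerivAt_picardMap_right he θ y)]
  exact isUnit_one_sub_integral he.expo _ θ.2.2.2 _
    (driftDeriv_apply he θ.2.2.1 θ.2.2.2 y)

end Regularity

/-- The equation has a unique solution, which is a locally Hölder differentiable function of
the data. -/
theorem exists_itoMap
    {U V W : Type*} [NormedAddCommGroup U] [NormedSpace ℝ U]
    [NormedAddCommGroup V] [NormedSpace ℝ V] [CompleteSpace V]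
    [NormedAddCommGroup W] [NormedSpace ℝ W]
    {T : ℝ} [Fact (0 < T)] {ω : Control T}
    {p : ℝ} (hp : 2 ≤ p) (x : RoughPath ω p U)
    {k : ℕ} (hk : 1 ≤ k) {γ : ℝ} (hγ : 0 < γ) (hγ' : γ ≤ 1)
    {κ : ℝ} (hκ : 0 < κ) (hκ' : κ < 1) (hpκ : p < 2 + κ * γ) :
    ∃ I : V × (W →L[ℝ] V) × HolderSpace V (W →L[ℝ] V) (k + 1) γ ×
        CRP x p (p / 2) W → CRP x p (p / 2) V,
      (∀ (a : V) (b : W →L[ℝ] V) (f : HolderSpace V (W →L[ℝ] V) (k + 1) γ)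
        (z : CRP x p (p / 2) W) (y : CRP x p (p / 2) V),
        Solves a b f z y ↔ y = I (a, b, f, z)) ∧
      LocallyOfClass k ((1 - κ) * γ) I := by
  obtain ⟨m, rfl⟩ := Nat.exists_eq_add_of_le' hk
  have he : HolderExpo p κ γ := ⟨hp, hκ, hκ', hγ, hγ', hpκ⟩
  have hβ0 : 0 ≤ (1 - κ) * γ := mul_nonneg (sub_nonneg.2 hκ'.le) hγ.le
  have hβ1 : (1 - κ) * γ ≤ 1 := mul_le_one₀ (by linarith) hγ.le hγ'
  -- The choice is harmless: by uniqueness I θ is the only fixed point in the whole space, and this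
  -- global form is what the regularity theorem for fixed points requires.
  choose I hI using fun θ : V × (W →L[ℝ] V) × HolderSpace V (W →L[ℝ] V) (m + 1 + 1) γ ×
    CRP x p (p / 2) W => exists_picardMap_eq he θ.1 θ.2.1 θ.2.2.1 θ.2.2.2
  have hiff : ∀ θ y, picardMap he m (θ, y) = y ↔ y = I θ := fun θ y =>
    ⟨fun h => picardMap_unique he θ.1 θ.2.1 θ.2.2.1 θ.2.2.2 h (hI θ), fun h => h ▸ hI θ⟩
  have := CRP.completeSpace (x := x) (E := V) he.expo.p_pos.le he.expo.p_pos.le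
    (half_pos he.expo.p_pos).le
  exact ⟨I, fun a b f z y => (solves_iff he a b f z y).trans (hiff _ y),
    LocallyOfClass.of_ckHolderAt fun θ => CkHolderAt.fixedPoint hβ0 hβ1 hiff
      (fun q => ckHolderAt_picardMap he q) (fun θ => isUnit_picardMap he θ (I θ)) θ⟩

end RoughIto

end

theorem mainTheorem1
    {U V W : Type*} [NormedAddCommGroup U] [NormedSpace ℝ U] [CompleteSpace U]
    [NormedAddCommGroup V] [NormedSpace ℝ V] [CompleteSpace V]
    [NormedAddCommGroup W] [NormedSpace ℝ W] [CompleteSpace W]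
    {T : ℝ} [Fact (0 < T)] (ω : RoughIto.Control T)
    (p : ℝ) (hp : 2 ≤ p) (hp' : p < 3) (x : RoughIto.RoughPath ω p U)
    (k : ℕ) (hk : 1 ≤ k) (γ : ℝ) (hγ : 0 < γ) (hγ' : γ ≤ 1)
    (κ : ℝ) (hκ : 0 < κ) (hκ' : κ < 1) (hpκ : p < 2 + κ * γ) :
    ∃ I : V × (W →L[ℝ] V) × RoughIto.HolderSpace V (W →L[ℝ] V) (k + 1) γ ×
        RoughIto.CRP x p (p / 2) W → RoughIto.CRP x p (p / 2) V,
      (∀ (a : V) (b : W →L[ℝ] V) (f : RoughIto.HolderSpace V (W →L[ℝ] V) (k + 1) γ)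
        (z : RoughIto.CRP x p (p / 2) W) (y : RoughIto.CRP x p (p / 2) V),
        RoughIto.Solves a b f z y ↔ y = I (a, b, f, z)) ∧
      RoughIto.LocallyOfClass k ((1 - κ) * γ) I :=
  RoughIto.exists_itoMap hp x hk hγ hγ' hκ hκ' hpκ
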